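/- Let $\Omega\subset\mathbb{R}^2$ be a bounded open polygonal domain with Lipschitz boundary $\Gamma$ (it is enough that $\Omega$ is the interior of its closure and that $\overline\Omega$ is triangulated as below). Let $\nu>0$, $\boldsymbol f\in[L^2(\Omega)]^2$, $g\in L^2(\Gamma)$. For a velocity $\boldsymbol u$ and a pressure $p$ put $\boldsymbol\sigma=\nu\nabla\boldsymbol u-p\boldsymbol I$, and write $\sigma_{nn}=\boldsymbol\sigma\boldsymbol n\cdot\boldsymbol n$, $u_n=\boldsymbol u\cdot\boldsymbol n$, $u_t=\boldsymbol u\cdot\boldsymbol t$. The Stokes problem with tangential-velocity and normal-flux (TVNF) boundary conditions is $$-\nu\Delta\boldsymbol u+\nabla p=\boldsymbol f,\quad \nabla\cdot\boldsymbol u=0\ \text{ in }\Omega,\qquad \sigma_{nn}=g,\quad u_t=0\ \text{ on }\Gamma ,$$ where the first equation holds in the sense of distributions, $u_t=0$ holds in the sense of traces, and $\sigma_{nn}=g$ means that $\int_\Omega\boldsymbol\sigma:\nabla\boldsymbol\varphi\,d\boldsymbol x-\int_\Omega\boldsymbol f\cdot\boldsymbol\varphi\,d\boldsymbol x=\int_\Gamma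 g\,\varphi_n\,ds$ for all smooth vector fields $\boldsymbol\varphi$ with $\varphi_t=0$ on $\Gamma$. Let $\mathcal T_h$ be a finite conforming triangulation of $\overline\Omega$ into triangles and $\mathcal E_h$ the set of its edges. For $K\in\mathcal T_h$ let $h_K$ be its diameter, $\boldsymbol n$ its outward unit normal on $\partial K$, and on each edge fix one unit tangent $\boldsymbol t$, used for both adjacent triangles. Let $k\ge1$, $\tau>0$, $\varepsilon\in\{-1,1\}$, and \begin{align*} \boldsymbol{BDM}_h^k&=\{\boldsymbol v\in H(\mathrm{div},\Omega):\ \boldsymbol v|_K\in[\mathbb P_k(K)]^2\ \forall K\in\mathcal T_h\},\qquad Q_h^k=\{q\in L^2(\Omega):\ q|_K\in\mathbb P_k(K)\ \forall K\in\mathcal T_h\},\\ M_{h,0}^{k-1}&=\{\tilde v\in L^2(\mathcal E_h):\ \tilde v|_E\in\mathbb P_{k-1}(E)\ \forall E\in\mathcal E_h,\ \tilde v=0\text{ on }\Gamma\},\qquad \boldsymbol V_h=\boldsymbol{BDM}_h^k\times M_{h,0}^{k-1}. \end{align*} Let $\Psi^{k-1}$ be the $L^2(K)$-projection onto $\mathbb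 P_{k-1}(K)$ on each $K\in\mathcal T_h$ and $\Phi^{k-1}$ the $L^2(E)$-projection onto $\mathbb P_{k-1}(E)$ on each $E\in\mathcal E_h$. With gradients and divergences taken on each $K$, and traces on $\partial K$ taken from $K$, define \begin{align*} a((\boldsymbol w,\tilde w),(\boldsymbol v,\tilde v))&=\sum_{K\in\mathcal T_h}\Big(\int_K\nu\nabla\boldsymbol w:\nabla\boldsymbol v\,d\boldsymbol x-\int_{\partial K}\nu(\partial_n\boldsymbol w)_t(v_t-\tilde v)\,ds+\varepsilon\int_{\partial K}\nu(w_t-\tilde w)(\partial_n\boldsymbol v)_t\,ds\\ &\qquad\qquad+\nu\frac{\tau}{h_K}\int_{\partial K}\Phi^{k-1}(w_t-\tilde w)\,\Phi^{k-1}(v_t-\tilde v)\,ds\Big),\\ b((\boldsymbol v,\tilde v),q)&=-\sum_{K\in\mathcal T_h}\int_K q\,\nabla\cdot\boldsymbol v\,d\boldsymbol x,\qquad s(p,q)=\frac1\nu\int_\Omega(p-\Psi^{k-1}p)(q-\Psi^{k-1}q)\,d\boldsymbol x,\\ A((\boldsymbol w,\tilde w,r),(\boldsymbol v,\tilde v,q))&=a((\boldsymbol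 w,\tilde w),(\boldsymbol v,\tilde v))+b((\boldsymbol v,\tilde v),r)+b((\boldsymbol w,\tilde w),q)-s(r,q). \end{align*} Let $(\boldsymbol u,p)\in[H^1(\Omega)\cap H^2(\mathcal T_h)]^2\times L^2(\Omega)$ be a solution of the Stokes problem, where $H^2(\mathcal T_h)$ is the space of $v\in L^2(\Omega)$ with $v|_K\in H^2(K)$ for all $K\in\mathcal T_h$, and let $\tilde u=u_t$ on all edges of $\mathcal E_h$. Let $(\boldsymbol u_h,\tilde u_h,p_h)\in\boldsymbol V_h\times Q_h^k$ satisfy $$A((\boldsymbol u_h,\tilde u_h,p_h),(\boldsymbol v_h,\tilde v_h,q_h))=\int_\Omega\boldsymbol f\cdot\boldsymbol v_h\,d\boldsymbol x+\int_\Gamma g\,(\boldsymbol v_h)_n\,ds\qquad\text{for all }(\boldsymbol v_h,\tilde v_h,q_h)\in\boldsymbol V_h\times Q_h^k .$$ Then, for all $(\boldsymbol v_h,\tilde v_h,q_h)\in\boldsymbol V_h\times Q_h^k$, $$A((\boldsymbol u-\boldsymbol u_h,\tilde u-\tilde u_h,p-p_h),(\boldsymbol v_h,\tilde v_h,q_h))=-\,s(p,q_h).$$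 -/

import Mathlib

open MeasureTheory Filter
open scoped ContDiff Topology

namespace StokesHDG

noncomputable section

/-- The plane `ℝ²` with its Euclidean norm. -/
abbrev Plane : Type := EuclideanSpace ℝ (Fin 2)

/-! ### Weak derivatives and Sobolev spaces -/

/-- The classical partial derivative `∂φ/∂x_j`. -/
def pderiv (j : Fin 2) (φ : Plane → ℝ) (x : Plane) : ℝ :=
  fderiv ℝ φ x (EuclideanSpace.single j 1)

/-- `φ ∈ C_c^∞(D)`. -/
def IsTestFunction (D : Set Plane) (φ : Plane → ℝ) : Prop :=
  ContDiff ℝ ∞ φ ∧ HasCompactSupport φ ∧ tsupport φ ⊆ D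

/-- On the open set `D`, the locally integrable function `w'` is the weak derivative of `w`
in the direction `x_j`. -/
def IsWeakDeriv (D : Set Plane) (j : Fin 2) (w w' : Plane → ℝ) : Prop :=
  LocallyIntegrableOn w D ∧ LocallyIntegrableOn w' D ∧
    ∀ φ, IsTestFunction D φ → ∫ x in D, w x * pderiv j φ x = - ∫ x in D, w' x * φ x

/-- The weak derivative `∂_j w` on `D` (a representative of it; it is unique almost everywhere in
the open set `D` whenever it exists). -/
def weakDeriv (D : Set Plane) (j : Fin 2) (w : Plane → ℝ) : Plane → ℝ :=
  Classical.epsilon (IsWeakDeriv D j w)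

/-- `w ∈ L²(D)`. -/
def MemL2 (D : Set Plane) (w : Plane → ℝ) : Prop :=
  MemLp w 2 (volume.restrict D)

/-- `w ∈ H^m(D)`: all weak derivatives of order at most `m` exist and lie in `L²(D)`. -/
def MemSobolev : ℕ → Set Plane → (Plane → ℝ) → Prop
  | 0, D, w => MemL2 D w
  | m + 1, D, w => MemL2 D w ∧ ∀ j, ∃ w', IsWeakDeriv D j w w' ∧ MemSobolev m D w'

/-- `v ∈ H(div, D)`. -/
def MemHdiv (D : Set Plane) (v : Plane → Plane) : Prop :=
  (∀ i, MemL2 D (fun x => v x i)) ∧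
    ∃ d, MemL2 D d ∧ ∀ φ, IsTestFunction D φ →
      ∫ x in D, ∑ i, v x i * pderiv i φ x = - ∫ x in D, d x * φ x

/-! ### Triangulations -/

/-- A conforming triangulation of the closure of `Ω`: a finite simplicial complex made of triangles
(together with their edges and vertices) whose union is the closure of `Ω`. A face is given by
the finite set of its vertices. -/
structure Triangulation (Ω : Set Plane) extends Geometry.SimplicialComplex ℝ Plane where
  finite_faces : faces.Finite
  pure_faces : ∀ s ∈ faces, ∃ K ∈ faces, K.card = 3 ∧ s ⊆ K
  space_eq : toSimplicialComplex.space = closure Ω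

/-- The closed simplex with the given vertices. -/
def hull (s : Finset Plane) : Set Plane := convexHull ℝ (s : Set Plane)

/-- The open triangle with vertex set `K`. -/
def cell (K : Finset Plane) : Set Plane := interior (hull K)

/-- The three edges of the triangle `K`. -/
def sides (K : Finset Plane) : Finset (Finset Plane) := K.powersetCard 2

/-- The diameter `h_K` of the triangle `K`. -/
def cellDiam (K : Finset Plane) : ℝ := Metric.diam (hull K)

/-- Arc length on the edge `e`. -/
def arcLength (e : Finset Plane) : Measure Plane := (μH[1]).restrict (hull e)

namespace Triangulation

variable {Ω : Set Plane}

/-- The set `𝒯_h` of triangles. -/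
def triangles (T : Triangulation Ω) : Finset (Finset Plane) :=
  T.finite_faces.toFinset.filter (fun s => s.card = 3)

/-- The set `ℰ_h` of edges. -/
def edges (T : Triangulation Ω) : Finset (Finset Plane) :=
  T.finite_faces.toFinset.filter (fun s => s.card = 2)

open Classical in
/-- The edges that lie on `Γ = ∂Ω`. -/
def boundaryEdges (T : Triangulation Ω) : Finset (Finset Plane) :=
  T.edges.filter (fun e => hull e ⊆ frontier Ω)

end Triangulation

/-- `n` is the unit normal to the edge `e` of `K` that points out of `K`. -/
def IsOutwardNormal (K e : Finset Plane) (n : Plane) : Prop :=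
  ‖n‖ = 1 ∧ n ∈ (vectorSpan ℝ (e : Set Plane))ᗮ ∧
    ∀ a ∈ e, ∀ c ∈ K, c ∉ e → inner ℝ n (c - a) < 0

/-- The outward unit normal `n` of the triangle `K` on its edge `e`. -/
def outwardNormal (K e : Finset Plane) : Plane := Classical.epsilon (IsOutwardNormal K e)

/-- `t` is a unit vector tangential to the edge `e`. -/
def IsUnitTangent (e : Finset Plane) (t : Plane) : Prop :=
  ‖t‖ = 1 ∧ t ∈ vectorSpan ℝ (e : Set Plane)

/-! ### Traces -/

/-- `g ∈ L²(e)` is the trace on the edge `e` of `w ∈ H¹(K)`: there are smooth functions that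
converge to `w` in `H¹(K)` and whose restrictions to `e` converge to `g` in `L²(e)`. -/
def IsTrace (K e : Finset Plane) (w g : Plane → ℝ) : Prop :=
  MemSobolev 1 (cell K) w ∧ MemLp g 2 (arcLength e) ∧
    ∃ φ : ℕ → Plane → ℝ, (∀ n, ContDiff ℝ ∞ (φ n)) ∧
      Tendsto (fun n => eLpNorm (fun x => φ n x - w x) 2 (volume.restrict (cell K)))
        atTop (𝓝 0) ∧
      (∀ j, Tendsto (fun n => eLpNorm (fun x => pderiv j (φ n) x - weakDeriv (cell K) j w x) 2
        (volume.restrict (cell K))) atTop (𝓝 0)) ∧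
      Tendsto (fun n => eLpNorm (fun x => φ n x - g x) 2 (arcLength e)) atTop (𝓝 0)

/-- The trace on the edge `e` of a function `w ∈ H¹(K)`, taken from inside `K`. -/
def trace (K e : Finset Plane) (w : Plane → ℝ) : Plane → ℝ := Classical.epsilon (IsTrace K e w)

/-- The component `w · d` on the edge `e` of the trace of the vector field `w` taken from `K`:
`w_n` for `d = n`, and `w_t` for `d = t`. -/
def traceComp (K e : Finset Plane) (d : Plane) (w : Plane → Plane) (x : Plane) : ℝ :=
  ∑ i, trace K e (fun y => w y i) x * d i

/-- The tangential component `(∂_n w)_t` on the edge `e` of the normal derivative of the vector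
field `w`, from inside `K`, with `n` the outward normal of `K`. -/
def normalDerivTangential (K e : Finset Plane) (t : Plane) (w : Plane → Plane) (x : Plane) : ℝ :=
  ∑ i, (∑ j, trace K e (weakDeriv (cell K) j (fun y => w y i)) x * outwardNormal K e j) * t i

/-! ### Polynomials and local projections -/

/-- The function on the plane given by a polynomial in two variables. -/
def polyFun (P : MvPolynomial (Fin 2) ℝ) (x : Plane) : ℝ := MvPolynomial.eval (fun i => x i) P

/-- `w` agrees `μ`-almost everywhere with a polynomial of total degree at most `m`. With `μ` the
area on a triangle `K` this is `w|_K ∈ ℙ_m(K)`; with `μ` the arc length on an edge `E` this is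
`w|_E ∈ ℙ_m(E)`, since the polynomials in the arc length parameter of degree at most `m` are the
restrictions to `E` of the polynomials of total degree at most `m`. -/
def IsPolyOn (m : ℕ) (μ : Measure Plane) (w : Plane → ℝ) : Prop :=
  ∃ P : MvPolynomial (Fin 2) ℝ, P.totalDegree ≤ m ∧ w =ᵐ[μ] polyFun P

/-- `π` is the `L²(μ)`-projection of `w` on the polynomials of degree at most `m`. -/
def IsPolyProj (m : ℕ) (μ : Measure Plane) (w π : Plane → ℝ) : Prop :=
  IsPolyOn m μ π ∧ ∀ Q : MvPolynomial (Fin 2) ℝ, Q.totalDegree ≤ m →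
    ∫ x, π x * polyFun Q x ∂μ = ∫ x, w x * polyFun Q x ∂μ

/-- The `L²(μ)`-projection on the polynomials of degree at most `m`. -/
def polyProj (m : ℕ) (μ : Measure Plane) (w : Plane → ℝ) : Plane → ℝ :=
  Classical.epsilon (IsPolyProj m μ w)

/-- The projection `Φ^m_E` on the edge `E = e`. -/
def edgeProj (m : ℕ) (e : Finset Plane) (w : Plane → ℝ) : Plane → ℝ :=
  polyProj m (arcLength e) w

/-- The projection `Ψ^m`, given on each triangle `K` by `Ψ^m_K`. -/
def cellwiseProj {Ω : Set Plane} (T : Triangulation Ω) (m : ℕ) (w : Plane → ℝ) (x : Plane) : ℝ :=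
  ∑ K ∈ T.triangles, (cell K).indicator (polyProj m (volume.restrict (cell K)) w) x

/-! ### Function spaces on a triangulation -/

section Spaces

variable {Ω : Set Plane} (T : Triangulation Ω)

/-- `w ∈ H^m(𝒯_h)`. -/
def MemBroken (m : ℕ) (w : Plane → ℝ) : Prop :=
  MemL2 Ω w ∧ ∀ K ∈ T.triangles, MemSobolev m (cell K) w

/-- The Brezzi-Douglas-Marini space `BDM_h^k`. -/
def MemBDM (k : ℕ) (v : Plane → Plane) : Prop :=
  MemHdiv Ω v ∧
    ∀ K ∈ T.triangles, ∀ i, IsPolyOn k (volume.restrict (cell K)) (fun x => v x i)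

/-- The pressure space `Q_h^k`. -/
def MemPressure (k : ℕ) (q : Plane → ℝ) : Prop :=
  MemL2 Ω q ∧ ∀ K ∈ T.triangles, IsPolyOn k (volume.restrict (cell K)) q

/-- The space `M_{h,0}^m` of multipliers on the edges. -/
def MemMultiplier (m : ℕ) (μ : Plane → ℝ) : Prop :=
  (∀ e ∈ T.edges, MemLp μ 2 (arcLength e) ∧ IsPolyOn m (arcLength e) μ) ∧
    ∀ e ∈ T.boundaryEdges, μ =ᵐ[arcLength e] 0

/-- `(v, v', q) ∈ BDM_h^k × M_{h,0}^{k-1} × Q_h^k`. -/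
def MemDiscrete (k : ℕ) (v : Plane → Plane) (v' q : Plane → ℝ) : Prop :=
  MemBDM T k v ∧ MemMultiplier T (k - 1) v' ∧ MemPressure T k q

end Spaces

/-! ### The Stokes problem -/

section Problem

variable {Ω : Set Plane} (T : Triangulation Ω)

open Classical in
/-- `∫_Γ g F(n) ds` as a sum over the boundary edges, each seen from the triangle `K` that it
belongs to; `F K e` is the integrand on the edge `e` of `K`. -/
def boundaryIntegral (F : Finset Plane → Finset Plane → Plane → ℝ) : ℝ :=
  ∑ K ∈ T.triangles, ∑ e ∈ (sides K).filter (fun e => e ∈ T.boundaryEdges),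
    ∫ x, F K e x ∂(arcLength e)

/-- The component `σ_{ij}` of the stress `σ = ν ∇u - p I` in `Ω`. -/
def stress (Ω : Set Plane) (ν : ℝ) (u : Plane → Plane) (p : Plane → ℝ) (i j : Fin 2)
    (x : Plane) : ℝ :=
  ν * weakDeriv Ω j (fun y => u y i) x - if i = j then p x else 0

/-- `(u, p) ∈ [H¹(Ω)]² × L²(Ω)` solves the Stokes problem
`-ν Δu + ∇p = f` and `∇·u = 0` in `Ω`, `σ_nn = g` and `u_t = 0` on `Γ`.
The vector `t e` is the unit tangent chosen on the edge `e`. -/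
structure IsStokesSolution (t : Finset Plane → Plane) (ν : ℝ) (f : Plane → Plane) (g : Plane → ℝ)
    (u : Plane → Plane) (p : Plane → ℝ) : Prop where
  velocity_mem : ∀ i, MemSobolev 1 Ω (fun x => u x i)
  pressure_mem : MemL2 Ω p
  /-- `-ν Δu + ∇p = f` in `Ω`, in the sense of distributions. -/
  momentum : ∀ i φ, IsTestFunction Ω φ →
    ν * (∑ j, ∫ x in Ω, weakDeriv Ω j (fun y => u y i) x * pderiv j φ x)
      - ∫ x in Ω, p x * pderiv i φ x = ∫ x in Ω, f x i * φ x
  /-- `∇·u = 0` almost everywhere in `Ω`. -/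
  incompressible : (fun x => ∑ i, weakDeriv Ω i (fun y => u y i) x) =ᵐ[volume.restrict Ω] 0
  /-- `σ_nn = g` on `Γ`. As `p` is only in `L²(Ω)`, this is meant in the weak sense, through Green's
  formula `∫_Γ σn · φ = ∫_Ω σ : ∇φ + ∫_Ω (∇·σ) · φ` with `-∇·σ = f`, for the smooth fields `φ` with
  `φ_t = 0` on `Γ`, for which `σn · φ = σ_nn φ_n`. -/
  normal_flux : ∀ φ : Plane → Plane, ContDiff ℝ ∞ φ →
    (∀ e ∈ T.boundaryEdges, ∀ x ∈ hull e, inner ℝ (φ x) (t e) = 0) →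
    (∫ x in Ω, ∑ i, ∑ j, stress Ω ν u p i j x * pderiv j (fun y => φ y i) x)
      - ∫ x in Ω, ∑ i, f x i * φ x i
      = boundaryIntegral T (fun K e x => g x * inner ℝ (φ x) (outwardNormal K e))
  /-- `u_t = 0` on `Γ`, in the sense of traces. -/
  tangential_velocity : ∀ K ∈ T.triangles, ∀ e ∈ sides K, e ∈ T.boundaryEdges →
    traceComp K e (t e) u =ᵐ[arcLength e] 0

/-! ### The stabilised hybrid discontinuous Galerkin method -/

/-- The bilinear form `a((w, w'), (v, v'))`. -/
def formA (t : Finset Plane → Plane) (ν τ ε : ℝ) (k : ℕ)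
    (w : Plane → Plane) (w' : Plane → ℝ) (v : Plane → Plane) (v' : Plane → ℝ) : ℝ :=
  ∑ K ∈ T.triangles,
    ((∫ x in cell K, ν * ∑ i, ∑ j,
        weakDeriv (cell K) j (fun y => w y i) x * weakDeriv (cell K) j (fun y => v y i) x)
      - (∑ e ∈ sides K, ∫ x, ν * normalDerivTangential K e (t e) w x
          * (traceComp K e (t e) v x - v' x) ∂(arcLength e))
      + ε * (∑ e ∈ sides K, ∫ x, ν * (traceComp K e (t e) w x - w' x)
          * normalDerivTangential K e (t e) v x ∂(arcLength e))
      + ν * (τ / cellDiam K) * (∑ e ∈ sides K, ∫ x,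
          edgeProj (k - 1) e (fun y => traceComp K e (t e) w y - w' y) x
          * edgeProj (k - 1) e (fun y => traceComp K e (t e) v y - v' y) x ∂(arcLength e)))

/-- The bilinear form `b((v, v'), q)`; it does not depend on `v'`. -/
def formB (v : Plane → Plane) (q : Plane → ℝ) : ℝ :=
  - ∑ K ∈ T.triangles, ∫ x in cell K, q x * ∑ i, weakDeriv (cell K) i (fun y => v y i) x

/-- The stabilisation `s(p, q)`. -/
def stab (ν : ℝ) (k : ℕ) (p q : Plane → ℝ) : ℝ :=
  1 / ν * ∫ x in Ω, (p x - cellwiseProj T (k - 1) p x) * (q x - cellwiseProj T (k - 1) q x)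

/-- The bilinear form `A((w, w', r), (v, v', q))` of the method. -/
def formFull (t : Finset Plane → Plane) (ν τ ε : ℝ) (k : ℕ)
    (w : Plane → Plane) (w' r : Plane → ℝ) (v : Plane → Plane) (v' q : Plane → ℝ) : ℝ :=
  formA T t ν τ ε k w w' v v' + formB T v r + formB T w q - stab T ν k r q

/-- `(u_h, u_h', p_h)` is a solution of the discrete problem. -/
def IsDiscreteSolution (t : Finset Plane → Plane) (ν τ ε : ℝ) (k : ℕ) (f : Plane → Plane)
    (g : Plane → ℝ) (uh : Plane → Plane) (uh' ph : Plane → ℝ) : Prop :=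
  MemDiscrete T k uh uh' ph ∧
    ∀ v v' q, MemDiscrete T k v v' q →
      formFull T t ν τ ε k uh uh' ph v v' q =
        (∫ x in Ω, ∑ i, f x i * v x i)
          + boundaryIntegral T (fun K e x => g x * traceComp K e (outwardNormal K e) v x)

end Problem

end

end StokesHDG

open StokesHDG

/-! The form `A` is linear in its first triple, and the discrete problem prescribes its value at the
discrete solution. Everything therefore rests on consistency (`IsStokesSolution.formFull_eq`):
inserting the exact solution must reproduce the load up to `-s(p, q)`.

For the exact solution the jump `u_t - u'` is zero, which removes the `ε` and `τ` terms, and `b(u,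
q) = 0` by incompressibility. What remains is Green's formula on each triangle for the rows of the
stress, whose divergence is `-f` (`IsStokesSolution.green_stress`). On an edge, `σn · v = σ_nn v_n +
σ_nt v_t`, and `σ_nt = ν (∂_n u)_t` because the pressure part `p n` has no tangential component. The
consistency term of `a` thus trades `v_t` for the multiplier `v'` and leaves the flux `σ_nn v_n +
σ_nt v'`. Across an interior edge the normal changes sign while the tangent is shared. The rows of
`σ` and the field `v` have square integrable divergence on `Ω`, so `σn` and `v_n` change sign too,
and the two fluxes cancel. On a boundary edge `v' = 0` and `σ_nn = g`, which gives the boundary load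
(`IsStokesSolution.sum_integral_residualFlux`).

Two points need care. The pressure is only in `L²(Ω)`, but the momentum equation expresses its
gradient on a triangle through `f` and second derivatives of `u`, so it is in `H¹(K)` and has
traces. The matching of normal traces and the flux condition are given in weak form only; testing
with functions that vanish on all edges but one turns them into almost everywhere identities
(`Triangulation.ae_eq_zero_on_edge`). The count of triangles at an edge and their opposite normals
come from the local geometry (`Triangulation.edge_cases`).

Traces are limits of smooth functions. They rest on the density of smooth functions in `H¹(K)`, by
mollification after shrinking towards an interior ball, and on a trace inequality; the divergence
theorem on a triangle comes from explicit integration. Weak derivatives, traces and projections are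
chosen by `Classical.epsilon` and are pinned down only almost everywhere, so uniqueness has to
precede every linearity statement. -/

namespace StokesHDG

noncomputable section

/-! ### Integration over a triangle -/

/-- The determinant of two plane vectors. -/
def cross (x y : Plane) : ℝ := x 0 * y 1 - x 1 * y 0

theorem mem_convexHull_triple {a b c z : Plane} :
    z ∈ convexHull ℝ ({a, b, c} : Set Plane) ↔
      ∃ x y : ℝ, 0 ≤ x ∧ 0 ≤ y ∧ x + y ≤ 1 ∧ z = c + x • (a - c) + y • (b - c) := by
  constructor
  · intro hz
    have hconv : Convex ℝ {z : Plane | ∃ x y : ℝ, 0 ≤ x ∧ 0 ≤ y ∧ x + y ≤ 1 ∧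
        z = c + x • (a - c) + y • (b - c)} := by
      rintro _ ⟨x, y, hx, hy, hxy, rfl⟩ _ ⟨x', y', hx', hy', hxy', rfl⟩ s r hs hr hsr
      refine ⟨s * x + r * x', s * y + r * y', by positivity, by positivity, ?_, ?_⟩
      · nlinarith
      · obtain rfl : r = 1 - s := by linarith
        module
    refine convexHull_min ?_ hconv hz
    rintro w (rfl | rfl | rfl)
    · exact ⟨1, 0, by simp, by simp, by simp, by simp⟩
    · exact ⟨0, 1, by simp, by simp, by simp, by simp⟩
    · exact ⟨0, 0, by simp, by simp, by simp, by simp⟩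
  · rintro ⟨x, y, hx, hy, hxy, rfl⟩
    have hc := convex_convexHull ℝ ({a, b, c} : Set Plane)
    have ha : a ∈ convexHull ℝ ({a, b, c} : Set Plane) := subset_convexHull _ _ (by simp)
    have hb : b ∈ convexHull ℝ ({a, b, c} : Set Plane) := subset_convexHull _ _ (by simp)
    have hcc : c ∈ convexHull ℝ ({a, b, c} : Set Plane) := subset_convexHull _ _ (by simp)
    have := hc.sum_mem (t := Finset.univ) (w := ![x, y, 1 - x - y]) (z := ![a, b, c])
      (by intro i _; fin_cases i <;> simp <;> linarith)
      (by simp [Fin.sum_univ_three])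
      (by intro i _; fin_cases i <;> simpa)
    convert this using 1
    simp [Fin.sum_univ_three]
    module

/-- The standard parametrisation of the triangle with vertices `a`, `b`, `c`. -/
def triParam (a b c : Plane) (z : Plane) : Plane := c + z 0 • (a - c) + z 1 • (b - c)

def triMatrix (a b c : Plane) : Matrix (Fin 2) (Fin 2) ℝ :=
  !![a 0 - c 0, b 0 - c 0; a 1 - c 1, b 1 - c 1]

def triDeriv (a b c : Plane) : Plane →L[ℝ] Plane :=
  LinearMap.toContinuousLinearMap (Matrix.toEuclideanLin (triMatrix a b c))

theorem triDeriv_apply (a b c z : Plane) :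
    triDeriv a b c z = z 0 • (a - c) + z 1 • (b - c) := by
  ext i
  fin_cases i <;>
  simp [triDeriv, triMatrix, Matrix.toEuclideanLin, Matrix.mulVec, dotProduct,
    Fin.sum_univ_two] <;> ring

theorem triDeriv_det (a b c : Plane) : (triDeriv a b c).det = cross (a - c) (b - c) := by
  have : (triDeriv a b c).det = LinearMap.det (Matrix.toEuclideanLin (triMatrix a b c)) := rfl
  rw [this, Matrix.toEuclideanLin_eq_toLin_orthonormal, LinearMap.det_toLin, Matrix.det_fin_two]
  simp [triMatrix, cross]
  ring

def refTriangle : Set (ℝ × ℝ) := {z | 0 ≤ z.1 ∧ 0 ≤ z.2 ∧ z.1 + z.2 ≤ 1}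

/-- Fubini, with the first coordinate innermost: in the image triangle this is the direction `a -
c`, along which the fundamental theorem of calculus is applied later. -/
theorem integral_refTriangle {G : ℝ × ℝ → ℝ} (hG : Continuous G) :
    ∫ z in refTriangle, G z = ∫ y in (0 : ℝ)..1, ∫ x in (0 : ℝ)..(1 - y), G (x, y) := by
  have hcl : IsClosed refTriangle := by
    refine IsClosed.inter ?_ (IsClosed.inter ?_ ?_)
    · exact isClosed_le continuous_const continuous_fst
    · exact isClosed_le continuous_const continuous_snd
    · exact isClosed_le (continuous_fst.add continuous_snd) continuous_const
  have hm : MeasurableSet refTriangle := hcl.measurableSet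
  have hcomp : IsCompact refTriangle := by
    refine (isCompact_Icc (a := ((0 : ℝ), (0 : ℝ))) (b := (1, 1))).of_isClosed_subset hcl ?_
    rintro ⟨x, y⟩ ⟨h1, h2, h3⟩
    simp at h1 h2 h3
    exact ⟨⟨h1, h2⟩, ⟨by simp; linarith, by simp; linarith⟩⟩
  have hint : Integrable (refTriangle.indicator G) (volume.prod volume) := by
    rw [integrable_indicator_iff hm]
    exact hG.continuousOn.integrableOn_compact hcomp
  rw [← integral_indicator hm, Measure.volume_eq_prod, integral_prod_symm _ hint,
    intervalIntegral.integral_of_le zero_le_one, ← integral_Icc_eq_integral_Ioc,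
    ← integral_indicator measurableSet_Icc]
  congr 1
  funext y
  by_cases hy : y ∈ Set.Icc (0 : ℝ) 1
  · rw [Set.indicator_of_mem hy, intervalIntegral.integral_of_le (by linarith [hy.2]),
      ← integral_Icc_eq_integral_Ioc, ← integral_indicator measurableSet_Icc]
    congr 1
    funext x
    by_cases hx : x ∈ Set.Icc (0 : ℝ) (1 - y)
    · rw [Set.indicator_of_mem hx, Set.indicator_of_mem]
      exact ⟨hx.1, hy.1, by have := hx.2; simp; linarith⟩
    · rw [Set.indicator_of_notMem hx, Set.indicator_of_notMem]
      rintro ⟨h1, h2, h3⟩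
      simp at h1 h2 h3
      exact hx ⟨h1, by linarith⟩
  · rw [Set.indicator_of_notMem hy]
    convert integral_zero ℝ ℝ with x
    rw [Set.indicator_of_notMem]
    rintro ⟨h1, h2, h3⟩
    simp at h1 h2 h3
    exact hy ⟨h2, by linarith⟩

/-- Change of variables by the affine map `triParam`, whose Jacobian determinant is the cross
product of the two sides at `c`. -/
theorem integral_triangle {a b c : Plane} (hD : cross (a - c) (b - c) ≠ 0) {G : Plane → ℝ}
    (hG : Continuous G) :
    ∫ z in convexHull ℝ ({a, b, c} : Set Plane), G z =
      |cross (a - c) (b - c)| *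
        ∫ y in (0 : ℝ)..1, ∫ x in (0 : ℝ)..(1 - y), G (c + x • (a - c) + y • (b - c)) := by
  set e : Plane ≃ᵐ ℝ × ℝ :=
    (MeasurableEquiv.toLp 2 (Fin 2 → ℝ)).symm.trans (MeasurableEquiv.finTwoArrow (α := ℝ)) with he
  have hep : MeasurePreserving e volume volume :=
    (volume_preserving_finTwoArrow ℝ).comp
      (EuclideanSpace.volume_preserving_symm_measurableEquiv_toLp (Fin 2))
  have hee : ∀ z, e z = (z 0, z 1) := fun z => rfl
  have himage : convexHull ℝ ({a, b, c} : Set Plane) = triParam a b c '' (e ⁻¹' refTriangle) := by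
    ext z
    rw [mem_convexHull_triple]
    constructor
    · rintro ⟨x, y, hx, hy, hxy, rfl⟩
      exact ⟨!₂[x, y], ⟨hx, hy, hxy⟩, by simp [triParam]⟩
    · rintro ⟨w, ⟨h1, h2, h3⟩, rfl⟩
      exact ⟨w 0, w 1, h1, h2, h3, rfl⟩
  have hm : MeasurableSet refTriangle := by
    refine MeasurableSet.inter ?_ (MeasurableSet.inter ?_ ?_)
    · exact measurableSet_le measurable_const measurable_fst
    · exact measurableSet_le measurable_const measurable_snd
    · exact measurableSet_le (measurable_fst.add measurable_snd) measurable_const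
  have hderiv : ∀ z, HasFDerivAt (triParam a b c) (triDeriv a b c) z := by
    intro z
    have : triParam a b c = fun z => c + triDeriv a b c z := by
      funext z; rw [triDeriv_apply, triParam, add_assoc]
    rw [this]
    exact (triDeriv a b c).hasFDerivAt.const_add c
  have hinj : Function.Injective (triParam a b c) := by
    intro z w h
    have h0 := congrArg (fun v : Plane => v 0) h
    have h1 := congrArg (fun v : Plane => v 1) h
    simp [triParam, cross] at h0 h1 hD
    have e0 : (z 0 - w 0) * ((a 0 - c 0) * (b 1 - c 1) - (a 1 - c 1) * (b 0 - c 0)) = 0 := by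
      linear_combination (b 1 - c 1) * h0 - (b 0 - c 0) * h1
    have e1 : (z 1 - w 1) * ((a 0 - c 0) * (b 1 - c 1) - (a 1 - c 1) * (b 0 - c 0)) = 0 := by
      linear_combination (a 0 - c 0) * h1 - (a 1 - c 1) * h0
    have f0 := (mul_eq_zero.1 e0).resolve_right hD
    have f1 := (mul_eq_zero.1 e1).resolve_right hD
    ext i; fin_cases i <;> simp <;> linarith
  rw [himage, integral_image_eq_integral_abs_det_fderiv_smul volume (e.measurable hm)
    (fun z _ => (hderiv z).hasFDerivWithinAt) hinj.injOn, triDeriv_det]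
  simp only [smul_eq_mul]
  rw [integral_const_mul]
  congr 1
  have hG' : Continuous fun w : ℝ × ℝ => G (c + w.1 • (a - c) + w.2 • (b - c)) := by fun_prop
  rw [← integral_refTriangle hG', ← hep.setIntegral_preimage_emb e.measurableEmbedding]
  rfl

/-- The integral over a triangle of a derivative along one of its sides. -/
theorem integral_triangle_fderiv {a b c : Plane} (hD : cross (a - c) (b - c) ≠ 0)
    {F : Plane → ℝ} (hF : ContDiff ℝ 1 F) :
    ∫ z in convexHull ℝ ({a, b, c} : Set Plane), fderiv ℝ F z (a - c) =
      |cross (a - c) (b - c)| * ((∫ s in (0 : ℝ)..1, F (AffineMap.lineMap a b s))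
        - ∫ s in (0 : ℝ)..1, F (AffineMap.lineMap c b s)) := by
  have hc : Continuous fun z => fderiv ℝ F z (a - c) :=
    (hF.continuous_fderiv one_ne_zero).clm_apply continuous_const
  rw [integral_triangle hD hc, ← intervalIntegral.integral_sub]
  · congr 1
    refine intervalIntegral.integral_congr fun y _ => ?_
    have hd : ∀ x, HasDerivAt (fun x : ℝ => F (c + x • (a - c) + y • (b - c)))
        (fderiv ℝ F (c + x • (a - c) + y • (b - c)) (a - c)) x := by
      intro x
      have h1 : HasDerivAt (fun x : ℝ => c + x • (a - c) + y • (b - c)) (a - c) x := by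
        have := (((hasDerivAt_id x).smul_const (a - c)).const_add c).add_const (y • (b - c))
        simpa using this
      exact ((hF.differentiable one_ne_zero _).hasFDerivAt).comp_hasDerivAt x h1
    -- The segment at height `y` parallel to `a - c` runs from the side `cb` (at `x = 0`) to the
    -- side `ab` (at `x = 1 - y`).
    rw [intervalIntegral.integral_eq_sub_of_hasDerivAt (fun x _ => hd x)]
    · congr 2
      · simp only [AffineMap.lineMap_apply_module]; module
      · simp only [AffineMap.lineMap_apply_module]; module
    · apply Continuous.intervalIntegrable
      exact hc.comp (by fun_prop)
  · apply Continuous.intervalIntegrable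
    have := hF.continuous
    fun_prop
  · apply Continuous.intervalIntegrable
    have := hF.continuous
    fun_prop

/-! ### Edges, normals and the divergence theorem on a triangle -/

theorem inner_plane (x y : Plane) : inner ℝ x y = x 0 * y 0 + x 1 * y 1 := by
  simp [PiLp.inner_apply, Fin.sum_univ_two]
  ring

theorem norm_sq_plane (x : Plane) : ‖x‖ ^ 2 = x 0 ^ 2 + x 1 ^ 2 := by
  rw [← real_inner_self_eq_norm_sq, inner_plane]
  ring

/-- `K` is the vertex set of a non-degenerate triangle. -/
structure IsTriangle (K : Finset Plane) : Prop where
  card_eq : K.card = 3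
  indep : AffineIndependent ℝ ((↑) : K → Plane)

/-- If the cross product vanished, all three points would lie on the line through `c` in direction
`a - c`. -/
theorem cross_ne_zero {a b c : Plane} (h : AffineIndependent ℝ ![a, b, c]) :
    cross (a - c) (b - c) ≠ 0 := by
  intro h0
  rw [affineIndependent_iff_not_collinear_set] at h
  apply h
  by_cases hac : a = c
  · subst hac
    simpa [Set.pair_comm b a] using collinear_pair ℝ a b
  have hne : (a 0 - c 0) ^ 2 + (a 1 - c 1) ^ 2 ≠ 0 := by
    intro h2
    apply hac
    ext i
    fin_cases i <;> simp <;> nlinarith [sq_nonneg (a 0 - c 0), sq_nonneg (a 1 - c 1)]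
  rw [collinear_iff_of_mem (p₀ := c) (by simp)]
  refine ⟨a - c, ?_⟩
  simp [cross] at h0
  rintro p (rfl | rfl | rfl)
  · exact ⟨1, by simp⟩
  -- The coefficient is that of the orthogonal projection of `b - c` on `a - c`.
  · refine ⟨((p 0 - c 0) * (a 0 - c 0) + (p 1 - c 1) * (a 1 - c 1)) /
      ((a 0 - c 0) ^ 2 + (a 1 - c 1) ^ 2), ?_⟩
    ext i
    fin_cases i
    · simp
      field_simp
      linear_combination (-(a 1 - c 1)) * h0
    · simp
      field_simp
      linear_combination (a 0 - c 0) * h0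
  · exact ⟨0, by simp⟩

theorem IsTriangle.cross_ne_zero {a b c : Plane} (hab : a ≠ b) (hac : a ≠ c) (hbc : b ≠ c)
    (h : AffineIndependent ℝ ((↑) : ({a, b, c} : Finset Plane) → Plane)) :
    cross (a - c) (b - c) ≠ 0 := by
  apply StokesHDG.cross_ne_zero
  have hinj : Function.Injective ![a, b, c] := by
    simp [Function.Injective, Fin.forall_fin_succ, hab, hac, hbc, hab.symm, hac.symm, hbc.symm]
  let f : Fin 3 ↪ ({a, b, c} : Finset Plane) :=
    ⟨fun i => ⟨![a, b, c] i, by fin_cases i <;> simp⟩, fun i j hij => hinj (Subtype.ext_iff.1 hij)⟩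
  have := h.comp_embedding f
  exact this

theorem hull_pair (a b : Plane) : hull {a, b} = segment ℝ a b := by
  simp [hull, convexHull_pair]

/-- The affine parametrisation of a segment multiplies one-dimensional Hausdorff measure by the
distance of the end points. This turns edge integrals into interval integrals. -/
theorem arcLength_pair (a b : Plane) :
    arcLength {a, b} = ENNReal.ofReal (dist a b) •
      (volume.restrict (Set.Icc (0 : ℝ) 1)).map (AffineMap.lineMap a b) := by
  have hc : Continuous (AffineMap.lineMap a b : ℝ → Plane) := AffineMap.lineMap_continuous
  ext s hs
  rw [arcLength, Measure.restrict_apply hs, hull_pair, Measure.smul_apply,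
    Measure.map_apply hc.measurable hs, Measure.restrict_apply (hc.measurable hs)]
  have : s ∩ segment ℝ a b =
      AffineMap.lineMap a b '' ((AffineMap.lineMap a b : ℝ → Plane) ⁻¹' s ∩ Set.Icc 0 1) := by
    rw [segment_eq_image_lineMap, Set.image_preimage_inter]
  rw [this, hausdorffMeasure_lineMap_image, hausdorffMeasure_real, ENNReal.smul_def, smul_eq_mul,
    smul_eq_mul]
  congr 1
  rw [← coe_nndist, ENNReal.ofReal_coe_nnreal]

theorem integral_arcLength_pair (a b : Plane) {F : Plane → ℝ} (hF : Continuous F) :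
    ∫ x, F x ∂(arcLength {a, b}) =
      dist a b * ∫ s in (0 : ℝ)..1, F (AffineMap.lineMap a b s) := by
  have hc : Continuous (AffineMap.lineMap a b : ℝ → Plane) := AffineMap.lineMap_continuous
  rw [arcLength_pair, integral_smul_measure, integral_map hc.aemeasurable hF.aestronglyMeasurable,
    intervalIntegral.integral_of_le zero_le_one, integral_Icc_eq_integral_Ioc,
    ENNReal.toReal_ofReal dist_nonneg, smul_eq_mul]

theorem isFiniteMeasure_arcLength {e : Finset Plane} (he : e.card = 2) :
    IsFiniteMeasure (arcLength e) := by
  obtain ⟨a, b, -, rfl⟩ := Finset.card_eq_two.1 he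
  constructor
  rw [arcLength, Measure.restrict_apply_univ, hull_pair, hausdorffMeasure_segment]
  exact edist_lt_top _ _

theorem isCompact_hull (s : Finset Plane) : IsCompact (hull s) :=
  s.finite_toSet.isCompact_convexHull ℝ

theorem convex_hull (s : Finset Plane) : Convex ℝ (hull s) := convex_convexHull ℝ _

theorem cell_ae_eq_hull (K : Finset Plane) : cell K =ᵐ[volume] hull K :=
  interior_ae_eq_of_null_frontier ((convex_hull K).addHaar_frontier volume)

theorem restrict_cell (K : Finset Plane) : volume.restrict (cell K) = volume.restrict (hull K) :=
  Measure.restrict_congr_set (cell_ae_eq_hull K)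

theorem isOpen_cell (K : Finset Plane) : IsOpen (cell K) := isOpen_interior

instance (K : Finset Plane) : IsFiniteMeasure (volume.restrict (cell K)) := by
  rw [restrict_cell]
  exact ⟨by simpa using (isCompact_hull K).measure_lt_top⟩

/-- Only one vertex is off the edge, and by orthogonality the choice of the base point on the edge
is immaterial, so a single inequality remains. -/
theorem isOutwardNormal_iff {a b c n : Plane} (hac : a ≠ c) (hbc : b ≠ c) :
    IsOutwardNormal {a, b, c} {a, b} n ↔
      ‖n‖ = 1 ∧ inner ℝ n (b - a) = 0 ∧ inner ℝ n (c - a) < 0 := by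
  rw [IsOutwardNormal]
  refine and_congr_right fun _ => ?_
  have hv : n ∈ (vectorSpan ℝ (({a, b} : Finset Plane) : Set Plane))ᗮ ↔
      inner ℝ n (b - a) = 0 := by
    rw [Finset.coe_insert, Finset.coe_singleton, Set.pair_comm, vectorSpan_pair,
      Submodule.mem_orthogonal_singleton_iff_inner_left]
    rfl
  rw [hv]
  refine and_congr_right fun h0 => ?_
  constructor
  · intro h
    exact h a (by simp) c (by simp) (by simp [hac.symm, hbc.symm])
  · intro h x hx y hy hyx
    simp only [Finset.mem_insert, Finset.mem_singleton, not_or] at hx hy hyx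
    have hyc : y = c := by tauto
    subst hyc
    rcases hx with rfl | rfl
    · exact h
    · simp only [inner_sub_right] at h h0 ⊢
      linarith

/-- The length of an edge times the height above it. -/
theorem dist_mul_inner_normal {a b c n : Plane} (hn : ‖n‖ = 1) (h0 : inner ℝ n (b - a) = 0)
    (h1 : inner ℝ n (c - a) < 0) :
    dist a b * inner ℝ n (a - c) = |cross (a - c) (b - c)| := by
  have hn2 := norm_sq_plane n
  have hab := norm_sq_plane (a - b)
  rw [hn] at hn2
  have hpos : 0 ≤ dist a b * inner ℝ n (a - c) := by
    refine mul_nonneg dist_nonneg ?_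
    simp only [inner_sub_right] at h1 ⊢
    linarith
  rw [← abs_of_nonneg hpos, ← sq_eq_sq_iff_abs_eq_abs, mul_pow, dist_eq_norm, hab]
  rw [inner_plane] at h0 ⊢
  simp [cross] at *
  generalize n 0 = p at *
  generalize n 1 = q at *
  -- Since `n = (p, q)` is a unit vector orthogonal to `b - a`, the side is `r` times the rotated
  -- normal `(-q, p)`. After this substitution the claim is a polynomial identity modulo `p² + q² =
  -- 1`.
  have e1 : b 0 - a 0 = -q * (p * (b 1 - a 1) - q * (b 0 - a 0)) := by
    linear_combination p * h0 + (b 0 - a 0) * hn2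
  have e2 : b 1 - a 1 = p * (p * (b 1 - a 1) - q * (b 0 - a 0)) := by
    linear_combination q * h0 + (b 1 - a 1) * hn2
  generalize (p * (b 1 - a 1) - q * (b 0 - a 0)) = r at *
  have hb0 : b 0 = a 0 - q * r := by linarith
  have hb1 : b 1 = a 1 + p * r := by linarith
  rw [hb0, hb1]
  linear_combination (-1) * r ^ 2 * (p * (a 0 - c 0) + q * (a 1 - c 1)) ^ 2 * hn2

/-- A quarter turn of `b - a`, normalised, is orthogonal to the edge. The sign `s` is that of the
cross product and selects the side away from `c`. -/
theorem exists_outwardNormal {a b c : Plane} (hac : a ≠ c) (hbc : b ≠ c)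
    (hD : cross (a - c) (b - c) ≠ 0) : ∃ n, IsOutwardNormal {a, b, c} {a, b} n := by
  simp only [isOutwardNormal_iff hac hbc]
  have hab : 0 < ‖b - a‖ := by
    rw [norm_pos_iff, sub_ne_zero]
    rintro rfl
    apply hD
    simp [cross]
    ring
  have hsq := norm_sq_plane (b - a)
  have key : ∀ s : ℝ, (s = 1 ∨ s = -1) → 0 < s * cross (a - c) (b - c) →
      ∃ n : Plane, ‖n‖ = 1 ∧ inner ℝ n (b - a) = 0 ∧ inner ℝ n (c - a) < 0 := by
    intro s hs hpos
    refine ⟨(s / ‖b - a‖) • !₂[b 1 - a 1, -(b 0 - a 0)], ?_, ?_, ?_⟩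
    · have : ‖(!₂[b 1 - a 1, -(b 0 - a 0)] : Plane)‖ = ‖b - a‖ := by
        rw [← sq_eq_sq₀ (norm_nonneg _) (norm_nonneg _), hsq, norm_sq_plane]
        simp
        ring
      rw [norm_smul, this, norm_div, norm_norm, div_mul_cancel₀ _ hab.ne']
      rcases hs with rfl | rfl <;> simp
    · rw [inner_plane]
      simp
      ring
    · have : inner ℝ ((s / ‖b - a‖) • (!₂[b 1 - a 1, -(b 0 - a 0)] : Plane)) (c - a) =
          -(s * cross (a - c) (b - c) / ‖b - a‖) := by
        rw [inner_plane]
        simp [cross]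
        field_simp
        ring
      rw [this]
      exact neg_neg_of_pos (div_pos hpos hab)
  rcases lt_or_gt_of_ne hD with h | h
  · exact key (-1) (Or.inr rfl) (by linarith)
  · exact key 1 (Or.inl rfl) (by linarith)

theorem outwardNormal_spec {a b c : Plane} (hac : a ≠ c) (hbc : b ≠ c)
    (hD : cross (a - c) (b - c) ≠ 0) :
    ‖outwardNormal {a, b, c} {a, b}‖ = 1 ∧ inner ℝ (outwardNormal {a, b, c} {a, b}) (b - a) = 0 ∧
      inner ℝ (outwardNormal {a, b, c} {a, b}) (c - a) < 0 := by
  rw [← isOutwardNormal_iff hac hbc]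
  exact Classical.epsilon_spec (exists_outwardNormal hac hbc hD)

theorem sides_triple {a b c : Plane} (hab : a ≠ b) (hac : a ≠ c) (hbc : b ≠ c) :
    sides {a, b, c} = {{a, b}, {a, c}, {b, c}} := by
  ext e
  rw [sides, Finset.mem_powersetCard]
  constructor
  · rintro ⟨h1, h2⟩
    obtain ⟨x, y, hxy, rfl⟩ := Finset.card_eq_two.1 h2
    have hx := h1 (Finset.mem_insert_self x {y})
    have hy := h1 (Finset.mem_insert_of_mem (Finset.mem_singleton_self y))
    simp only [Finset.mem_insert, Finset.mem_singleton] at hx hy ⊢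
    rcases hx with rfl | rfl | rfl <;> rcases hy with rfl | rfl | rfl <;>
      simp_all [Finset.pair_comm]
  · intro h
    simp only [Finset.mem_insert, Finset.mem_singleton] at h
    rcases h with rfl | rfl | rfl
    · exact ⟨by intro; simp; tauto, Finset.card_pair hab⟩
    · exact ⟨by intro; simp; tauto, Finset.card_pair hac⟩
    · exact ⟨by intro; simp; tauto, Finset.card_pair hbc⟩

theorem sum_sides_triple {a b c : Plane} (hab : a ≠ b) (hac : a ≠ c) (hbc : b ≠ c)
    (f : Finset Plane → ℝ) :
    ∑ e ∈ sides {a, b, c}, f e = f {a, b} + f {a, c} + f {b, c} := by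
  have h1 : ({a, b} : Finset Plane) ≠ {a, c} := by
    intro h
    have : b ∈ ({a, c} : Finset Plane) := h ▸ (by simp)
    simp [hab.symm, hbc] at this
  have h2 : ({a, b} : Finset Plane) ≠ {b, c} := by
    intro h
    have : a ∈ ({b, c} : Finset Plane) := h ▸ (by simp)
    simp [hab, hac] at this
  have h3 : ({a, c} : Finset Plane) ≠ {b, c} := by
    intro h
    have : a ∈ ({b, c} : Finset Plane) := h ▸ (by simp)
    simp [hab, hac] at this
  rw [sides_triple hab hac hbc, Finset.sum_insert (by simp [h1, h2]),
    Finset.sum_insert (by simp [h3]), Finset.sum_singleton]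
  ring

theorem cross_swap (a b c : Plane) : cross (b - c) (a - c) = - cross (a - c) (b - c) := by
  simp [cross]; ring

theorem cross_rotate (a b c : Plane) : cross (b - a) (c - a) = cross (a - c) (b - c) := by
  simp [cross]; ring

/-- The side `ac` contributes nothing since its normal is orthogonal to `a - c`. On `ab` and `bc`,
length times normal component is plus or minus the absolute value of the cross product, which is the
factor in `integral_triangle_fderiv`. -/
theorem divergence_along_side {a b c : Plane} (hab : a ≠ b) (hac : a ≠ c) (hbc : b ≠ c)
    (hD : cross (a - c) (b - c) ≠ 0) {F : Plane → ℝ} (hF : ContDiff ℝ 1 F) :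
    ∫ x in hull {a, b, c}, fderiv ℝ F x (a - c) =
      ∑ e ∈ sides {a, b, c}, inner ℝ (outwardNormal {a, b, c} e) (a - c) *
        ∫ x, F x ∂(arcLength e) := by
  have hF' := hF.continuous
  have hset : ((({a, b, c} : Finset Plane) : Set Plane)) = {a, b, c} := by simp
  rw [hull, hset, integral_triangle_fderiv hD hF, sum_sides_triple hab hac hbc,
    integral_arcLength_pair _ _ hF', integral_arcLength_pair _ _ hF',
    integral_arcLength_pair _ _ hF']
  obtain ⟨n1, n2, n3⟩ := outwardNormal_spec hac hbc hD
  have hD' : cross (b - a) (c - a) ≠ 0 := by rwa [cross_rotate]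
  obtain ⟨m1, m2, m3⟩ := outwardNormal_spec hab.symm hac.symm hD'
  have hD'' : cross (c - b) (a - b) ≠ 0 := by rwa [cross_rotate, cross_rotate]
  obtain ⟨l1, l2, l3⟩ := outwardNormal_spec hbc.symm hab hD''
  have e1 : ({b, c, a} : Finset Plane) = {a, b, c} := by ext; simp; tauto
  have e2 : ({c, a, b} : Finset Plane) = {a, b, c} := by ext; simp; tauto
  have e3 : ({c, a} : Finset Plane) = {a, c} := by ext; simp; tauto
  rw [e1] at m1 m2 m3
  rw [e2, e3] at l1 l2 l3
  have k1 := dist_mul_inner_normal n1 n2 n3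
  have k2 := dist_mul_inner_normal m1 m2 m3
  rw [cross_rotate] at k2
  have k3 : inner ℝ (outwardNormal {a, b, c} {b, c}) (a - c) =
      - inner ℝ (outwardNormal {a, b, c} {b, c}) (b - a) := by
    simp only [inner_sub_right] at m2 ⊢
    linarith
  have hsw : ∫ s in (0 : ℝ)..1, F (AffineMap.lineMap c b s) =
      ∫ s in (0 : ℝ)..1, F (AffineMap.lineMap b c s) := by
    have := intervalIntegral.integral_comp_sub_left (a := 0) (b := 1)
      (fun s => F (AffineMap.lineMap b c s)) (1 : ℝ)
    simpa [AffineMap.lineMap_apply_one_sub] using this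
  rw [l2, k3, hsw, mul_sub]
  nth_rewrite 1 [← k1]
  rw [← k2]
  ring

/-- The divergence theorem on a triangle, for a constant direction `d`. -/
theorem IsTriangle.divergence {K : Finset Plane} (hK : IsTriangle K) {F : Plane → ℝ}
    (hF : ContDiff ℝ 1 F) (d : Plane) :
    ∫ x in cell K, fderiv ℝ F x d =
      ∑ e ∈ sides K, inner ℝ (outwardNormal K e) d * ∫ x, F x ∂(arcLength e) := by
  obtain ⟨hcard, hind⟩ := hK
  obtain ⟨a, b, c, hab, hac, hbc, rfl⟩ := Finset.card_eq_three.1 hcard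
  have hD := IsTriangle.cross_ne_zero hab hac hbc hind
  have h1 := divergence_along_side hab hac hbc hD hF
  have hD' : cross (b - c) (a - c) ≠ 0 := by rw [cross_swap]; simpa
  have h2 := divergence_along_side hab.symm hbc hac hD' hF
  rw [Finset.insert_comm b a] at h2
  -- Cramer's rule in the basis `a - c`, `b - c`: the divergence theorem along two sides gives every
  -- direction.
  have hd : d = (cross d (b - c) / cross (a - c) (b - c)) • (a - c) +
      (cross (a - c) d / cross (a - c) (b - c)) • (b - c) := by
    ext i
    simp [cross] at hD
    fin_cases i <;> simp [cross] <;>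
      rw [div_mul_eq_mul_div, div_mul_eq_mul_div, ← add_div, eq_div_iff hD] <;> ring
  generalize (cross d (b - c) / cross (a - c) (b - c)) = α at hd
  generalize (cross (a - c) d / cross (a - c) (b - c)) = β at hd
  have hint : ∀ v, IntegrableOn (fun x => fderiv ℝ F x v) (hull {a, b, c}) := fun v =>
    ((hF.continuous_fderiv one_ne_zero).clm_apply continuous_const).continuousOn.integrableOn_compact
      (isCompact_hull _)
  rw [restrict_cell, hd]
  simp only [map_add, map_smul, inner_add_right, inner_smul_right, smul_eq_mul, add_mul,
    Finset.sum_add_distrib, mul_assoc, ← Finset.mul_sum]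
  rw [integral_add ((hint _).const_mul α) ((hint _).const_mul β), integral_const_mul,
    integral_const_mul, h1, h2]

/-- Labels the vertices so that a given side is `{a, b}` and `c` is opposite; the cross product is
invariant under the cyclic relabelling. -/
theorem IsTriangle.exists_opposite {K e : Finset Plane} (hK : IsTriangle K) (he : e ∈ sides K) :
    ∃ a b c, a ≠ b ∧ a ≠ c ∧ b ≠ c ∧ K = {a, b, c} ∧ e = {a, b} ∧ cross (a - c) (b - c) ≠ 0 := by
  obtain ⟨hcard, hind⟩ := hK
  obtain ⟨a, b, c, hab, hac, hbc, rfl⟩ := Finset.card_eq_three.1 hcard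
  have hD := IsTriangle.cross_ne_zero hab hac hbc hind
  rw [sides_triple hab hac hbc] at he
  simp only [Finset.mem_insert, Finset.mem_singleton] at he
  rcases he with rfl | rfl | rfl
  · exact ⟨a, b, c, hab, hac, hbc, rfl, rfl, hD⟩
  · refine ⟨c, a, b, hac.symm, hbc.symm, hab, by ext; simp; tauto, Finset.pair_comm _ _, ?_⟩
    rwa [cross_rotate b c a, cross_rotate a b c]
  · refine ⟨b, c, a, hbc, hab.symm, hac.symm, by ext; simp; tauto, rfl, ?_⟩
    rwa [cross_rotate a b c]

/-! ### Weak derivatives -/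

theorem MemL2.locallyIntegrableOn {D : Set Plane} {w : Plane → ℝ} (h : MemL2 D w) :
    LocallyIntegrableOn w D :=
  locallyIntegrableOn_of_locallyIntegrable_restrict (MemLp.locallyIntegrable h (by norm_num))

theorem MemL2.integrable_mul {D : Set Plane} {w z : Plane → ℝ} (h : MemL2 D w) (h' : MemL2 D z) :
    Integrable (fun x => w x * z x) (volume.restrict D) :=
  MemLp.integrable_mul h h'

theorem MemL2.mono {D D' : Set Plane} {w : Plane → ℝ} (h : MemL2 D w) (hD : D' ⊆ D) :
    MemL2 D' w :=
  MemLp.mono_measure (Measure.restrict_mono hD le_rfl) h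

theorem MemL2.congr {D : Set Plane} {w z : Plane → ℝ} (h : MemL2 D w)
    (hz : w =ᵐ[volume.restrict D] z) : MemL2 D z :=
  (memLp_congr_ae hz).1 h

theorem integrable_mul_of_tsupport_subset {D : Set Plane} {w χ : Plane → ℝ} {μ : Measure Plane}
    (hw : LocallyIntegrableOn w D μ) (hχ : Continuous χ) (hc : HasCompactSupport χ)
    (hs : tsupport χ ⊆ D) : Integrable (fun x => w x * χ x) μ := by
  have h1 : IntegrableOn w (tsupport χ) μ := hw.integrableOn_compact_subset hs hc.isCompact
  have h2 : IntegrableOn (fun x => w x * χ x) (tsupport χ) μ :=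
    h1.mul_continuousOn hχ.continuousOn hc.isCompact
  refine (integrableOn_iff_integrable_of_support_subset ?_).1 h2
  intro x hx
  apply subset_tsupport
  intro h0
  exact hx (by simp [h0])

theorem contDiff_pderiv {φ : Plane → ℝ} (h : ContDiff ℝ ∞ φ) (j : Fin 2) :
    ContDiff ℝ ∞ (pderiv j φ) :=
  (h.fderiv_right (by simp)).clm_apply contDiff_const

theorem tsupport_pderiv_subset (j : Fin 2) (φ : Plane → ℝ) : tsupport (pderiv j φ) ⊆ tsupport φ := by
  refine closure_minimal ?_ (isClosed_tsupport φ)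
  intro x hx
  apply support_fderiv_subset ℝ
  intro h0
  exact hx (by simp [pderiv, h0])

theorem IsTestFunction.pderiv {D : Set Plane} {φ : Plane → ℝ} (h : IsTestFunction D φ) (j : Fin 2) :
    IsTestFunction D (pderiv j φ) :=
  ⟨contDiff_pderiv h.1 j, h.2.1.fderiv_apply ℝ _, (tsupport_pderiv_subset j φ).trans h.2.2⟩

theorem IsTestFunction.integrable {D : Set Plane} {φ w : Plane → ℝ} (h : IsTestFunction D φ)
    (hw : LocallyIntegrableOn w D) : Integrable (fun x => w x * φ x) :=
  integrable_mul_of_tsupport_subset hw h.1.continuous h.2.1 h.2.2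

theorem IsTestFunction.eq_zero {D : Set Plane} {φ : Plane → ℝ} (h : IsTestFunction D φ) {x : Plane}
    (hx : x ∉ D) : φ x = 0 :=
  image_eq_zero_of_notMem_tsupport fun hx' => hx (h.2.2 hx')

theorem IsTestFunction.setIntegral {D : Set Plane} {φ : Plane → ℝ} (h : IsTestFunction D φ)
    (w : Plane → ℝ) : ∫ x in D, w x * φ x = ∫ x, w x * φ x :=
  setIntegral_eq_integral_of_forall_compl_eq_zero fun x hx => by simp [h.eq_zero hx]

theorem IsTestFunction.mono {D D' : Set Plane} {φ : Plane → ℝ} (h : IsTestFunction D φ)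
    (hD : D ⊆ D') : IsTestFunction D' φ :=
  ⟨h.1, h.2.1, h.2.2.trans hD⟩

/-- The fundamental lemma of the calculus of variations. It is the source of uniqueness for weak
derivatives and weak divergences. -/
theorem ae_eq_of_forall_testFunction {D : Set Plane} (hD : IsOpen D) {w z : Plane → ℝ}
    (hw : LocallyIntegrableOn w D) (hz : LocallyIntegrableOn z D)
    (h : ∀ φ, IsTestFunction D φ → ∫ x in D, w x * φ x = ∫ x in D, z x * φ x) :
    w =ᵐ[volume.restrict D] z := by
  have := hD.ae_eq_zero_of_integral_contDiff_smul_eq_zero (hw.sub hz) (fun φ h1 h2 h3 => by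
    have ht : IsTestFunction D φ := ⟨h1, h2, h3⟩
    have h4 := h φ ht
    rw [ht.setIntegral, ht.setIntegral] at h4
    simp only [Pi.sub_apply, smul_eq_mul, mul_comm (φ _), sub_mul]
    rw [integral_sub (ht.integrable hw) (ht.integrable hz), h4, sub_self])
  rw [EventuallyEq, ae_restrict_iff' hD.measurableSet]
  filter_upwards [this] with x hx hxD
  exact sub_eq_zero.1 (hx hxD)

theorem IsWeakDeriv.unique {D : Set Plane} (hD : IsOpen D) {j : Fin 2} {w w' w'' : Plane → ℝ}
    (h : IsWeakDeriv D j w w') (h' : IsWeakDeriv D j w w'') : w' =ᵐ[volume.restrict D] w'' := by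
  refine ae_eq_of_forall_testFunction hD h.2.1 h'.2.1 fun φ hφ => ?_
  have h1 := h.2.2 φ hφ
  have h2 := h'.2.2 φ hφ
  linarith

theorem IsWeakDeriv.weakDeriv_spec {D : Set Plane} {j : Fin 2} {w w' : Plane → ℝ}
    (h : IsWeakDeriv D j w w') : IsWeakDeriv D j w (weakDeriv D j w) :=
  Classical.epsilon_spec (p := IsWeakDeriv D j w) ⟨w', h⟩

theorem IsWeakDeriv.weakDeriv_ae_eq {D : Set Plane} (hD : IsOpen D) {j : Fin 2}
    {w w' : Plane → ℝ} (h : IsWeakDeriv D j w w') : weakDeriv D j w =ᵐ[volume.restrict D] w' :=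
  h.weakDeriv_spec.unique hD h

theorem IsWeakDeriv.congr {D : Set Plane} {j : Fin 2} {w w' z z' : Plane → ℝ}
    (h : IsWeakDeriv D j w w') (hz : w =ᵐ[volume.restrict D] z)
    (hz' : w' =ᵐ[volume.restrict D] z') : IsWeakDeriv D j z z' := by
  refine ⟨h.1.congr hz, h.2.1.congr hz', fun φ hφ => ?_⟩
  rw [integral_congr_ae (g := fun x => w x * pderiv j φ x), h.2.2 φ hφ]
  · congr 1
    refine integral_congr_ae ?_
    filter_upwards [hz'] with x hx using by rw [hx]
  · filter_upwards [hz] with x hx using by rw [hx]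

theorem IsWeakDeriv.sub {D : Set Plane} {j : Fin 2} {w w' z z' : Plane → ℝ}
    (h : IsWeakDeriv D j w w') (hz : IsWeakDeriv D j z z') :
    IsWeakDeriv D j (fun x => w x - z x) (fun x => w' x - z' x) := by
  refine ⟨h.1.sub hz.1, h.2.1.sub hz.2.1, fun φ hφ => ?_⟩
  have hp := hφ.pderiv j
  simp only [sub_mul]
  rw [integral_sub (hp.integrable h.1).restrict (hp.integrable hz.1).restrict,
    integral_sub (hφ.integrable h.2.1).restrict (hφ.integrable hz.2.1).restrict,
    h.2.2 φ hφ, hz.2.2 φ hφ]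
  ring

theorem LocallyIntegrableOn.const_mul_real {D : Set Plane} {w : Plane → ℝ}
    (h : LocallyIntegrableOn w D) (c : ℝ) : LocallyIntegrableOn (fun x => c * w x) D :=
  fun x hx => (h x hx).smul c

theorem IsWeakDeriv.const_mul {D : Set Plane} {j : Fin 2} {w w' : Plane → ℝ}
    (h : IsWeakDeriv D j w w') (c : ℝ) :
    IsWeakDeriv D j (fun x => c * w x) (fun x => c * w' x) := by
  refine ⟨LocallyIntegrableOn.const_mul_real h.1 c, LocallyIntegrableOn.const_mul_real h.2.1 c,
    fun φ hφ => ?_⟩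
  simp only [mul_assoc]
  rw [integral_const_mul, integral_const_mul, h.2.2 φ hφ]
  ring

theorem IsWeakDeriv.mono {D D' : Set Plane} {j : Fin 2} {w w' : Plane → ℝ}
    (h : IsWeakDeriv D j w w') (hD : D' ⊆ D) : IsWeakDeriv D' j w w' := by
  refine ⟨h.1.mono_set hD, h.2.1.mono_set hD, fun φ hφ => ?_⟩
  have := h.2.2 φ (hφ.mono hD)
  rwa [(hφ.mono hD).setIntegral, ((hφ.mono hD).pderiv j).setIntegral, ← hφ.setIntegral,
    ← (hφ.pderiv j).setIntegral] at this

/-- Integration by parts of smooth functions, one of them with compact support. -/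
theorem integral_mul_pderiv {ψ φ : Plane → ℝ} (hψ : ContDiff ℝ ∞ ψ) (hφ : ContDiff ℝ ∞ φ)
    (hc : HasCompactSupport φ) (j : Fin 2) :
    ∫ x, ψ x * pderiv j φ x = - ∫ x, pderiv j ψ x * φ x := by
  have hcs : HasCompactSupport (pderiv j φ) := hc.fderiv_apply ℝ _
  refine integral_mul_fderiv_eq_neg_fderiv_mul_of_integrable ?_ ?_ ?_
    (fun x _ => (hψ.differentiable (by simp)).differentiableAt)
    (fun x _ => (hφ.differentiable (by simp)).differentiableAt)
  · exact ((contDiff_pderiv hψ j).continuous.mul hφ.continuous).integrable_of_hasCompactSupport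
      hc.mul_left
  · exact (hψ.continuous.mul (contDiff_pderiv hφ j).continuous).integrable_of_hasCompactSupport
      hcs.mul_left
  · exact (hψ.continuous.mul hφ.continuous).integrable_of_hasCompactSupport hc.mul_left

theorem isWeakDeriv_of_contDiff (D : Set Plane) {ψ : Plane → ℝ} (hψ : ContDiff ℝ ∞ ψ) (j : Fin 2) :
    IsWeakDeriv D j ψ (pderiv j ψ) := by
  refine ⟨hψ.continuous.locallyIntegrable.locallyIntegrableOn D,
    (contDiff_pderiv hψ j).continuous.locallyIntegrable.locallyIntegrableOn D, fun φ hφ => ?_⟩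
  rw [(hφ.pderiv j).setIntegral, hφ.setIntegral, integral_mul_pderiv hψ hφ.1 hφ.2.1]

/-! ### Sobolev spaces -/

theorem MemSobolev.memL2 {m : ℕ} {D : Set Plane} {w : Plane → ℝ} (h : MemSobolev m D w) :
    MemL2 D w := by
  cases m with
  | zero => exact h
  | succ m => exact h.1

theorem MemSobolev.congr {m : ℕ} {D : Set Plane} {w z : Plane → ℝ}
    (h : MemSobolev m D w) (hz : w =ᵐ[volume.restrict D] z) : MemSobolev m D z := by
  cases m with
  | zero => exact MemL2.congr h hz
  | succ m =>
    refine ⟨MemL2.congr h.1 hz, fun j => ?_⟩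
    obtain ⟨w', h1, h2⟩ := h.2 j
    exact ⟨w', h1.congr hz (ae_eq_refl _), h2⟩

theorem MemSobolev.isWeakDeriv {m : ℕ} {D : Set Plane} {w : Plane → ℝ}
    (h : MemSobolev (m + 1) D w) (j : Fin 2) : IsWeakDeriv D j w (weakDeriv D j w) := by
  obtain ⟨w', h1, -⟩ := h.2 j
  exact h1.weakDeriv_spec

theorem MemSobolev.weakDeriv {m : ℕ} {D : Set Plane} (hD : IsOpen D) {w : Plane → ℝ}
    (h : MemSobolev (m + 1) D w) (j : Fin 2) : MemSobolev m D (weakDeriv D j w) := by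
  obtain ⟨w', h1, h2⟩ := h.2 j
  exact h2.congr (h1.weakDeriv_ae_eq hD).symm

theorem MemSobolev.of_succ {m : ℕ} {D : Set Plane} {w : Plane → ℝ}
    (h : MemSobolev (m + 1) D w) : MemSobolev m D w := by
  induction m generalizing w with
  | zero => exact h.1
  | succ m ih =>
    refine ⟨h.1, fun j => ?_⟩
    obtain ⟨w', h1, h2⟩ := h.2 j
    exact ⟨w', h1, ih h2⟩

theorem MemSobolev.sub {m : ℕ} {D : Set Plane} {w z : Plane → ℝ}
    (h : MemSobolev m D w) (hz : MemSobolev m D z) : MemSobolev m D (fun x => w x - z x) := by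
  induction m generalizing w z with
  | zero => exact MemLp.sub h hz
  | succ m ih =>
    refine ⟨MemLp.sub h.1 hz.1, fun j => ?_⟩
    obtain ⟨w', h1, h2⟩ := h.2 j
    obtain ⟨z', h3, h4⟩ := hz.2 j
    exact ⟨_, h1.sub h3, ih h2 h4⟩

theorem MemSobolev.const_mul {m : ℕ} {D : Set Plane} {w : Plane → ℝ}
    (h : MemSobolev m D w) (c : ℝ) : MemSobolev m D (fun x => c * w x) := by
  induction m generalizing w with
  | zero => exact MemLp.const_mul h c
  | succ m ih =>
    refine ⟨MemLp.const_mul h.1 c, fun j => ?_⟩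
    obtain ⟨w', h1, h2⟩ := h.2 j
    exact ⟨_, h1.const_mul c, ih h2⟩

theorem memLp_of_continuous {ψ : Plane → ℝ} (hψ : Continuous ψ) {s : Set Plane} (hs : IsCompact s)
    (μ : Measure Plane) [IsFiniteMeasure (μ.restrict s)] : MemLp ψ 2 (μ.restrict s) := by
  obtain ⟨C, hC⟩ := hs.exists_bound_of_continuousOn hψ.continuousOn
  refine MemLp.of_bound hψ.aestronglyMeasurable C ?_
  exact (ae_restrict_iff' hs.measurableSet).2 (ae_of_all _ hC)

theorem memL2_cell {ψ : Plane → ℝ} (hψ : Continuous ψ) (K : Finset Plane) : MemL2 (cell K) ψ := by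
  rw [MemL2, restrict_cell]
  have : IsFiniteMeasure (volume.restrict (hull K)) := by rw [← restrict_cell]; infer_instance
  exact memLp_of_continuous hψ (isCompact_hull K) volume

theorem memLp_arcLength {ψ : Plane → ℝ} (hψ : Continuous ψ) {e : Finset Plane} (he : e.card = 2) :
    MemLp ψ 2 (arcLength e) := by
  have := isFiniteMeasure_arcLength he
  rw [arcLength] at *
  exact memLp_of_continuous hψ (isCompact_hull e) _

theorem memSobolev_of_contDiff {ψ : Plane → ℝ} (hψ : ContDiff ℝ ∞ ψ) (K : Finset Plane) (m : ℕ) :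
    MemSobolev m (cell K) ψ := by
  induction m generalizing ψ with
  | zero => exact memL2_cell hψ.continuous K
  | succ m ih =>
    exact ⟨memL2_cell hψ.continuous K,
      fun j => ⟨_, isWeakDeriv_of_contDiff _ hψ j, ih (contDiff_pderiv hψ j)⟩⟩

theorem contDiff_polyFun (P : MvPolynomial (Fin 2) ℝ) : ContDiff ℝ ∞ (polyFun P) := by
  have hP : polyFun P = fun x => MvPolynomial.eval (fun i => x i) P := rfl
  rw [hP]
  induction P using MvPolynomial.induction_on with
  | C a => simpa using (contDiff_const : ContDiff ℝ ∞ fun _ : Plane => a)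
  | add p q hp hq => simpa using (hp rfl).add (hq rfl)
  | mul_X p i hp =>
    have hi : ContDiff ℝ ∞ fun x : Plane => x i := by fun_prop
    simpa using (hp rfl).mul hi

theorem IsPolyOn.memSobolev {k : ℕ} {K : Finset Plane} {w : Plane → ℝ}
    (h : IsPolyOn k (volume.restrict (cell K)) w) (m : ℕ) : MemSobolev m (cell K) w := by
  obtain ⟨P, -, hP⟩ := h
  exact (memSobolev_of_contDiff (contDiff_polyFun P) K m).congr hP.symm

/-! ### Density of smooth functions in `H¹` of a convex set -/

theorem eLpNorm_two_sq {α : Type*} [MeasurableSpace α] (μ : Measure α) (f : α → ℝ) :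
    eLpNorm f 2 μ ^ 2 = ∫⁻ x, ‖f x‖ₑ ^ 2 ∂μ := by
  have := eLpNorm_nnreal_pow_eq_lintegral (μ := μ) (f := f) (p := 2) (by norm_num)
  simpa using this

/-- The support need not be centred at the origin: an off-centre kernel is what moves the averages
into a convex set. -/
structure IsKernel (k : Plane → ℝ) : Prop where
  smooth : ContDiff ℝ ∞ k
  compact : HasCompactSupport k
  nonneg : ∀ x, 0 ≤ k x
  integral_eq : ∫ x, k x = 1

/-- The mollification of `V` with the kernel `k`, composed with the dilation by `l`. -/
def smoothing (l : ℝ) (k V : Plane → ℝ) (x : Plane) : ℝ := ∫ y, V y * k (l • x - y)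

theorem IsKernel.hasCompactSupport_shift {k : Plane → ℝ} (hk : IsKernel k) (x : Plane) :
    HasCompactSupport fun y => k (x - y) :=
  hk.compact.comp_homeomorph (Homeomorph.subLeft x)

theorem IsKernel.integral_shift {k : Plane → ℝ} (hk : IsKernel k) (x : Plane) :
    ∫ y, k (x - y) = 1 := by
  rw [integral_sub_left_eq_self k volume x, hk.integral_eq]

theorem IsKernel.integrable_shift {k : Plane → ℝ} (hk : IsKernel k) (x : Plane) :
    Integrable fun y => k (x - y) :=
  (hk.smooth.continuous.comp (by fun_prop)).integrable_of_hasCompactSupport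
    (hk.hasCompactSupport_shift x)

theorem IsKernel.integrable_mul {k V : Plane → ℝ} (hk : IsKernel k) (hV : LocallyIntegrable V)
    (x : Plane) : Integrable fun y => V y * k (x - y) := by
  have := hV.integrable_smul_left_of_hasCompactSupport
    (hk.smooth.continuous.comp (by fun_prop : Continuous fun y => x - y))
    (hk.hasCompactSupport_shift x)
  simpa [mul_comm] using this

theorem contDiff_smoothing {k V : Plane → ℝ} (hk : IsKernel k) (hV : LocallyIntegrable V) (l : ℝ) :
    ContDiff ℝ ∞ (smoothing l k V) := by
  have := hk.compact.contDiff_convolution_right (ContinuousLinearMap.mul ℝ ℝ) hV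
    (n := ⊤) hk.smooth
  exact this.comp (contDiff_const_smul l)

/-- The derivative falls on the kernel, so `V` need not be differentiable; the factor `l` comes from
the dilation. -/
theorem pderiv_smoothing {k V : Plane → ℝ} (hk : IsKernel k) (hV : LocallyIntegrable V) (l : ℝ)
    (j : Fin 2) (x : Plane) :
    pderiv j (smoothing l k V) x = l * ∫ y, V y * pderiv j k (l • x - y) := by
  have h1 := hk.compact.hasFDerivAt_convolution_right (ContinuousLinearMap.mul ℝ ℝ) hV
    (hk.smooth.of_le (by simp)) (l • x)
  have h2 : HasFDerivAt (fun x : Plane => l • x) (l • ContinuousLinearMap.id ℝ Plane) x :=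
    (hasFDerivAt_id x).const_smul l
  have h3 := h1.comp x h2
  rw [pderiv]
  have h4 : smoothing l k V =
      convolution V k (ContinuousLinearMap.mul ℝ ℝ) volume ∘ fun x => l • x := rfl
  rw [h4, h3.fderiv]
  simp only [ContinuousLinearMap.comp_apply, smul_apply,
    ContinuousLinearMap.id_apply, map_smul, smul_eq_mul]
  rw [convolution_precompR_apply _ hV (hk.compact.fderiv ℝ)
    (hk.smooth.continuous_fderiv (by simp))]
  rfl

/-- The shifted kernel is a probability density, and for a probability measure the `L¹` norm is at
most the `L²` norm. -/
theorem enorm_smoothing_sq_le {k V : Plane → ℝ} (hk : IsKernel k) (hV : Measurable V) (l : ℝ)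
    (x : Plane) :
    ‖smoothing l k V x‖ₑ ^ 2 ≤ ∫⁻ y, ‖V y‖ₑ ^ 2 * ENNReal.ofReal (k (l • x - y)) := by
  set d : Plane → ENNReal := fun y => ENNReal.ofReal (k (l • x - y)) with hd
  have hdm : Measurable d :=
    (hk.smooth.continuous.measurable.comp (by fun_prop)).ennreal_ofReal
  have hprob : IsProbabilityMeasure (volume.withDensity d) := by
    constructor
    rw [withDensity_apply _ MeasurableSet.univ, Measure.restrict_univ, hd,
      ← ofReal_integral_eq_lintegral_ofReal (hk.integrable_shift _)
        (ae_of_all _ fun y => hk.nonneg _), hk.integral_shift, ENNReal.ofReal_one]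
  have h1 : ‖smoothing l k V x‖ₑ ≤ eLpNorm V 1 (volume.withDensity d) := by
    rw [eLpNorm_one_eq_lintegral_enorm, lintegral_withDensity_eq_lintegral_mul _ hdm hV.enorm]
    refine (enorm_integral_le_lintegral_enorm _).trans_eq ?_
    refine lintegral_congr fun y => ?_
    rw [enorm_mul, Pi.mul_apply, hd, mul_comm]
    congr 1
    rw [Real.enorm_eq_ofReal (hk.nonneg _)]
  calc ‖smoothing l k V x‖ₑ ^ 2 ≤ eLpNorm V 2 (volume.withDensity d) ^ 2 := by
        gcongr
        exact h1.trans (eLpNorm_le_eLpNorm_of_exponent_le (by norm_num) hV.aestronglyMeasurable)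
    _ = _ := by
        rw [eLpNorm_two_sq, lintegral_withDensity_eq_lintegral_mul _ hdm (by fun_prop)]
        refine lintegral_congr fun y => ?_
        rw [Pi.mul_apply, mul_comm]

/-- Integrate the pointwise bound and exchange the integrals. In the plane the dilation by `l`
scales area by `l ^ 2`, and the square root leaves the factor `l⁻¹`. -/
theorem eLpNorm_smoothing_le {k V : Plane → ℝ} (hk : IsKernel k) (hV : Measurable V) {l : ℝ}
    (hl : 0 < l) :
    eLpNorm (smoothing l k V) 2 volume ≤ ENNReal.ofReal l⁻¹ * eLpNorm V 2 volume := by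
  refine (ENNReal.pow_le_pow_left_iff (two_ne_zero)).1 ?_
  rw [mul_pow, eLpNorm_two_sq, eLpNorm_two_sq]
  have hkm := hk.smooth.continuous.measurable
  calc ∫⁻ x, ‖smoothing l k V x‖ₑ ^ 2
      ≤ ∫⁻ x, ∫⁻ y, ‖V y‖ₑ ^ 2 * ENNReal.ofReal (k (l • x - y)) :=
        lintegral_mono fun x => enorm_smoothing_sq_le hk hV l x
    _ = ∫⁻ y, ∫⁻ x, ‖V y‖ₑ ^ 2 * ENNReal.ofReal (k (l • x - y)) := by
        refine lintegral_lintegral_swap ?_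
        refine Measurable.aemeasurable ?_
        have m1 : Measurable fun p : Plane × Plane => ‖V p.2‖ₑ ^ 2 :=
          (hV.comp measurable_snd).enorm.pow_const 2
        have m2 : Measurable fun p : Plane × Plane => ENNReal.ofReal (k (l • p.1 - p.2)) :=
          (hkm.comp (by fun_prop : Measurable fun p : Plane × Plane => l • p.1 - p.2)).ennreal_ofReal
        exact m1.mul m2
    _ = ∫⁻ y, ‖V y‖ₑ ^ 2 * ENNReal.ofReal l⁻¹ ^ 2 := by
        refine lintegral_congr fun y => ?_
        have m3 : Measurable fun x : Plane => ENNReal.ofReal (k (l • x - y)) :=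
          (hkm.comp (by fun_prop : Measurable fun x : Plane => l • x - y)).ennreal_ofReal
        rw [lintegral_const_mul _ m3]
        congr 1
        have hint : Integrable fun x => k (l • x - y) := by
          have h1 : Integrable fun x => k (x - y) :=
            (hk.smooth.continuous.integrable_of_hasCompactSupport hk.compact).comp_sub_right y
          exact h1.comp_smul hl.ne'
        rw [← ofReal_integral_eq_lintegral_ofReal hint (ae_of_all _ fun y => hk.nonneg _),
          Measure.integral_comp_smul volume (fun x => k (x - y)) l,
          integral_sub_right_eq_self k y, hk.integral_eq, ← ENNReal.ofReal_pow (by positivity)]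
        simp [abs_of_nonneg (sq_nonneg l)]
    _ = _ := by
        rw [lintegral_mul_const _ (hV.enorm.pow_const 2), mul_comm]

/-- A smooth kernel with support in the ball of radius `s * r` about `-(s • c)`. -/
theorem exists_kernel (c : Plane) {r s : ℝ} (hr : 0 < r) (hs : 0 < s) :
    ∃ k, IsKernel k ∧ ∀ v ∈ tsupport k, ∃ z ∈ Metric.ball c r, v = -(s • z) := by
  -- The outer radius is half of `s * r`, so that the closed support still fits into the open ball.
  let f : ContDiffBump (-(s • c)) := ⟨s * (r / 4), s * (r / 2), by positivity, by
    gcongr; linarith⟩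
  refine ⟨f.normed volume, ⟨f.contDiff_normed, f.hasCompactSupport_normed, f.nonneg_normed,
    f.integral_normed⟩, fun v hv => ⟨-(s⁻¹ • v), ?_, ?_⟩⟩
  · rw [f.tsupport_normed_eq, mem_closedBall_iff_norm] at hv
    rw [mem_ball_iff_norm]
    have : -(s⁻¹ • v) - c = -(s⁻¹ • (v - -(s • c))) := by
      rw [smul_sub, smul_neg, smul_smul, inv_mul_cancel₀ hs.ne', one_smul]
      abel
    rw [this, norm_neg, norm_smul, Real.norm_of_nonneg (by positivity)]
    calc s⁻¹ * ‖v - -(s • c)‖ ≤ s⁻¹ * (s * (r / 2)) := by gcongr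
      _ = r / 2 := by field_simp
      _ < r := by linarith
  · rw [smul_neg, smul_smul, mul_inv_cancel₀ hs.ne', one_smul, neg_neg]

theorem smoothing_sub {k V W : Plane → ℝ} (hk : IsKernel k) (hV : LocallyIntegrable V)
    (hW : LocallyIntegrable W) (l : ℝ) (x : Plane) :
    smoothing l k (V - W) x = smoothing l k V x - smoothing l k W x := by
  simp only [smoothing, Pi.sub_apply, sub_mul]
  exact integral_sub (hk.integrable_mul hV _) (hk.integrable_mul hW _)

/-- The smoothing at `x` is an average of values of `g` at points within `δ` of `x`, each of which
is within `ε` of `g x`. -/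
theorem norm_smoothing_sub_le {k g : Plane → ℝ} (hk : IsKernel k) (hg : Continuous g) {l δ ε : ℝ}
    {x : Plane} (hsupp : ∀ v ∈ tsupport k, dist (l • x - v) x < δ)
    (hδ : ∀ y, dist y x < δ → dist (g y) (g x) ≤ ε) :
    ‖smoothing l k g x - g x‖ ≤ ε := by
  have h1 : smoothing l k g x - g x = ∫ y, (g y - g x) * k (l • x - y) := by
    simp only [sub_mul]
    rw [integral_sub (hk.integrable_mul hg.locallyIntegrable _)
      ((hk.integrable_shift _).const_mul _), integral_const_mul, hk.integral_shift, mul_one]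
    rfl
  rw [h1]
  calc ‖∫ y, (g y - g x) * k (l • x - y)‖ ≤ ∫ y, ε * k (l • x - y) := by
        refine norm_integral_le_of_norm_le ((hk.integrable_shift _).const_mul _)
          (ae_of_all _ fun y => ?_)
        rw [norm_mul, Real.norm_of_nonneg (hk.nonneg _)]
        by_cases hy : l • x - y ∈ tsupport k
        · have := hsupp _ hy
          rw [sub_sub_cancel] at this
          have h2 := hδ y this
          rw [dist_eq_norm] at h2
          exact mul_le_mul_of_nonneg_right h2 (hk.nonneg _)
        · simp [image_eq_zero_of_notMem_tsupport hy]
    _ = ε := by rw [integral_const_mul, hk.integral_shift, mul_one]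

/-- Convergence of the dilated mollifications in `L²` of a bounded set. -/
theorem tendsto_smoothing {D : Set Plane} (hD : Bornology.IsBounded D)
    (hDm : MeasurableSet D) {c : Plane} {r : ℝ}
    (hball : Metric.ball c r ⊆ D) {l s : ℕ → ℝ} (hl : ∀ n, 1 / 2 ≤ l n) (hls : ∀ n, l n = 1 - s n)
    (hs : Tendsto s atTop (𝓝 0)) {k : ℕ → Plane → ℝ} (hk : ∀ n, IsKernel (k n))
    (hsupp : ∀ n, ∀ v ∈ tsupport (k n), ∃ z ∈ Metric.ball c r, v = -(s n • z))
    {V : Plane → ℝ} (hVm : Measurable V) (hV : MemLp V 2 volume) :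
    Tendsto (fun n => eLpNorm (fun x => smoothing (l n) (k n) V x - V x) 2 (volume.restrict D))
      atTop (𝓝 0) := by
  rw [ENNReal.tendsto_atTop_zero]
  intro ε hε
  by_cases hεt : ε = ⊤
  · exact ⟨0, fun n _ => hεt ▸ le_top⟩
  -- The error is split into quarters of `ε`: two for the smoothing of `V - g`, whose norm may
  -- double because `l n ≥ 1 / 2`, one for the smoothing error of `g`, and one for `g - V`.
  have hε4 : ε / 2 / 2 ≠ 0 := (ENNReal.half_pos (ENNReal.half_pos hε.ne').ne').ne'
  obtain ⟨g, hgc, hgV, hg, hgL⟩ := hV.exists_hasCompactSupport_eLpNorm_sub_le (by norm_num) hε4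
  have hgu := hgc.uniformContinuous_of_continuous hg
  have hvol : volume D ≠ ⊤ := hD.measure_lt_top.ne
  -- A uniform error `η` costs at most `|D| ^ (1/2) * η` in `L²(D)`; the `+ 1` in the witness avoids
  -- a zero denominator.
  obtain ⟨η, hη, hηε⟩ : ∃ η : ℝ, 0 < η ∧
      (volume.restrict D) Set.univ ^ (2 : ENNReal).toReal⁻¹ * ENNReal.ofReal η ≤ ε / 2 / 2 := by
    rw [Measure.restrict_apply_univ]
    set M := volume D ^ (2 : ENNReal).toReal⁻¹ with hM
    have hMt : M ≠ ⊤ := ENNReal.rpow_ne_top_of_nonneg (by simp) hvol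
    have hε4t : ε / 2 / 2 ≠ ⊤ := ENNReal.div_ne_top (ENNReal.div_ne_top hεt (by norm_num)) (by norm_num)
    refine ⟨(ε / 2 / 2).toReal / (M.toReal + 1), ?_, ?_⟩
    · exact div_pos (ENNReal.toReal_pos hε4 hε4t) (by positivity)
    · rw [← ENNReal.ofReal_toReal hMt, ← ENNReal.ofReal_mul ENNReal.toReal_nonneg]
      refine ENNReal.ofReal_le_of_le_toReal ?_
      rw [ENNReal.toReal_ofReal ENNReal.toReal_nonneg, mul_div_assoc']
      rw [div_le_iff₀ (by positivity)]
      nlinarith [ENNReal.toReal_nonneg (a := ε / 2 / 2), ENNReal.toReal_nonneg (a := M)]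
  obtain ⟨δ, hδ, hδg⟩ := Metric.uniformContinuous_iff.1 hgu η hη
  obtain ⟨N, hN⟩ : ∃ N, ∀ n ≥ N, |s n| * (Metric.diam D + 1) < δ := by
    have : Tendsto (fun n => |s n| * (Metric.diam D + 1)) atTop (𝓝 0) := by
      simpa using hs.abs.mul_const (Metric.diam D + 1)
    exact eventually_atTop.1 (this.eventually (gt_mem_nhds hδ))
  refine ⟨N, fun n hn => ?_⟩
  have hVl : LocallyIntegrable V := hV.locallyIntegrable (by norm_num)
  have hgl : LocallyIntegrable g := hg.locallyIntegrable
  have hln : 0 < l n := by linarith [hl n]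
  have hsplit : (fun x => smoothing (l n) (k n) V x - V x) =
      smoothing (l n) (k n) (V - g) + ((fun x => smoothing (l n) (k n) g x - g x) + (g - V)) := by
    funext x
    simp only [Pi.add_apply, Pi.sub_apply, smoothing_sub (hk n) hVl hgl]
    ring
  have m1 : AEStronglyMeasurable (smoothing (l n) (k n) (V - g)) (volume.restrict D) :=
    (contDiff_smoothing (hk n) (hVl.sub hgl) _).continuous.aestronglyMeasurable
  have m2 : AEStronglyMeasurable (fun x => smoothing (l n) (k n) g x - g x) (volume.restrict D) :=
    ((contDiff_smoothing (hk n) hgl _).continuous.sub hg).aestronglyMeasurable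
  have m3 : AEStronglyMeasurable (g - V) (volume.restrict D) :=
    (hg.measurable.sub hVm).aestronglyMeasurable
  have b1 : eLpNorm (smoothing (l n) (k n) (V - g)) 2 (volume.restrict D) ≤ ε / 2 / 2 + ε / 2 / 2 := by
    refine (eLpNorm_mono_measure _ Measure.restrict_le_self).trans ?_
    refine (eLpNorm_smoothing_le (hk n) (hVm.sub hg.measurable) hln).trans ?_
    rw [← two_mul]
    refine mul_le_mul' ?_ hgV
    rw [← ENNReal.ofReal_ofNat]
    refine ENNReal.ofReal_le_ofReal ?_
    rw [inv_le_comm₀ hln (by norm_num)]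
    linarith [hl n]
  have b2 : eLpNorm (fun x => smoothing (l n) (k n) g x - g x) 2 (volume.restrict D) ≤ ε / 2 / 2 := by
    refine (eLpNorm_le_of_ae_bound (C := η) ?_).trans hηε
    refine (ae_restrict_iff' hDm).2 (ae_of_all _ fun x hx => ?_)
    refine norm_smoothing_sub_le (δ := δ) (hk n) hg ?_ fun y hy => (hδg hy).le
    intro v hv
    obtain ⟨z, hz, rfl⟩ := hsupp n v hv
    -- The averaging points `(1 - s) • x + s • z` are at distance `s * ‖z - x‖` from `x`, and `x`,
    -- `z` both lie in `D`.
    have h1 : l n • x - -(s n • z) - x = s n • (z - x) := by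
      rw [hls n]
      module
    rw [dist_eq_norm, h1, norm_smul, ← dist_eq_norm, Real.norm_eq_abs]
    refine lt_of_le_of_lt ?_ (hN n hn)
    gcongr
    linarith [Metric.dist_le_diam_of_mem hD (hball hz) hx]
  have b3 : eLpNorm (g - V) 2 (volume.restrict D) ≤ ε / 2 / 2 := by
    rw [eLpNorm_sub_comm]
    exact (eLpNorm_mono_measure _ Measure.restrict_le_self).trans hgV
  rw [hsplit]
  refine (eLpNorm_add_le m1 (m2.add m3) (by norm_num)).trans ?_
  refine (add_le_add b1 ((eLpNorm_add_le m2 m3 (by norm_num)).trans (add_le_add b2 b3))).trans ?_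
  rw [ENNReal.add_halves, ENNReal.add_halves]

/-- Smooth functions are dense in `H¹` of a bounded convex open set. -/
theorem exists_smooth_approx {D : Set Plane} (hDo : IsOpen D) (hDc : Convex ℝ D)
    (hDb : Bornology.IsBounded D) {w : Plane → ℝ} (hw : MemSobolev 1 D w) :
    ∃ φ : ℕ → Plane → ℝ, (∀ n, ContDiff ℝ ∞ (φ n)) ∧
      Tendsto (fun n => eLpNorm (fun x => φ n x - w x) 2 (volume.restrict D)) atTop (𝓝 0) ∧
      ∀ j, Tendsto (fun n => eLpNorm (fun x => pderiv j (φ n) x - weakDeriv D j w x) 2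
        (volume.restrict D)) atTop (𝓝 0) := by
  rcases D.eq_empty_or_nonempty with rfl | ⟨c, hc⟩
  · exact ⟨fun _ _ => 0, fun _ => contDiff_const, by simp, by simp⟩
  obtain ⟨r, hr, hball⟩ := Metric.isOpen_iff.1 hDo c hc
  set s : ℕ → ℝ := fun n => 1 / ((n : ℝ) + 2) with hs_def
  have hs_pos : ∀ n, 0 < s n := fun n => by positivity
  have hs_le : ∀ n, s n ≤ 1 / 2 := fun n => by
    have : (2 : ℝ) ≤ n + 2 := by linarith [(Nat.cast_nonneg n : (0 : ℝ) ≤ n)]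
    exact one_div_le_one_div_of_le (by norm_num) this
  have hs_lim : Tendsto s atTop (𝓝 0) := by
    have := tendsto_one_div_atTop_nhds_zero_nat (𝕜 := ℝ)
    refine ((tendsto_add_atTop_iff_nat 2).2 this).congr fun n => ?_
    simp [hs_def]
  choose k hk hsupp using fun n => exists_kernel c hr (hs_pos n)
  -- Extension by zero, with a measurable representative. It preserves `L²` only; the extension may
  -- fail to be weakly differentiable across the boundary of `D`.
  have hext : ∀ z, MemL2 D z → ∃ Z : Plane → ℝ, Measurable Z ∧ MemLp Z 2 volume ∧
      z =ᵐ[volume.restrict D] Z ∧ ∀ x ∉ D, Z x = 0 := by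
    intro z hz
    refine ⟨D.indicator (hz.1.mk z), hz.1.stronglyMeasurable_mk.measurable.indicator
      hDo.measurableSet, ?_, ?_, fun x hx => Set.indicator_of_notMem hx _⟩
    · rw [memLp_indicator_iff_restrict hDo.measurableSet]
      exact (memLp_congr_ae hz.1.ae_eq_mk).1 hz
    · filter_upwards [hz.1.ae_eq_mk, ae_restrict_mem hDo.measurableSet] with x hx hxD
      rw [Set.indicator_of_mem hxD, hx]
  obtain ⟨W, hWm, hW2, hWw, hW0⟩ := hext w hw.1
  choose W' hWm' hW2' hWw' hW0' using fun j => hext _ (hw.weakDeriv hDo j).memL2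
  have hWl : LocallyIntegrable W := hW2.locallyIntegrable (by norm_num)
  have hlim : ∀ V : Plane → ℝ, Measurable V → MemLp V 2 volume →
      Tendsto (fun n => eLpNorm (fun x => smoothing (1 - s n) (k n) V x - V x) 2
        (volume.restrict D)) atTop (𝓝 0) := fun V hVm hV =>
    tendsto_smoothing hDb hDo.measurableSet hball (fun n => by linarith [hs_le n]) (fun n => rfl)
      hs_lim hk hsupp hVm hV
  -- The reason for shrinking: for `x ∈ D` the kernel sees only convex combinations of `x` with
  -- points of the ball, all in `D`. As a function of `y` it is a test function on `D`, and the weak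
  -- derivative passes through the smoothing.
  have hder : ∀ n j, ∀ x ∈ D, pderiv j (smoothing (1 - s n) (k n) W) x =
      (1 - s n) * smoothing (1 - s n) (k n) (W' j) x := by
    intro n j x hx
    rw [pderiv_smoothing (hk n) hWl]
    congr 1
    set χ : Plane → ℝ := fun y => k n ((1 - s n) • x - y) with hχ
    have hχt : IsTestFunction D χ := by
      refine ⟨(hk n).smooth.comp (contDiff_const.sub contDiff_id),
        (hk n).hasCompactSupport_shift _, ?_⟩
      intro y hy
      have hy' : (1 - s n) • x - y ∈ tsupport (k n) :=
        tsupport_comp_subset_preimage (k n) (by fun_prop : Continuous fun y => (1 - s n) • x - y) hy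
      obtain ⟨z, hz, hzy⟩ := hsupp n _ hy'
      have : y = (1 - s n) • x + s n • z := by
        rw [sub_eq_iff_eq_add] at hzy
        rw [hzy]
        abel
      rw [this]
      exact hDc hx (hball hz) (by linarith [hs_le n]) (hs_pos n).le (by ring)
    have hχd : ∀ y, pderiv j χ y = - pderiv j (k n) ((1 - s n) • x - y) := by
      intro y
      have h1 : HasFDerivAt (fun y : Plane => (1 - s n) • x - y)
          (-(ContinuousLinearMap.id ℝ Plane)) y := (hasFDerivAt_id y).const_sub _
      have h2 := ((hk n).smooth.differentiable (by simp) ((1 - s n) • x - y)).hasFDerivAt.comp y h1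
      rw [pderiv, hχ]
      have h3 : (fun y => k n ((1 - s n) • x - y)) = k n ∘ fun y => (1 - s n) • x - y := rfl
      rw [h3, h2.fderiv]
      simp [pderiv]
    have hwd := (((hw.isWeakDeriv j).congr hWw (hWw' j)).2.2 χ hχt)
    rw [(hχt.pderiv j).setIntegral, hχt.setIntegral] at hwd
    simp only [hχd, mul_neg, integral_neg, neg_inj] at hwd
    exact hwd
  refine ⟨fun n => smoothing (1 - s n) (k n) W, fun n => contDiff_smoothing (hk n) hWl _, ?_, ?_⟩
  · refine (hlim W hWm hW2).congr fun n => eLpNorm_congr_ae ?_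
    filter_upwards [hWw] with x hx
    rw [hx]
  · intro j
    have h1 := hlim (W' j) (hWm' j) (hW2' j)
    -- The derivative carries the factor `1 - s n` instead of `1`; the defect `s n` times a bounded
    -- sequence tends to zero.
    have h2 : Tendsto (fun n => eLpNorm (fun x => s n * smoothing (1 - s n) (k n) (W' j) x) 2
        (volume.restrict D)) atTop (𝓝 0) := by
      have hb : ∀ n, eLpNorm (fun x => s n * smoothing (1 - s n) (k n) (W' j) x) 2
          (volume.restrict D) ≤ ENNReal.ofReal (s n) * (2 * eLpNorm (W' j) 2 volume) := by
        intro n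
        have : (fun x => s n * smoothing (1 - s n) (k n) (W' j) x) =
            s n • smoothing (1 - s n) (k n) (W' j) := rfl
        rw [this, eLpNorm_const_smul, Real.enorm_eq_ofReal (hs_pos n).le]
        gcongr
        refine (eLpNorm_mono_measure _ Measure.restrict_le_self).trans ?_
        have hln : 0 < 1 - s n := by linarith [hs_le n]
        refine (eLpNorm_smoothing_le (hk n) (hWm' j) hln).trans ?_
        gcongr
        rw [← ENNReal.ofReal_ofNat]
        refine ENNReal.ofReal_le_ofReal ?_
        rw [inv_le_comm₀ hln (by norm_num)]
        linarith [hs_le n]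
      refine tendsto_of_tendsto_of_tendsto_of_le_of_le tendsto_const_nhds ?_ (fun _ => zero_le) hb
      have := ENNReal.Tendsto.mul_const (ENNReal.tendsto_ofReal hs_lim)
        (b := 2 * eLpNorm (W' j) 2 volume)
        (Or.inr (ENNReal.mul_ne_top (by norm_num) (hW2' j).2.ne))
      simpa using this
    have h3 := h1.add h2
    rw [add_zero] at h3
    refine tendsto_of_tendsto_of_tendsto_of_le_of_le tendsto_const_nhds h3 (fun _ => zero_le)
      fun n => ?_
    have hsm := (contDiff_smoothing (hk n) ((hW2' j).locallyIntegrable (by norm_num))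
      (1 - s n)).continuous
    have m1 : AEStronglyMeasurable (fun x => smoothing (1 - s n) (k n) (W' j) x - W' j x)
        (volume.restrict D) := (hsm.measurable.sub (hWm' j)).aestronglyMeasurable
    have m2 : AEStronglyMeasurable (fun x => s n * smoothing (1 - s n) (k n) (W' j) x)
        (volume.restrict D) := (hsm.const_mul (s n)).aestronglyMeasurable
    have m3 := eLpNorm_sub_le m1 m2 (p := 2) (by norm_num)
    refine le_trans (le_of_eq ?_) m3
    refine eLpNorm_congr_ae ?_
    filter_upwards [hWw' j, ae_restrict_mem hDo.measurableSet] with x hx hxD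
    rw [hder n j x hxD, hx, Pi.sub_apply]
    ring

/-! ### The trace inequality -/

theorem fderiv_plane (F : Plane → ℝ) (x d : Plane) :
    fderiv ℝ F x d = d 0 * pderiv 0 F x + d 1 * pderiv 1 F x := by
  have hd : d = d 0 • EuclideanSpace.single 0 1 + d 1 • EuclideanSpace.single 1 1 := by
    ext i
    fin_cases i <;> simp
  conv_lhs => rw [hd]
  simp [pderiv]

/-- The barycentric coordinate of `a` in the triangle with vertices `a`, `b`, `c`. -/
def bary (a b c x : Plane) : ℝ := cross (x - c) (b - c) / cross (a - c) (b - c)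

theorem contDiff_bary (a b c : Plane) : ContDiff ℝ ∞ (bary a b c) := by
  unfold bary cross
  simp only [PiLp.sub_apply]
  fun_prop

theorem bary_affine (a b c x y : Plane) (s : ℝ) :
    bary a b c (x + s • y) = bary a b c x + s * (cross y (b - c) / cross (a - c) (b - c)) := by
  simp only [bary, cross, PiLp.sub_apply, PiLp.add_apply, PiLp.smul_apply, smul_eq_mul]
  ring

theorem bary_mem_Icc {a b c x : Plane} (hD : cross (a - c) (b - c) ≠ 0)
    (hx : x ∈ convexHull ℝ ({a, b, c} : Set Plane)) : 0 ≤ bary a b c x ∧ bary a b c x ≤ 1 := by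
  obtain ⟨s, r, hs, hr, hsr, rfl⟩ := mem_convexHull_triple.1 hx
  have : bary a b c (c + s • (a - c) + r • (b - c)) = s := by
    rw [bary_affine, bary_affine]
    simp [bary, cross] at *
    rw [div_self hD]
    ring_nf
  rw [this]
  exact ⟨hs, by linarith⟩

theorem fderiv_bary {a b c : Plane} (hD : cross (a - c) (b - c) ≠ 0) (x : Plane) :
    fderiv ℝ (bary a b c) x (a - c) = 1 := by
  have h1 := ((contDiff_bary a b c).differentiable (by simp) x).hasFDerivAt.hasLineDerivAt (a - c)
  have h2 : HasLineDerivAt ℝ (bary a b c) 1 x (a - c) := by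
    rw [HasLineDerivAt]
    simp only [bary_affine, div_self hD, mul_one]
    exact (hasDerivAt_id (0 : ℝ)).const_add _
  exact h1.unique h2

/-- Integrates the derivative of `φ² λ` along `a - c`, with `λ` the barycentric coordinate of `a`:
it vanishes on `cb`, equals `1 - s` on `ab`, and has slope one. Young's inequality with `0 ≤ λ ≤ 1`
bounds the integrand. -/
theorem integral_lineMap_bary_le {a b c : Plane} (hD : cross (a - c) (b - c) ≠ 0) {φ : Plane → ℝ}
    (hφ : ContDiff ℝ ∞ φ) :
    |cross (a - c) (b - c)| * ∫ s in (0 : ℝ)..1, φ (AffineMap.lineMap a b s) ^ 2 * (1 - s) ≤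
      2 * (∫ x in convexHull ℝ ({a, b, c} : Set Plane), φ x ^ 2) + ‖a - c‖ ^ 2 *
        ∑ j, ∫ x in convexHull ℝ ({a, b, c} : Set Plane), pderiv j φ x ^ 2 := by
  have hF : ContDiff ℝ 1 fun x => φ x ^ 2 * bary a b c x :=
    ((hφ.pow 2).mul (contDiff_bary a b c)).of_le (by simp)
  have key := integral_triangle_fderiv hD hF
  have e1 : ∀ s : ℝ, bary a b c (AffineMap.lineMap a b s) = 1 - s := by
    intro s
    simp only [bary, cross, AffineMap.lineMap_apply_module, PiLp.sub_apply, PiLp.add_apply,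
      PiLp.smul_apply, smul_eq_mul] at hD ⊢
    rw [div_eq_iff hD]
    ring
  have e2 : ∀ s : ℝ, bary a b c (AffineMap.lineMap c b s) = 0 := by
    intro s
    simp only [bary, cross, AffineMap.lineMap_apply_module, PiLp.sub_apply, PiLp.add_apply,
      PiLp.smul_apply, smul_eq_mul] at hD ⊢
    rw [div_eq_iff hD]
    ring
  simp only [e1, e2, mul_zero, intervalIntegral.integral_zero, sub_zero] at key
  rw [← key]
  have hcomp : IsCompact (convexHull ℝ ({a, b, c} : Set Plane)) :=
    Set.Finite.isCompact_convexHull ℝ (by simp)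
  have hint : ∀ f : Plane → ℝ, Continuous f →
      IntegrableOn f (convexHull ℝ ({a, b, c} : Set Plane)) := fun f hf =>
    hf.continuousOn.integrableOn_compact hcomp
  have c0 := hφ.continuous
  have c1 := fun j => (contDiff_pderiv hφ j).continuous
  rw [Fin.sum_univ_two, ← integral_add (hint _ (by fun_prop)) (hint _ (by fun_prop)),
    ← integral_const_mul, ← integral_const_mul,
    ← integral_add (hint _ (by fun_prop)) (hint _ (by fun_prop))]
  refine setIntegral_mono_on (hint _ ?_) (hint _ (by fun_prop)) hcomp.measurableSet ?_
  · exact (hF.continuous_fderiv (by simp)).clm_apply continuous_const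
  intro x hx
  have h1 := (hφ.differentiable (by simp) x).hasFDerivAt
  have h2 := ((contDiff_bary a b c).differentiable (by simp) x).hasFDerivAt
  have h3 := (h1.pow 2).mul h2
  have hb := bary_mem_Icc hD hx
  have h4 : fderiv ℝ (fun x => φ x ^ 2 * bary a b c x) x (a - c) =
      φ x ^ 2 + bary a b c x * (2 * φ x * fderiv ℝ φ x (a - c)) := by
    have : (fun x => φ x ^ 2 * bary a b c x) = (fun x => φ x ^ 2) * bary a b c := rfl
    rw [this, h3.fderiv]
    simp [fderiv_bary hD]
  rw [h4, fderiv_plane, norm_sq_plane]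
  generalize bary a b c x = β at hb
  generalize (a - c) 0 = p
  generalize (a - c) 1 = q
  generalize pderiv 0 φ x = P
  generalize pderiv 1 φ x = Q
  generalize φ x = z
  have i1 : β * (2 * z * (p * P + q * Q)) ≤ z ^ 2 + β ^ 2 * (p * P + q * Q) ^ 2 := by
    nlinarith [sq_nonneg (z - β * (p * P + q * Q))]
  have i2 : β ^ 2 * (p * P + q * Q) ^ 2 ≤ (p * P + q * Q) ^ 2 :=
    mul_le_of_le_one_left (sq_nonneg _) (by nlinarith)
  have i3 : (p * P + q * Q) ^ 2 ≤ (p ^ 2 + q ^ 2) * (P ^ 2 + Q ^ 2) := by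
    nlinarith [sq_nonneg (p * Q - q * P)]
  linarith

/-- Exchanging `a` and `b` replaces the weight `1 - s` by `s`; the two weights add up to one. -/
theorem integral_lineMap_sq_le {a b c : Plane} (hD : cross (a - c) (b - c) ≠ 0) :
    ∃ C : ℝ, 0 ≤ C ∧ ∀ φ : Plane → ℝ, ContDiff ℝ ∞ φ →
      ∫ s in (0 : ℝ)..1, φ (AffineMap.lineMap a b s) ^ 2 ≤
        C * ((∫ x in convexHull ℝ ({a, b, c} : Set Plane), φ x ^ 2) +
          ∑ j, ∫ x in convexHull ℝ ({a, b, c} : Set Plane), pderiv j φ x ^ 2) := by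
  have hD' : cross (b - c) (a - c) ≠ 0 := by rw [cross_swap]; simpa
  refine ⟨(4 + ‖a - c‖ ^ 2 + ‖b - c‖ ^ 2) / |cross (a - c) (b - c)|, by positivity, fun φ hφ => ?_⟩
  have h1 := integral_lineMap_bary_le hD hφ
  have h2 := integral_lineMap_bary_le hD' hφ
  have hset : ({b, a, c} : Set Plane) = {a, b, c} := Set.insert_comm b a {c}
  rw [cross_swap, abs_neg, hset] at h2
  have c0 := hφ.continuous
  have hsw : ∫ s in (0 : ℝ)..1, φ (AffineMap.lineMap b a s) ^ 2 * (1 - s) =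
      ∫ s in (0 : ℝ)..1, φ (AffineMap.lineMap a b s) ^ 2 * s := by
    have := intervalIntegral.integral_comp_sub_left (a := 0) (b := 1)
      (fun s => φ (AffineMap.lineMap a b s) ^ 2 * s) (1 : ℝ)
    simpa [AffineMap.lineMap_apply_one_sub] using this
  have hcl : Continuous (AffineMap.lineMap a b : ℝ → Plane) := AffineMap.lineMap_continuous
  have hsum : ∫ s in (0 : ℝ)..1, φ (AffineMap.lineMap a b s) ^ 2 =
      (∫ s in (0 : ℝ)..1, φ (AffineMap.lineMap a b s) ^ 2 * (1 - s)) +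
        ∫ s in (0 : ℝ)..1, φ (AffineMap.lineMap a b s) ^ 2 * s := by
    rw [← intervalIntegral.integral_add]
    · congr 1
      funext s
      ring
    · exact Continuous.intervalIntegrable (by fun_prop) _ _
    · exact Continuous.intervalIntegrable (by fun_prop) _ _
  rw [hsw] at h2
  rw [hsum, div_mul_eq_mul_div, le_div_iff₀ (abs_pos.2 hD)]
  have p1 : 0 ≤ ∫ x in convexHull ℝ ({a, b, c} : Set Plane), φ x ^ 2 :=
    integral_nonneg fun x => sq_nonneg _
  have p2 : 0 ≤ ∑ j, ∫ x in convexHull ℝ ({a, b, c} : Set Plane), pderiv j φ x ^ 2 :=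
    Finset.sum_nonneg fun j _ => integral_nonneg fun x => sq_nonneg _
  nlinarith [mul_nonneg (sq_nonneg ‖a - c‖) p1, mul_nonneg (sq_nonneg ‖b - c‖) p1]

theorem eLpNorm_two_sq_eq_integral {μ : Measure Plane} {f : Plane → ℝ} (hf : MemLp f 2 μ) :
    eLpNorm f 2 μ ^ 2 = ENNReal.ofReal (∫ x, f x ^ 2 ∂μ) := by
  rw [eLpNorm_two_sq, ofReal_integral_eq_lintegral_ofReal hf.integrable_sq
    (ae_of_all _ fun x => sq_nonneg _)]
  refine lintegral_congr fun x => ?_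
  rw [← enorm_pow, Real.enorm_eq_ofReal (sq_nonneg _)]

theorem card_of_mem_sides {K e : Finset Plane} (he : e ∈ sides K) : e.card = 2 :=
  (Finset.mem_powersetCard.1 he).2

/-- The trace inequality on a triangle. -/
theorem IsTriangle.eLpNorm_arcLength_le {K e : Finset Plane} (hK : IsTriangle K)
    (he : e ∈ sides K) :
    ∃ C : ENNReal, C ≠ ⊤ ∧ ∀ φ : Plane → ℝ, ContDiff ℝ ∞ φ → eLpNorm φ 2 (arcLength e) ≤
      C * (eLpNorm φ 2 (volume.restrict (cell K)) +
        ∑ j, eLpNorm (pderiv j φ) 2 (volume.restrict (cell K))) := by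
  have hcard := card_of_mem_sides he
  obtain ⟨a, b, c, hab, hac, hbc, rfl, rfl, hD⟩ := hK.exists_opposite he
  obtain ⟨C, hC, h⟩ := integral_lineMap_sq_le hD
  refine ⟨ENNReal.ofReal (Real.sqrt (dist a b * C)), ENNReal.ofReal_ne_top, fun φ hφ => ?_⟩
  have c1 := fun j => (contDiff_pderiv hφ j).continuous
  refine (ENNReal.pow_le_pow_left_iff two_ne_zero).1 ?_
  rw [eLpNorm_two_sq_eq_integral (memLp_arcLength hφ.continuous hcard),
    integral_arcLength_pair a b (F := fun x => φ x ^ 2) (hφ.continuous.pow 2)]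
  have h1 := h φ hφ
  have hset : ((({a, b, c} : Finset Plane) : Set Plane)) = {a, b, c} := by simp
  rw [← hset] at h1
  change _ ≤ C * ((∫ x in hull {a, b, c}, φ x ^ 2) +
    ∑ j, ∫ x in hull {a, b, c}, pderiv j φ x ^ 2) at h1
  rw [← restrict_cell] at h1
  calc ENNReal.ofReal (dist a b * ∫ s in (0 : ℝ)..1, φ (AffineMap.lineMap a b s) ^ 2)
      ≤ ENNReal.ofReal (dist a b * C * ((∫ x in cell {a, b, c}, φ x ^ 2) +
          ∑ j, ∫ x in cell {a, b, c}, pderiv j φ x ^ 2)) := by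
        refine ENNReal.ofReal_le_ofReal ?_
        rw [mul_assoc]
        gcongr
    _ = ENNReal.ofReal (Real.sqrt (dist a b * C)) ^ 2 *
        (eLpNorm φ 2 (volume.restrict (cell {a, b, c})) ^ 2 +
          ∑ j, eLpNorm (pderiv j φ) 2 (volume.restrict (cell {a, b, c})) ^ 2) := by
        rw [ENNReal.ofReal_mul (by positivity), ← ENNReal.ofReal_pow (Real.sqrt_nonneg _),
          Real.sq_sqrt (by positivity), ENNReal.ofReal_add
            (integral_nonneg fun x => sq_nonneg _)
            (Finset.sum_nonneg fun j _ => integral_nonneg fun x => sq_nonneg _),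
          ENNReal.ofReal_sum_of_nonneg (fun j _ => integral_nonneg fun x => sq_nonneg _),
          eLpNorm_two_sq_eq_integral (memL2_cell hφ.continuous _)]
        congr 3
        funext j
        rw [eLpNorm_two_sq_eq_integral (memL2_cell (c1 j) _)]
    _ ≤ _ := by
        rw [mul_pow]
        gcongr
        rw [Fin.sum_univ_two, Fin.sum_univ_two]
        generalize eLpNorm φ 2 _ = A
        generalize eLpNorm (pderiv 0 φ) 2 _ = B
        generalize eLpNorm (pderiv 1 φ) 2 _ = E
        -- A sum of squares is at most the square of the sum.
        calc A ^ 2 + (B ^ 2 + E ^ 2) ≤ A ^ 2 + (B ^ 2 + E ^ 2) + (2 * A * B + 2 * A * E + 2 * B * E) :=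
              le_self_add
          _ = _ := by ring

/-! ### Traces on the edges of a triangle -/

/-- The distance in `H¹(K)` of the smooth function `φ` to `w`. -/
def sobolevDist (K : Finset Plane) (w φ : Plane → ℝ) : ENNReal :=
  eLpNorm (fun x => φ x - w x) 2 (volume.restrict (cell K)) +
    ∑ j, eLpNorm (fun x => pderiv j φ x - weakDeriv (cell K) j w x) 2 (volume.restrict (cell K))

theorem tendsto_sobolevDist {K : Finset Plane} {w : Plane → ℝ} {φ : ℕ → Plane → ℝ}
    (h0 : Tendsto (fun n => eLpNorm (fun x => φ n x - w x) 2 (volume.restrict (cell K)))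
      atTop (𝓝 0))
    (h1 : ∀ j, Tendsto (fun n => eLpNorm (fun x => pderiv j (φ n) x - weakDeriv (cell K) j w x) 2
        (volume.restrict (cell K))) atTop (𝓝 0)) :
    Tendsto (fun n => sobolevDist K w (φ n)) atTop (𝓝 0) := by
  have := h0.add (tendsto_finsetSum Finset.univ fun j _ => h1 j)
  simpa [sobolevDist] using this

theorem pderiv_sub {φ ψ : Plane → ℝ} (hφ : ContDiff ℝ ∞ φ) (hψ : ContDiff ℝ ∞ ψ) (j : Fin 2)
    (x : Plane) : pderiv j (φ - ψ) x = pderiv j φ x - pderiv j ψ x := by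
  rw [pderiv, fderiv_sub (hφ.differentiable (by simp) x) (hψ.differentiable (by simp) x)]
  rfl

theorem eLpNorm_sub_le_add {μ : Measure Plane} {f g w : Plane → ℝ} (hf : AEStronglyMeasurable f μ)
    (hg : AEStronglyMeasurable g μ) (hw : AEStronglyMeasurable w μ) :
    eLpNorm (f - g) 2 μ ≤
      eLpNorm (fun x => f x - w x) 2 μ + eLpNorm (fun x => g x - w x) 2 μ := by
  have h := eLpNorm_sub_le (hf.sub hw) (hg.sub hw) (p := 2) (by norm_num)
  rwa [sub_sub_sub_cancel_right] at h

/-- The trace inequality for `φ - ψ`, with the difference measured through `w`. It gives both the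
existence of traces, by a Cauchy argument, and their uniqueness. -/
theorem IsTriangle.exists_trace_bound {K e : Finset Plane} (hK : IsTriangle K) (he : e ∈ sides K)
    {w : Plane → ℝ} (hw : MemSobolev 1 (cell K) w) :
    ∃ C : ENNReal, C ≠ ⊤ ∧ ∀ φ ψ : Plane → ℝ, ContDiff ℝ ∞ φ → ContDiff ℝ ∞ ψ →
      eLpNorm (φ - ψ) 2 (arcLength e) ≤ C * (sobolevDist K w φ + sobolevDist K w ψ) := by
  obtain ⟨C, hC, h⟩ := hK.eLpNorm_arcLength_le he
  refine ⟨C, hC, fun φ ψ hφ hψ => (h _ (hφ.sub hψ)).trans (mul_le_mul' le_rfl ?_)⟩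
  have h0 := eLpNorm_sub_le_add (μ := volume.restrict (cell K)) hφ.continuous.aestronglyMeasurable
    hψ.continuous.aestronglyMeasurable hw.memL2.1
  have h1 : ∀ j, eLpNorm (pderiv j (φ - ψ)) 2 (volume.restrict (cell K)) ≤
      eLpNorm (fun x => pderiv j φ x - weakDeriv (cell K) j w x) 2 (volume.restrict (cell K)) +
      eLpNorm (fun x => pderiv j ψ x - weakDeriv (cell K) j w x) 2 (volume.restrict (cell K)) := by
    intro j
    have : pderiv j (φ - ψ) = pderiv j φ - pderiv j ψ := funext fun x => pderiv_sub hφ hψ j x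
    rw [this]
    exact eLpNorm_sub_le_add (contDiff_pderiv hφ j).continuous.aestronglyMeasurable
      (contDiff_pderiv hψ j).continuous.aestronglyMeasurable (hw.weakDeriv (isOpen_cell K) j).memL2.1
  refine (add_le_add h0 (Finset.sum_le_sum fun j _ => h1 j)).trans_eq ?_
  rw [Finset.sum_add_distrib, sobolevDist, sobolevDist]
  abel

theorem exists_L2_limit {μ : Measure Plane} {φ : ℕ → Plane → ℝ} (hφ : ∀ n, MemLp (φ n) 2 μ)
    {E : ℕ → ENNReal} (hE : Tendsto E atTop (𝓝 0)) {C : ENNReal} (hC : C ≠ ⊤)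
    (h : ∀ n m, eLpNorm (φ n - φ m) 2 μ ≤ C * (E n + E m)) :
    ∃ g, MemLp g 2 μ ∧ Tendsto (fun n => eLpNorm (fun x => φ n x - g x) 2 μ) atTop (𝓝 0) := by
  have : Fact ((1 : ENNReal) ≤ 2) := ⟨by norm_num⟩
  have hcau : CauchySeq fun n => (hφ n).toLp (φ n) := by
    rw [Lp.cauchySeq_Lp_iff_cauchySeq_eLpNorm]
    have h1 : Tendsto (fun n : ℕ × ℕ => C * (E n.1 + E n.2)) atTop (𝓝 0) := by
      rw [← prod_atTop_atTop_eq]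
      have := ENNReal.Tendsto.const_mul ((hE.comp tendsto_fst).add (hE.comp tendsto_snd))
        (Or.inr hC) (f := atTop ×ˢ atTop)
      simpa using this
    refine tendsto_of_tendsto_of_tendsto_of_le_of_le tendsto_const_nhds h1 (fun _ => zero_le)
      fun n => ?_
    refine le_trans (le_of_eq ?_) (h n.1 n.2)
    exact eLpNorm_congr_ae ((hφ n.1).coeFn_toLp.sub (hφ n.2).coeFn_toLp)
  obtain ⟨g, hg⟩ := cauchySeq_tendsto_of_complete hcau
  rw [Lp.tendsto_Lp_iff_tendsto_eLpNorm'] at hg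
  refine ⟨g, Lp.memLp g, hg.congr fun n => eLpNorm_congr_ae ?_⟩
  exact (hφ n).coeFn_toLp.sub (ae_eq_refl _)

/-- One approximating sequence serves all three sides at once, so that Green's formula can pass to
the limit along it. -/
theorem IsTriangle.exists_isTrace {K : Finset Plane} (hK : IsTriangle K)
    {w : Plane → ℝ} (hw : MemSobolev 1 (cell K) w) :
    ∃ φ : ℕ → Plane → ℝ, (∀ n, ContDiff ℝ ∞ (φ n)) ∧
      Tendsto (fun n => eLpNorm (fun x => φ n x - w x) 2 (volume.restrict (cell K)))
        atTop (𝓝 0) ∧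
      (∀ j, Tendsto (fun n => eLpNorm (fun x => pderiv j (φ n) x - weakDeriv (cell K) j w x) 2
        (volume.restrict (cell K))) atTop (𝓝 0)) ∧
      ∀ e ∈ sides K, ∃ g, MemLp g 2 (arcLength e) ∧
        Tendsto (fun n => eLpNorm (fun x => φ n x - g x) 2 (arcLength e)) atTop (𝓝 0) := by
  have hb : Bornology.IsBounded (cell K) := (isCompact_hull K).isBounded.subset interior_subset
  obtain ⟨φ, h1, h2, h3⟩ := exists_smooth_approx (isOpen_cell K) (convex_hull K).interior hb hw
  refine ⟨φ, h1, h2, h3, fun e he => ?_⟩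
  obtain ⟨C, hC, h⟩ := hK.exists_trace_bound he hw
  exact exists_L2_limit (fun n => memLp_arcLength (h1 n).continuous (card_of_mem_sides he))
    (tendsto_sobolevDist h2 h3) hC fun n m => h _ _ (h1 n) (h1 m)

theorem IsTriangle.isTrace_trace {K e : Finset Plane} (hK : IsTriangle K) (he : e ∈ sides K)
    {w : Plane → ℝ} (hw : MemSobolev 1 (cell K) w) : IsTrace K e w (trace K e w) := by
  obtain ⟨φ, h1, h2, h3, h4⟩ := hK.exists_isTrace hw
  obtain ⟨g, hg, h5⟩ := h4 e he
  exact Classical.epsilon_spec (p := IsTrace K e w) ⟨g, hw, hg, φ, h1, h2, h3, h5⟩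

theorem IsTriangle.isTrace_unique {K e : Finset Plane} (hK : IsTriangle K) (he : e ∈ sides K)
    {w g g' : Plane → ℝ} (h : IsTrace K e w g) (h' : IsTrace K e w g') : g =ᵐ[arcLength e] g' := by
  obtain ⟨hw, hg, φ, h1, h2, h3, h4⟩ := h
  obtain ⟨-, hg', ψ, h1', h2', h3', h4'⟩ := h'
  obtain ⟨C, hC, hbd⟩ := hK.exists_trace_bound he hw
  have hz : eLpNorm (g - g') 2 (arcLength e) = 0 := by
    have hlim : Tendsto (fun n => eLpNorm (fun x => φ n x - g x) 2 (arcLength e) +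
        (eLpNorm (fun x => ψ n x - g' x) 2 (arcLength e) +
          C * (sobolevDist K w (φ n) + sobolevDist K w (ψ n)))) atTop (𝓝 0) := by
      have := h4.add (h4'.add (ENNReal.Tendsto.const_mul
        ((tendsto_sobolevDist h2 h3).add (tendsto_sobolevDist h2' h3')) (Or.inr hC)))
      simpa using this
    refine le_antisymm (ge_of_tendsto' hlim fun n => ?_) zero_le
    have m1 := (h1 n).continuous.aestronglyMeasurable (μ := arcLength e)
    have m2 := (h1' n).continuous.aestronglyMeasurable (μ := arcLength e)
    -- Two approximating sequences may differ, but their restrictions to the edge approach each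
    -- other by the trace bound.
    have e1 : g - g' = (fun x => ψ n x - g' x) - (fun x => φ n x - g x) + (φ n - ψ n) := by
      funext x
      simp only [Pi.add_apply, Pi.sub_apply]
      ring
    rw [e1]
    refine (eLpNorm_add_le ((m2.sub hg'.1).sub (m1.sub hg.1)) (m1.sub m2) (by norm_num)).trans ?_
    have k1 := eLpNorm_sub_le (m2.sub hg'.1) (m1.sub hg.1) (p := 2) (by norm_num)
    refine (add_le_add k1 (hbd _ _ (h1 n) (h1' n))).trans_eq ?_
    rw [add_comm (eLpNorm (ψ n - g') 2 (arcLength e)), add_assoc]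
    rfl
  rw [eLpNorm_eq_zero_iff (hg.1.sub hg'.1) (by norm_num)] at hz
  filter_upwards [hz] with x hx
  exact sub_eq_zero.1 hx

theorem IsTriangle.trace_ae_eq {K e : Finset Plane} (hK : IsTriangle K) (he : e ∈ sides K)
    {w g : Plane → ℝ} (h : IsTrace K e w g) : trace K e w =ᵐ[arcLength e] g :=
  hK.isTrace_unique he (hK.isTrace_trace he h.1) h

theorem IsTriangle.memLp_trace {K e : Finset Plane} (hK : IsTriangle K) (he : e ∈ sides K)
    {w : Plane → ℝ} (hw : MemSobolev 1 (cell K) w) : MemLp (trace K e w) 2 (arcLength e) :=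
  (hK.isTrace_trace he hw).2.1

theorem weakDeriv_congr {D : Set Plane} (hD : IsOpen D) {j : Fin 2} {w z : Plane → ℝ}
    (hw : MemSobolev 1 D w) (h : w =ᵐ[volume.restrict D] z) :
    weakDeriv D j w =ᵐ[volume.restrict D] weakDeriv D j z :=
  (((hw.isWeakDeriv j).congr h (ae_eq_refl _)).weakDeriv_ae_eq hD).symm

theorem weakDeriv_sub {D : Set Plane} (hD : IsOpen D) (j : Fin 2) {w z : Plane → ℝ}
    (hw : MemSobolev 1 D w) (hz : MemSobolev 1 D z) :
    weakDeriv D j (fun x => w x - z x) =ᵐ[volume.restrict D]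
      fun x => weakDeriv D j w x - weakDeriv D j z x :=
  ((hw.isWeakDeriv j).sub (hz.isWeakDeriv j)).weakDeriv_ae_eq hD

theorem weakDeriv_const_mul {D : Set Plane} (hD : IsOpen D) (j : Fin 2) {w : Plane → ℝ}
    (hw : MemSobolev 1 D w) (c : ℝ) :
    weakDeriv D j (fun x => c * w x) =ᵐ[volume.restrict D] fun x => c * weakDeriv D j w x :=
  ((hw.isWeakDeriv j).const_mul c).weakDeriv_ae_eq hD

theorem IsTrace.congr {K e : Finset Plane} {w z g : Plane → ℝ} (h : IsTrace K e w g)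
    (hz : w =ᵐ[volume.restrict (cell K)] z) : IsTrace K e z g := by
  obtain ⟨hw, hg, φ, h1, h2, h3, h4⟩ := h
  refine ⟨hw.congr hz, hg, φ, h1, h2.congr fun n => eLpNorm_congr_ae ?_,
    fun j => (h3 j).congr fun n => eLpNorm_congr_ae ?_, h4⟩
  · filter_upwards [hz] with x hx
    rw [hx]
  · filter_upwards [weakDeriv_congr (j := j) (isOpen_cell K) hw hz] with x hx
    rw [hx]

theorem IsTrace.sub {K e : Finset Plane} {w z g h : Plane → ℝ} (hw : IsTrace K e w g)
    (hz : IsTrace K e z h) : IsTrace K e (fun x => w x - z x) (fun x => g x - h x) := by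
  obtain ⟨hw, hg, φ, h1, h2, h3, h4⟩ := hw
  obtain ⟨hz, hh, ψ, h1', h2', h3', h4'⟩ := hz
  have key : ∀ {μ : Measure Plane} {F G : ℕ → Plane → ℝ} {f g : Plane → ℝ},
      (∀ n, AEStronglyMeasurable (F n) μ) → (∀ n, AEStronglyMeasurable (G n) μ) →
      AEStronglyMeasurable f μ → AEStronglyMeasurable g μ →
      Tendsto (fun n => eLpNorm (fun x => F n x - f x) 2 μ) atTop (𝓝 0) →
      Tendsto (fun n => eLpNorm (fun x => G n x - g x) 2 μ) atTop (𝓝 0) →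
      Tendsto (fun n => eLpNorm (fun x => (F n x - G n x) - (f x - g x)) 2 μ) atTop (𝓝 0) := by
    intro μ F G f g mF mG mf mg hF hG
    have := hF.add hG
    rw [add_zero] at this
    refine tendsto_of_tendsto_of_tendsto_of_le_of_le tendsto_const_nhds this (fun _ => zero_le)
      fun n => ?_
    refine le_trans (le_of_eq ?_) (eLpNorm_sub_le ((mF n).sub mf) ((mG n).sub mg) (by norm_num))
    congr 1
    funext x
    simp only [Pi.sub_apply]
    ring
  refine ⟨hw.sub hz, hg.sub hh, fun n => φ n - ψ n, fun n => (h1 n).sub (h1' n), ?_, fun j => ?_, ?_⟩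
  · exact key (fun n => (h1 n).continuous.aestronglyMeasurable)
      (fun n => (h1' n).continuous.aestronglyMeasurable) hw.memL2.1 hz.memL2.1 h2 h2'
  · have := key (fun n => (contDiff_pderiv (h1 n) j).continuous.aestronglyMeasurable)
      (fun n => (contDiff_pderiv (h1' n) j).continuous.aestronglyMeasurable)
      (hw.weakDeriv (isOpen_cell K) j).memL2.1 (hz.weakDeriv (isOpen_cell K) j).memL2.1
      (h3 j) (h3' j)
    refine this.congr fun n => eLpNorm_congr_ae ?_
    filter_upwards [weakDeriv_sub (isOpen_cell K) j hw hz] with x hx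
    rw [hx, pderiv_sub (h1 n) (h1' n)]
  · exact key (fun n => (h1 n).continuous.aestronglyMeasurable)
      (fun n => (h1' n).continuous.aestronglyMeasurable) hg.1 hh.1 h4 h4'

/-- A constant sequence approximates. -/
theorem isTrace_of_contDiff {K e : Finset Plane} (he : e ∈ sides K) {ψ : Plane → ℝ}
    (hψ : ContDiff ℝ ∞ ψ) : IsTrace K e ψ ψ := by
  refine ⟨memSobolev_of_contDiff hψ K 1, memLp_arcLength hψ.continuous (card_of_mem_sides he),
    fun _ => ψ, fun _ => hψ, by simp, fun j => ?_, by simp⟩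
  refine tendsto_const_nhds.congr fun n => ?_
  symm
  rw [← eLpNorm_zero (p := 2) (μ := volume.restrict (cell K)) (α := Plane) (ε := ℝ)]
  refine eLpNorm_congr_ae ?_
  filter_upwards [(isWeakDeriv_of_contDiff (cell K) hψ j).weakDeriv_ae_eq (isOpen_cell K)] with x hx
  simp [hx]

theorem IsTrace.const_mul {K e : Finset Plane} {w g : Plane → ℝ} (h : IsTrace K e w g) (c : ℝ) :
    IsTrace K e (fun x => c * w x) (fun x => c * g x) := by
  obtain ⟨hw, hg, φ, h1, h2, h3, h4⟩ := h
  have key : ∀ {μ : Measure Plane} {F : ℕ → Plane → ℝ} {f : Plane → ℝ},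
      Tendsto (fun n => eLpNorm (fun x => F n x - f x) 2 μ) atTop (𝓝 0) →
      Tendsto (fun n => eLpNorm (fun x => c * F n x - c * f x) 2 μ) atTop (𝓝 0) := by
    intro μ F f hF
    have := ENNReal.Tendsto.const_mul hF (a := ‖c‖ₑ) (Or.inr enorm_ne_top)
    rw [mul_zero] at this
    refine this.congr fun n => ?_
    rw [← eLpNorm_const_smul]
    congr 1
    funext x
    simp only [Pi.smul_apply, smul_eq_mul]
    ring
  refine ⟨hw.const_mul c, hg.const_mul c, fun n x => c * φ n x, fun n => contDiff_const.mul (h1 n),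
    key h2, fun j => ?_, key h4⟩
  refine (key (h3 j)).congr fun n => eLpNorm_congr_ae ?_
  filter_upwards [weakDeriv_const_mul (isOpen_cell K) j hw c] with x hx
  have hc : pderiv j (fun x => c * φ n x) x = c * pderiv j (φ n) x := by
    rw [pderiv, fderiv_const_mul ((h1 n).differentiable (by simp) x)]
    rfl
  rw [hx, hc]

/-! ### Green's formula -/

/-- Hölder's inequality: convergence in `L²` gives convergence in `L¹` after multiplication by a
fixed `L²` function. -/
theorem tendsto_integral_mul {μ : Measure Plane} {F : ℕ → Plane → ℝ} {f ψ : Plane → ℝ}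
    (hF : ∀ n, MemLp (F n) 2 μ) (hf : MemLp f 2 μ) (hψ : MemLp ψ 2 μ)
    (h : Tendsto (fun n => eLpNorm (fun x => F n x - f x) 2 μ) atTop (𝓝 0)) :
    Tendsto (fun n => ∫ x, F n x * ψ x ∂μ) atTop (𝓝 (∫ x, f x * ψ x ∂μ)) := by
  refine tendsto_integral_of_L1' _ (hf.integrable_mul hψ).1
    (Eventually.of_forall fun n => (hF n).integrable_mul hψ) ?_
  have h1 := ENNReal.Tendsto.mul_const h (b := eLpNorm ψ 2 μ) (Or.inr hψ.2.ne)
  rw [zero_mul] at h1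
  refine tendsto_of_tendsto_of_tendsto_of_le_of_le tendsto_const_nhds h1 (fun _ => zero_le)
    fun n => ?_
  refine le_trans (le_of_eq ?_) (eLpNorm_smul_le_mul_eLpNorm (p := 2) (q := 2) (r := 1) hψ.1
    ((hF n).1.sub hf.1))
  congr 1
  funext x
  simp [sub_mul]

/-- The divergence theorem for the product `φ ψ` in a coordinate direction. -/
theorem IsTriangle.green_of_contDiff {K : Finset Plane} (hK : IsTriangle K) {φ ψ : Plane → ℝ}
    (hφ : ContDiff ℝ ∞ φ) (hψ : ContDiff ℝ ∞ ψ) (j : Fin 2) :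
    (∫ x in cell K, φ x * pderiv j ψ x) + ∫ x in cell K, pderiv j φ x * ψ x =
      ∑ e ∈ sides K, outwardNormal K e j * ∫ x, φ x * ψ x ∂(arcLength e) := by
  have h := hK.divergence (F := fun x => φ x * ψ x) ((hφ.mul hψ).of_le (by simp))
    (EuclideanSpace.single j 1)
  have h1 : ∀ e, inner ℝ (outwardNormal K e) (EuclideanSpace.single j 1) = outwardNormal K e j := by
    intro e
    rw [inner_plane]
    fin_cases j <;> simp
  simp only [h1] at h
  rw [← h, ← integral_add]
  · refine integral_congr_ae (ae_of_all _ fun x => ?_)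
    simp only [pderiv]
    rw [fderiv_fun_mul (hφ.differentiable (by simp) x) (hψ.differentiable (by simp) x)]
    simp
    ring
  · exact (memL2_cell hφ.continuous K).integrable_mul
      (memL2_cell (contDiff_pderiv hψ j).continuous K)
  · exact (memL2_cell (contDiff_pderiv hφ j).continuous K).integrable_mul
      (memL2_cell hψ.continuous K)

/-- Limit of the smooth formula. The second factor stays smooth, which suffices because discrete
functions are polynomials on each triangle. -/
theorem IsTriangle.green {K : Finset Plane} (hK : IsTriangle K) {w ψ : Plane → ℝ}
    (hw : MemSobolev 1 (cell K) w) (hψ : ContDiff ℝ ∞ ψ) (j : Fin 2) :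
    (∫ x in cell K, w x * pderiv j ψ x) + ∫ x in cell K, weakDeriv (cell K) j w x * ψ x =
      ∑ e ∈ sides K, outwardNormal K e j * ∫ x, trace K e w x * ψ x ∂(arcLength e) := by
  obtain ⟨φ, h1, h2, h3, h4⟩ := hK.exists_isTrace hw
  have l1 := tendsto_integral_mul (fun n => memL2_cell (h1 n).continuous K) hw.memL2
    (memL2_cell (contDiff_pderiv hψ j).continuous K) h2
  have l2 := tendsto_integral_mul (fun n => memL2_cell (contDiff_pderiv (h1 n) j).continuous K)
    (hw.weakDeriv (isOpen_cell K) j).memL2 (memL2_cell hψ.continuous K) (h3 j)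
  have l3 : Tendsto (fun n => ∑ e ∈ sides K,
      outwardNormal K e j * ∫ x, φ n x * ψ x ∂(arcLength e)) atTop
      (𝓝 (∑ e ∈ sides K, outwardNormal K e j * ∫ x, trace K e w x * ψ x ∂(arcLength e))) := by
    refine tendsto_finsetSum _ fun e he => Tendsto.const_mul _ ?_
    obtain ⟨g, hg, h5⟩ := h4 e he
    have htr := hK.trace_ae_eq he ⟨hw, hg, φ, h1, h2, h3, h5⟩
    have := tendsto_integral_mul
      (fun n => memLp_arcLength (h1 n).continuous (card_of_mem_sides he)) hg
      (memLp_arcLength hψ.continuous (card_of_mem_sides he)) h5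
    rwa [integral_congr_ae (g := fun x => trace K e w x * ψ x)] at this
    filter_upwards [htr] with x hx
    rw [hx]
  refine tendsto_nhds_unique (l1.add l2) (l3.congr fun n => ?_)
  exact (hK.green_of_contDiff (h1 n) hψ j).symm

/-! ### Projections on polynomials -/

theorem integrable_fun_mul {μ : Measure Plane} {f g : Plane → ℝ} (hf : MemLp f 2 μ)
    (hg : MemLp g 2 μ) : Integrable (fun x => f x * g x) μ :=
  hf.integrable_mul hg

/-- Continuous functions are square integrable. -/
def ContinuousMemL2 (μ : Measure Plane) : Prop := ∀ ψ : Plane → ℝ, Continuous ψ → MemLp ψ 2 μ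

theorem continuousMemL2_cell (K : Finset Plane) : ContinuousMemL2 (volume.restrict (cell K)) :=
  fun _ h => memL2_cell h K

theorem continuousMemL2_arcLength {e : Finset Plane} (he : e.card = 2) :
    ContinuousMemL2 (arcLength e) := fun _ h => memLp_arcLength h he

theorem continuous_polyFun (P : MvPolynomial (Fin 2) ℝ) : Continuous (polyFun P) :=
  (contDiff_polyFun P).continuous

theorem polyFun_sub (P Q : MvPolynomial (Fin 2) ℝ) (x : Plane) :
    polyFun (P - Q) x = polyFun P x - polyFun Q x := by simp [polyFun]

theorem IsPolyOn.memLp {m : ℕ} {μ : Measure Plane} (hμ : ContinuousMemL2 μ) {w : Plane → ℝ}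
    (h : IsPolyOn m μ w) : MemLp w 2 μ := by
  obtain ⟨P, -, hP⟩ := h
  exact (memLp_congr_ae hP).2 (hμ _ (continuous_polyFun P))

theorem IsPolyOn.sub {m : ℕ} {μ : Measure Plane} {w z : Plane → ℝ} (hw : IsPolyOn m μ w)
    (hz : IsPolyOn m μ z) : IsPolyOn m μ (fun x => w x - z x) := by
  obtain ⟨P, hP, hPw⟩ := hw
  obtain ⟨Q, hQ, hQz⟩ := hz
  refine ⟨P - Q, (MvPolynomial.totalDegree_sub P Q).trans (max_le hP hQ), ?_⟩
  filter_upwards [hPw, hQz] with x h1 h2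
  rw [h1, h2, polyFun_sub]

theorem exists_isPolyProj {μ : Measure Plane} (hμ : ContinuousMemL2 μ) (m : ℕ) {w : Plane → ℝ}
    (hw : MemLp w 2 μ) : ∃ π, IsPolyProj m μ w π := by
  have hP := fun P : MvPolynomial (Fin 2) ℝ => hμ _ (continuous_polyFun P)
  let L : MvPolynomial (Fin 2) ℝ →ₗ[ℝ] Lp ℝ 2 μ :=
    { toFun := fun P => (hP P).toLp _
      map_add' := fun P Q => by
        rw [← MemLp.toLp_add]
        congr 1
        funext x
        simp [polyFun]
      map_smul' := fun c P => by
        rw [RingHom.id_apply, ← MemLp.toLp_const_smul]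
        congr 1
        funext x
        simp [polyFun] }
  -- Polynomials of bounded degree have a finite-dimensional image in `L²`, so the orthogonal
  -- decomposition exists.
  obtain ⟨y, hy, z, hz, hyz⟩ := Submodule.exists_add_mem_mem_orthogonal
    (K := (MvPolynomial.restrictTotalDegree (Fin 2) ℝ m).map L) (hw.toLp w)
  obtain ⟨P, hPm, rfl⟩ := hy
  refine ⟨polyFun P, ⟨P, (MvPolynomial.mem_restrictTotalDegree _ _ _).1 hPm, ae_eq_refl _⟩,
    fun Q hQ => ?_⟩
  have h0 := (Submodule.mem_orthogonal _ z).1 hz (L Q)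
    ⟨Q, (MvPolynomial.mem_restrictTotalDegree _ _ _).2 hQ, rfl⟩
  rw [← add_sub_cancel_left (L P) z, ← hyz, L2.inner_def] at h0
  have h1 : ∫ x, (w x * polyFun Q x - polyFun P x * polyFun Q x) ∂μ = 0 := by
    rw [← h0]
    refine integral_congr_ae ?_
    filter_upwards [(hP P).coeFn_toLp, (hP Q).coeFn_toLp, hw.coeFn_toLp,
      Lp.coeFn_sub (hw.toLp w) (L P)] with x e1 e2 e3 e4
    have e5 : (L Q : Plane → ℝ) x = polyFun Q x := e2
    have e6 : (L P : Plane → ℝ) x = polyFun P x := e1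
    rw [e4, e5, Pi.sub_apply, e6, e3]
    simp
    ring
  rw [integral_sub (integrable_fun_mul hw (hP Q)) (integrable_fun_mul (hP P) (hP Q))] at h1
  linarith

theorem isPolyProj_polyProj {μ : Measure Plane} (hμ : ContinuousMemL2 μ) (m : ℕ) {w : Plane → ℝ}
    (hw : MemLp w 2 μ) : IsPolyProj m μ w (polyProj m μ w) :=
  Classical.epsilon_spec (p := IsPolyProj m μ w) (exists_isPolyProj hμ m hw)

/-- The difference of two projections agrees with an admissible polynomial; tested with itself it
has norm zero. On an edge that polynomial may be nonzero off the edge, so uniqueness is almost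
everywhere. -/
theorem IsPolyProj.unique {μ : Measure Plane} (hμ : ContinuousMemL2 μ) {m : ℕ}
    {w π π' : Plane → ℝ} (h : IsPolyProj m μ w π) (h' : IsPolyProj m μ w π') : π =ᵐ[μ] π' := by
  obtain ⟨P, hP, hPd⟩ := h.1.sub h'.1
  have hi := fun P : MvPolynomial (Fin 2) ℝ => hμ _ (continuous_polyFun P)
  have h0 : ∫ x, polyFun P x ^ 2 ∂μ = 0 := by
    have : ∫ x, (π x - π' x) * polyFun P x ∂μ = 0 := by
      simp only [sub_mul]
      rw [integral_sub (integrable_fun_mul (h.1.memLp hμ) (hi P))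
        (integrable_fun_mul (h'.1.memLp hμ) (hi P)), h.2 P hP, h'.2 P hP, sub_self]
    rw [← this]
    refine integral_congr_ae ?_
    filter_upwards [hPd] with x hx
    rw [hx, sq]
  rw [integral_eq_zero_iff_of_nonneg (fun x => sq_nonneg _) (hi P).integrable_sq] at h0
  filter_upwards [h0, hPd] with x h1 h2
  have h3 : polyFun P x = 0 := by simpa using h1
  rw [h3] at h2
  exact sub_eq_zero.1 h2

theorem IsPolyProj.congr {μ : Measure Plane} {m : ℕ} {w z π : Plane → ℝ} (h : IsPolyProj m μ w π)
    (hz : w =ᵐ[μ] z) : IsPolyProj m μ z π := by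
  refine ⟨h.1, fun Q hQ => (h.2 Q hQ).trans (integral_congr_ae ?_)⟩
  filter_upwards [hz] with x hx
  rw [hx]

theorem IsPolyProj.sub {μ : Measure Plane} (hμ : ContinuousMemL2 μ) {m : ℕ}
    {w z π ρ : Plane → ℝ} (hw : MemLp w 2 μ) (hz : MemLp z 2 μ) (h : IsPolyProj m μ w π)
    (h' : IsPolyProj m μ z ρ) : IsPolyProj m μ (fun x => w x - z x) (fun x => π x - ρ x) := by
  refine ⟨h.1.sub h'.1, fun Q hQ => ?_⟩
  have hi := hμ _ (continuous_polyFun Q)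
  simp only [sub_mul]
  rw [integral_sub (integrable_fun_mul (h.1.memLp hμ) hi) (integrable_fun_mul (h'.1.memLp hμ) hi),
    integral_sub (integrable_fun_mul hw hi) (integrable_fun_mul hz hi), h.2 Q hQ, h'.2 Q hQ]

theorem memLp_polyProj {μ : Measure Plane} (hμ : ContinuousMemL2 μ) (m : ℕ) {w : Plane → ℝ}
    (hw : MemLp w 2 μ) : MemLp (polyProj m μ w) 2 μ :=
  (isPolyProj_polyProj hμ m hw).1.memLp hμ

theorem polyProj_sub {μ : Measure Plane} (hμ : ContinuousMemL2 μ) (m : ℕ) {w z : Plane → ℝ}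
    (hw : MemLp w 2 μ) (hz : MemLp z 2 μ) :
    polyProj m μ (fun x => w x - z x) =ᵐ[μ] fun x => polyProj m μ w x - polyProj m μ z x :=
  (isPolyProj_polyProj hμ m (hw.sub hz)).unique hμ
    ((isPolyProj_polyProj hμ m hw).sub hμ hw hz (isPolyProj_polyProj hμ m hz))

theorem polyProj_congr {μ : Measure Plane} (hμ : ContinuousMemL2 μ) (m : ℕ) {w z : Plane → ℝ}
    (hw : MemLp w 2 μ) (h : w =ᵐ[μ] z) : polyProj m μ w =ᵐ[μ] polyProj m μ z :=
  ((isPolyProj_polyProj hμ m hw).congr h).unique hμ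
    (isPolyProj_polyProj hμ m ((memLp_congr_ae h).1 hw))

theorem polyProj_zero {μ : Measure Plane} (hμ : ContinuousMemL2 μ) (m : ℕ) :
    polyProj m μ (fun _ => 0) =ᵐ[μ] fun _ => 0 := by
  refine (isPolyProj_polyProj hμ m (hμ _ continuous_const)).unique hμ ⟨⟨0, by simp, ?_⟩, by simp⟩
  exact ae_of_all _ fun x => by simp [polyFun]

/-! ### The local structure of a triangle at one of its edges -/

theorem eq_bary {a b c : Plane} (hD : cross (a - c) (b - c) ≠ 0) (y : Plane) :
    y = c + bary a b c y • (a - c) + bary b a c y • (b - c) := by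
  have h : bary b a c y = cross (a - c) (y - c) / cross (a - c) (b - c) := by
    rw [bary, cross_swap a b c, ← neg_div_neg_eq, neg_neg, ← cross_swap, ]
  rw [h, bary]
  simp only [cross, PiLp.sub_apply] at hD ⊢
  ext i
  fin_cases i <;> simp <;>
    rw [add_assoc, div_mul_eq_mul_div, div_mul_eq_mul_div, ← add_div, ← sub_eq_iff_eq_add',
      eq_div_iff hD] <;> ring

theorem mem_hull_diff_pair {a b x : Plane} (hx : x ∈ hull {a, b}) (hx' : x ∉ ({a, b} : Finset Plane)) :
    ∃ s : ℝ, 0 < s ∧ s < 1 ∧ x = a + s • (b - a) := by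
  rw [hull_pair, segment_eq_image'] at hx
  obtain ⟨s, ⟨h0, h1⟩, rfl⟩ := hx
  refine ⟨s, lt_of_le_of_ne h0 ?_, lt_of_le_of_ne h1 ?_, rfl⟩
  · rintro rfl
    simp at hx'
  · rintro rfl
    simp at hx'

/-- `n` is orthogonal to the edge `e`. -/
def OrthogonalToEdge (e : Finset Plane) (n : Plane) : Prop :=
  ∀ x ∈ hull e, ∀ y ∈ hull e, inner ℝ n (y - x) = 0

theorem orthogonalToEdge_pair {a b n : Plane} (h : inner ℝ n (b - a) = 0) :
    OrthogonalToEdge {a, b} n := by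
  intro x hx y hy
  rw [hull_pair, segment_eq_image'] at hx hy
  obtain ⟨s, -, rfl⟩ := hx
  obtain ⟨r, -, rfl⟩ := hy
  have : a + r • (b - a) - (a + s • (b - a)) = (r - s) • (b - a) := by module
  rw [this, inner_smul_right, h, mul_zero]

/-- In the plane the orthogonal complement of an edge is a line, and a line has two unit vectors:
the determinant of `n`, `m` vanishes, hence their inner product is `1` or `-1`. -/
theorem eq_or_eq_neg_of_orthogonal {e : Finset Plane} (he : e.card = 2) {n m : Plane}
    (hn : ‖n‖ = 1) (hm : ‖m‖ = 1) (hn' : OrthogonalToEdge e n) (hm' : OrthogonalToEdge e m) :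
    m = n ∨ m = -n := by
  obtain ⟨a, b, hab, rfl⟩ := Finset.card_eq_two.1 he
  have ha : a ∈ hull {a, b} := subset_convexHull _ _ (by simp)
  have hb : b ∈ hull {a, b} := subset_convexHull _ _ (by simp)
  have h1 := hn' a ha b hb
  have h2 := hm' a ha b hb
  have h3 := norm_sq_plane n
  have h4 := norm_sq_plane m
  have h5 := norm_sq_plane (b - a)
  have h6 : 0 < ‖b - a‖ ^ 2 := by
    have : b - a ≠ 0 := sub_ne_zero.2 hab.symm
    positivity
  rw [h5] at h6
  rw [hn] at h3
  rw [hm] at h4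
  rw [inner_plane] at h1 h2
  generalize (b - a) 0 = p at *
  generalize (b - a) 1 = q at *
  have hdet : n 0 * m 1 - n 1 * m 0 = 0 := by
    have e1 : (n 0 * m 1 - n 1 * m 0) * p = 0 := by linear_combination m 1 * h1 - n 1 * h2
    have e2 : (n 0 * m 1 - n 1 * m 0) * q = 0 := by linear_combination n 0 * h2 - m 0 * h1
    by_contra hne
    have hp := (mul_eq_zero.1 e1).resolve_left hne
    have hq := (mul_eq_zero.1 e2).resolve_left hne
    simp [hp, hq] at h6
  have hdot : (n 0 * m 0 + n 1 * m 1 - 1) * (n 0 * m 0 + n 1 * m 1 + 1) = 0 := by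
    linear_combination (-(n 0 * m 1 - n 1 * m 0)) * hdet - (m 0 ^ 2 + m 1 ^ 2) * h3 - h4
  rcases mul_eq_zero.1 hdot with h | h
  · left
    ext i
    fin_cases i
    · simp
      linear_combination m 0 * h3 - n 1 * hdet + n 0 * h
    · simp
      linear_combination m 1 * h3 + n 0 * hdet + n 1 * h
  · right
    ext i
    fin_cases i
    · simp
      linear_combination m 0 * h3 - n 1 * hdet + n 0 * h
    · simp
      linear_combination m 1 * h3 + n 0 * hdet + n 1 * h

/-- The properties of the outward normal of a triangle on one of its edges. -/
theorem IsTriangle.normal_spec {K e : Finset Plane} (hK : IsTriangle K) (he : e ∈ sides K) :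
    ‖outwardNormal K e‖ = 1 ∧ OrthogonalToEdge e (outwardNormal K e) ∧
      (∀ x ∈ hull e, ∀ y ∈ hull K, inner ℝ (outwardNormal K e) (y - x) ≤ 0) ∧
      (∀ x ∈ hull e, x ∉ e → ∀ᶠ y in 𝓝 x, inner ℝ (outwardNormal K e) (y - x) ≤ 0 → y ∈ hull K) := by
  obtain ⟨a, b, c, hab, hac, hbc, rfl, rfl, hD⟩ := hK.exists_opposite he
  obtain ⟨n1, n2, n3⟩ := outwardNormal_spec hac hbc hD
  set n := outwardNormal {a, b, c} {a, b} with hn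
  have horth := orthogonalToEdge_pair n2
  have hset : ((({a, b, c} : Finset Plane) : Set Plane)) = {a, b, c} := by simp
  have ha : a ∈ hull {a, b} := subset_convexHull _ _ (by simp)
  have hbase : ∀ x ∈ hull {a, b}, ∀ y, inner ℝ n (y - x) = inner ℝ n (y - a) := by
    intro x hx y
    have := horth a ha x hx
    have e : y - x = (y - a) - (x - a) := by abel
    rw [e, inner_sub_right, this, sub_zero]
  have hcoord : ∀ s r : ℝ, inner ℝ n (c + s • (a - c) + r • (b - c) - a) =
      (1 - s - r) * inner ℝ n (c - a) := by
    intro s r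
    have e : c + s • (a - c) + r • (b - c) - a = (1 - s - r) • (c - a) + r • (b - a) := by module
    rw [e, inner_add_right, inner_smul_right, inner_smul_right, n2, mul_zero, add_zero]
  refine ⟨n1, horth, ?_, ?_⟩
  · intro x hx y hy
    rw [hbase x hx]
    rw [hull, hset] at hy
    obtain ⟨s, r, hs, hr, hsr, rfl⟩ := mem_convexHull_triple.1 hy
    rw [hcoord]
    exact mul_nonpos_of_nonneg_of_nonpos (by linarith) n3.le
  · intro x hx hxe
    have hD' : cross (b - c) (a - c) ≠ 0 := by rw [cross_swap]; simpa
    obtain ⟨s, hs0, hs1, rfl⟩ := mem_hull_diff_pair hx hxe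
    have v1 : bary a b c (a + s • (b - a)) = 1 - s := by
      simp only [bary, cross, PiLp.sub_apply, PiLp.add_apply, PiLp.smul_apply, smul_eq_mul] at hD ⊢
      rw [div_eq_iff hD]
      ring
    have v2 : bary b a c (a + s • (b - a)) = s := by
      simp only [bary, cross, PiLp.sub_apply, PiLp.add_apply, PiLp.smul_apply, smul_eq_mul] at hD' ⊢
      rw [div_eq_iff hD']
      ring
    -- Inside the edge the coordinates of `a` and `b` are positive and stay so nearby; the
    -- half-plane condition is the sign of the third one.
    have c1 := ((contDiff_bary a b c).continuous.tendsto (a + s • (b - a))).eventually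
      (lt_mem_nhds (a := 0) (by rw [v1]; linarith))
    have c2 := ((contDiff_bary b a c).continuous.tendsto (a + s • (b - a))).eventually
      (lt_mem_nhds (a := 0) (by rw [v2]; linarith))
    filter_upwards [c1, c2] with y h1 h2 h3
    rw [hbase _ hx, eq_bary hD y, hcoord] at h3
    rw [hull, hset, mem_convexHull_triple]
    refine ⟨_, _, h1.le, h2.le, ?_, eq_bary hD y⟩
    nlinarith

theorem eventually_shift (x n : Plane) {p : Plane → Prop} (h : ∀ᶠ y in 𝓝 x, p y) :
    ∃ δ : ℝ, 0 < δ ∧ p (x + δ • n) := by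
  have hc : Tendsto (fun δ : ℝ => x + δ • n) (𝓝[>] 0) (𝓝 x) := by
    have : Continuous fun δ : ℝ => x + δ • n := by fun_prop
    have h2 := this.tendsto 0
    simp only [zero_smul, add_zero] at h2
    exact h2.mono_left nhdsWithin_le_nhds
  obtain ⟨δ, h1, h2⟩ := ((hc.eventually h).and self_mem_nhdsWithin).exists
  exact ⟨δ, h2, h1⟩

theorem inner_add_smul_self {n : Plane} (hn : ‖n‖ = 1) (x : Plane) (δ : ℝ) :
    inner ℝ n (x + δ • n - x) = δ := by
  rw [add_sub_cancel_left, inner_smul_right, real_inner_self_eq_norm_sq, hn]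
  ring

/-- An interior point on an edge could be moved slightly along the outward normal without leaving
the triangle. -/
theorem IsTriangle.cell_disjoint_hull {K e : Finset Plane} (hK : IsTriangle K) (he : e ∈ sides K) :
    Disjoint (cell K) (hull e) := by
  rw [Set.disjoint_left]
  intro x hx hxe
  obtain ⟨h1, h2, h3, -⟩ := hK.normal_spec he
  have hev : ∀ᶠ y in 𝓝 x, y ∈ hull K := mem_interior_iff_mem_nhds.1 hx
  obtain ⟨δ, hδ, hy⟩ := eventually_shift x (outwardNormal K e) hev
  have := h3 x hxe _ hy
  rw [inner_add_smul_self h1] at this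
  linarith

/-! ### The structure of a triangulation -/

namespace Triangulation

variable {Ω : Set Plane} (T : Triangulation Ω)

theorem mem_triangles {K : Finset Plane} : K ∈ T.triangles ↔ K ∈ T.faces ∧ K.card = 3 := by
  simp [triangles]

theorem mem_edges {e : Finset Plane} : e ∈ T.edges ↔ e ∈ T.faces ∧ e.card = 2 := by
  simp [edges]

theorem isTriangle {K : Finset Plane} (hK : K ∈ T.triangles) : IsTriangle K :=
  ⟨(T.mem_triangles.1 hK).2, T.indep (T.mem_triangles.1 hK).1⟩

theorem side_mem_edges {K e : Finset Plane} (hK : K ∈ T.triangles) (he : e ∈ sides K) :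
    e ∈ T.edges := by
  obtain ⟨h1, h2⟩ := Finset.mem_powersetCard.1 he
  refine T.mem_edges.2 ⟨T.down_closed (T.mem_triangles.1 hK).1 h1 ?_, h2⟩
  rw [← Finset.card_pos]
  omega

theorem hull_inter_subset {s t : Finset Plane} (hs : s ∈ T.faces) (ht : t ∈ T.faces) :
    hull s ∩ hull t ⊆ hull (s ∩ t) := by
  classical
  have := T.inter_subset_convexHull hs ht
  rw [hull, hull, hull]
  push_cast
  exact this

theorem closure_eq : closure Ω = ⋃ K ∈ T.triangles, hull K := by
  rw [← T.space_eq]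
  ext x
  simp only [Set.mem_iUnion, exists_prop, Geometry.SimplicialComplex.mem_space_iff]
  constructor
  · rintro ⟨s, hs, hx⟩
    obtain ⟨K, hK, hK3, hsK⟩ := T.pure_faces s hs
    exact ⟨K, T.mem_triangles.2 ⟨hK, hK3⟩, convexHull_mono (by exact_mod_cast hsK) hx⟩
  · rintro ⟨K, hK, hx⟩
    exact ⟨K, (T.mem_triangles.1 hK).1, hx⟩

theorem hull_subset {K : Finset Plane} (hK : K ∈ T.triangles) : hull K ⊆ closure Ω := by
  rw [T.closure_eq]
  exact Set.subset_biUnion_of_mem (u := fun K => hull K) hK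

theorem cell_subset (hΩ : interior (closure Ω) = Ω) {K : Finset Plane} (hK : K ∈ T.triangles) :
    cell K ⊆ Ω := by
  rw [← hΩ]
  exact interior_mono (T.hull_subset hK)

/-- By conformity two triangles meet in the hull of their common vertices, at most two in number.
This lies in a side of the first triangle, which its open cell avoids. -/
theorem pairwise_disjoint_cell :
    (T.triangles : Set (Finset Plane)).Pairwise (Function.onFun Disjoint cell) := by
  classical
  intro K hK K' hK' hne
  have h3 := (T.mem_triangles.1 hK).2
  have h3' := (T.mem_triangles.1 hK').2
  have hsub : K ∩ K' ⊆ K := Finset.inter_subset_left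
  have hcard : (K ∩ K').card ≤ 2 := by
    by_contra hcon
    have e1 : K ∩ K' = K := Finset.eq_of_subset_of_card_le hsub (by omega)
    have e2 : K ⊆ K' := e1 ▸ Finset.inter_subset_right
    exact hne (Finset.eq_of_subset_of_card_le e2 (by omega))
  obtain ⟨e, he1, he2, he3⟩ := Finset.exists_subsuperset_card_eq hsub hcard (by omega)
  have hdisj := (T.isTriangle hK).cell_disjoint_hull (Finset.mem_powersetCard.2 ⟨he2, he3⟩)
  refine Set.disjoint_left.2 fun x hx hx' => Set.disjoint_left.1 hdisj hx ?_
  exact convexHull_mono (by exact_mod_cast he1) (T.hull_inter_subset (T.mem_triangles.1 hK).1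
    (T.mem_triangles.1 hK').1 ⟨interior_subset hx, interior_subset hx'⟩)

/-- The triangles cover `Ω`, and what the open cells miss is contained in their boundaries, which
are null because the triangles are convex. -/
theorem ae_eq_biUnion_cell (hΩ : interior (closure Ω) = Ω) :
    Ω =ᵐ[volume] ⋃ K ∈ T.triangles, cell K := by
  refine ae_eq_set.2 ⟨?_, ?_⟩
  · have hsub : Ω \ ⋃ K ∈ T.triangles, cell K ⊆ ⋃ K ∈ T.triangles, (hull K \ cell K) := by
      rintro x ⟨hx, hx'⟩
      have := subset_closure hx
      rw [T.closure_eq] at this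
      simp only [Set.mem_iUnion, exists_prop, not_exists, not_and] at this hx' ⊢
      obtain ⟨K, hK, hxK⟩ := this
      exact ⟨K, hK, hxK, hx' K hK⟩
    refine measure_mono_null hsub ?_
    exact (measure_biUnion_null_iff T.triangles.countable_toSet).2
      fun K _ => (ae_eq_set.1 (cell_ae_eq_hull K)).2
  · have : (⋃ K ∈ T.triangles, cell K) \ Ω = ∅ := by
      rw [Set.sdiff_eq_empty]
      exact Set.iUnion₂_subset fun K hK => T.cell_subset hΩ hK
    rw [this, measure_empty]

theorem integral_eq_sum (hΩ : interior (closure Ω) = Ω) {F : Plane → ℝ}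
    (hF : ∀ K ∈ T.triangles, IntegrableOn F (cell K)) :
    ∫ x in Ω, F x = ∑ K ∈ T.triangles, ∫ x in cell K, F x := by
  rw [setIntegral_congr_set (T.ae_eq_biUnion_cell hΩ)]
  exact integral_biUnion_finset _ (fun K _ => (isOpen_cell K).measurableSet)
    T.pairwise_disjoint_cell hF

open Classical in
/-- The triangles that have the edge `e`. -/
def around (e : Finset Plane) : Finset (Finset Plane) := T.triangles.filter (fun K => e ∈ sides K)

theorem mem_around {e K : Finset Plane} : K ∈ T.around e ↔ K ∈ T.triangles ∧ e ∈ sides K := by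
  simp [around]

theorem around_nonempty {e : Finset Plane} (he : e ∈ T.edges) : (T.around e).Nonempty := by
  obtain ⟨h1, h2⟩ := T.mem_edges.1 he
  obtain ⟨K, hK, hK3, hsub⟩ := T.pure_faces e h1
  exact ⟨K, T.mem_around.2 ⟨T.mem_triangles.2 ⟨hK, hK3⟩, Finset.mem_powersetCard.2 ⟨hsub, h2⟩⟩⟩

theorem hull_inter_hull_subset {e e' : Finset Plane} (he : e ∈ T.edges) (he' : e' ∈ T.edges)
    (hne : e ≠ e') : hull e ∩ hull e' ⊆ e := by
  classical
  obtain ⟨h1, h2⟩ := T.mem_edges.1 he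
  obtain ⟨h1', h2'⟩ := T.mem_edges.1 he'
  have hcard : (e ∩ e').card ≤ 1 := by
    by_contra hcon
    have e1 : e ∩ e' = e := Finset.eq_of_subset_of_card_le Finset.inter_subset_left (by omega)
    have e2 : e ⊆ e' := e1 ▸ Finset.inter_subset_right
    exact hne (Finset.eq_of_subset_of_card_le e2 (by omega))
  refine (T.hull_inter_subset h1 h1').trans ?_
  have hss : ((e ∩ e' : Finset Plane) : Set Plane).Subsingleton :=
    fun a ha b hb => Finset.card_le_one.1 hcard a ha b hb
  rw [hull, hss.convex.convexHull_eq]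
  exact_mod_cast Finset.inter_subset_left

theorem exists_mem_edge_interior {e : Finset Plane} (he : e.card = 2) :
    ∃ x, x ∈ hull e ∧ x ∉ e := by
  obtain ⟨a, b, hab, rfl⟩ := Finset.card_eq_two.1 he
  refine ⟨midpoint ℝ a b, ?_, ?_⟩
  · rw [hull_pair]
    exact midpoint_mem_segment a b
  · simp [hab]

theorem mem_around_of_mem_hull {e K : Finset Plane} (he : e ∈ T.edges) (hK : K ∈ T.triangles)
    {x : Plane} (hx : x ∈ hull e) (hxe : x ∉ e) (hxK : x ∈ hull K) : K ∈ T.around e := by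
  classical
  obtain ⟨h1, h2⟩ := T.mem_edges.1 he
  refine T.mem_around.2 ⟨hK, Finset.mem_powersetCard.2 ⟨?_, h2⟩⟩
  by_contra hnot
  have hcard : (e ∩ K).card ≤ 1 := by
    by_contra hcon
    have e1 : e ∩ K = e := Finset.eq_of_subset_of_card_le Finset.inter_subset_left (by omega)
    exact hnot (e1 ▸ Finset.inter_subset_right)
  have hss : ((e ∩ K : Finset Plane) : Set Plane).Subsingleton :=
    fun a ha b hb => Finset.card_le_one.1 hcard a ha b hb
  have := T.hull_inter_subset h1 (T.mem_triangles.1 hK).1 ⟨hx, hxK⟩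
  rw [hull, hss.convex.convexHull_eq] at this
  exact hxe (Finset.inter_subset_left (Finset.mem_coe.1 this))

/-- A triangle that does not have the edge `e` misses `x` by conformity; it is closed, so it misses
a neighbourhood of `x`. -/
theorem eventually_mem_around {e : Finset Plane} (he : e ∈ T.edges) {x : Plane}
    (hx : x ∈ hull e) (hxe : x ∉ e) :
    ∀ᶠ y in 𝓝 x, y ∈ closure Ω → ∃ K ∈ T.around e, y ∈ hull K := by
  have h1 : ∀ K ∈ T.triangles, ∀ᶠ y in 𝓝 x, y ∈ hull K → K ∈ T.around e := by
    intro K hK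
    by_cases hxK : x ∈ hull K
    · exact Eventually.of_forall fun _ _ => T.mem_around_of_mem_hull he hK hx hxe hxK
    · have := (isCompact_hull K).isClosed.isOpen_compl.mem_nhds hxK
      filter_upwards [this] with y hy hy'
      exact absurd hy' hy
  have h2 := (Filter.eventually_all_finset T.triangles).2 h1
  filter_upwards [h2] with y hy hyc
  rw [T.closure_eq] at hyc
  simp only [Set.mem_iUnion, exists_prop] at hyc
  obtain ⟨K, hK, hyK⟩ := hyc
  exact ⟨K, hy K hK hyK, hyK⟩

/-- With equal normals both triangles would fill the same side of `e` near an inner point, and their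
intersection would leave `e`, against conformity. -/
theorem normal_eq_neg {e K K' : Finset Plane} (hK : K ∈ T.around e) (hK' : K' ∈ T.around e)
    (hne : K ≠ K') : outwardNormal K' e = - outwardNormal K e := by
  classical
  obtain ⟨hKt, heK⟩ := T.mem_around.1 hK
  obtain ⟨hKt', heK'⟩ := T.mem_around.1 hK'
  have hcard := card_of_mem_sides heK
  obtain ⟨h1, h2, h3, h4⟩ := (T.isTriangle hKt).normal_spec heK
  obtain ⟨h1', h2', h3', h4'⟩ := (T.isTriangle hKt').normal_spec heK'
  rcases eq_or_eq_neg_of_orthogonal hcard h1 h1' h2 h2' with h | h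
  swap
  · exact h
  exfalso
  obtain ⟨x, hx, hxe⟩ := exists_mem_edge_interior hcard
  obtain ⟨δ, hδ, hy1, hy2⟩ := eventually_shift x (-outwardNormal K e)
    ((h4 x hx hxe).and (h4' x hx hxe))
  have hval : inner ℝ (outwardNormal K e) (x + δ • (-outwardNormal K e) - x) = -δ := by
    rw [smul_neg, ← neg_smul]
    exact inner_add_smul_self h1 x (-δ)
  rw [h] at hy2
  have m1 := hy1 (by rw [hval]; linarith)
  have m2 := hy2 (by rw [hval]; linarith)
  have hKK : K ∩ K' = e := by
    refine (Finset.eq_of_subset_of_card_le (Finset.subset_inter (Finset.mem_powersetCard.1 heK).1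
      (Finset.mem_powersetCard.1 heK').1) ?_).symm
    rw [hcard]
    by_contra hcon
    have c3 := (T.mem_triangles.1 hKt).2
    have c3' := (T.mem_triangles.1 hKt').2
    have e1 : K ∩ K' = K := Finset.eq_of_subset_of_card_le Finset.inter_subset_left (by omega)
    have e2 : K ⊆ K' := e1 ▸ Finset.inter_subset_right
    exact hne (Finset.eq_of_subset_of_card_le e2 (by omega))
  have m3 := T.hull_inter_subset (T.mem_triangles.1 hKt).1 (T.mem_triangles.1 hKt').1 ⟨m1, m2⟩
  rw [hKK] at m3
  have := h2 x hx _ m3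
  rw [hval] at this
  linarith

/-- An edge on the boundary belongs to one triangle, and any other edge to two triangles with
opposite normals; it lies in `Ω` up to its end points. -/
theorem edge_cases (hΩ : interior (closure Ω) = Ω) {e : Finset Plane} (he : e ∈ T.edges) :
    (e ∈ T.boundaryEdges ∧ ∃ K, T.around e = {K}) ∨
      (e ∉ T.boundaryEdges ∧ (∀ x ∈ hull e, x ∉ e → x ∈ Ω) ∧
        ∃ K K', K ≠ K' ∧ T.around e = {K, K'} ∧ outwardNormal K' e = - outwardNormal K e) := by
  classical
  have hcard := (T.mem_edges.1 he).2
  have hopen : IsOpen Ω := by rw [← hΩ]; exact isOpen_interior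
  obtain ⟨K, hK⟩ := T.around_nonempty he
  obtain ⟨hKt, heK⟩ := T.mem_around.1 hK
  obtain ⟨h1, h2, h3, h4⟩ := (T.isTriangle hKt).normal_spec heK
  by_cases hone : ∀ K' ∈ T.around e, K' = K
  · left
    have har : T.around e = {K} := Finset.eq_singleton_iff_unique_mem.2 ⟨hK, hone⟩
    refine ⟨?_, K, har⟩
    rw [boundaryEdges, Finset.mem_filter]
    refine ⟨he, ?_⟩
    -- If an inner point `x` of the edge were in `Ω`, a small step along the outward normal would
    -- stay in `Ω`, hence in the only triangle at `e`, on the wrong side.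
    have hint : ∀ x ∈ hull e, x ∉ e → x ∈ frontier Ω := by
      intro x hx hxe
      rw [hopen.frontier_eq]
      refine ⟨T.hull_subset hKt (convexHull_mono
        (by exact_mod_cast (Finset.mem_powersetCard.1 heK).1) hx), fun hxΩ => ?_⟩
      obtain ⟨δ, hδ, hy1, hy2⟩ := eventually_shift x (outwardNormal K e)
        ((T.eventually_mem_around he hx hxe).and (hopen.mem_nhds hxΩ))
      obtain ⟨K', hK', hyK'⟩ := hy1 (subset_closure hy2)
      rw [hone K' hK'] at hyK'
      have := h3 x hx _ hyK'
      rw [inner_add_smul_self h1] at this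
      linarith
    obtain ⟨a, b, hab, rfl⟩ := Finset.card_eq_two.1 hcard
    -- The end points follow since the frontier is closed.
    rw [hull_pair, ← closure_openSegment]
    refine closure_minimal (fun x hx => hint x ?_ ?_) isClosed_frontier
    · rw [hull_pair]
      exact openSegment_subset_segment ℝ a b hx
    · simp only [Finset.mem_insert, Finset.mem_singleton, not_or]
      constructor
      · rintro rfl
        exact hab (left_mem_openSegment_iff.1 hx)
      · rintro rfl
        exact hab (right_mem_openSegment_iff.1 hx)
  · right
    push Not at hone
    obtain ⟨K', hK', hne⟩ := hone
    obtain ⟨hKt', heK'⟩ := T.mem_around.1 hK'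
    obtain ⟨h1', h2', h3', h4'⟩ := (T.isTriangle hKt').normal_spec heK'
    have hneg := T.normal_eq_neg hK hK' hne.symm
    -- The two triangles fill the two half-planes near `x`, so `x` is interior to the closure of
    -- `Ω`.
    have hin : ∀ x ∈ hull e, x ∉ e → x ∈ Ω := by
      intro x hx hxe
      rw [← hΩ, mem_interior_iff_mem_nhds]
      filter_upwards [h4 x hx hxe, h4' x hx hxe] with y hy hy'
      rw [hneg, inner_neg_left] at hy'
      rcases le_total (inner ℝ (outwardNormal K e) (y - x)) 0 with h | h
      · exact T.hull_subset hKt (hy h)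
      · exact T.hull_subset hKt' (hy' (by linarith))
    refine ⟨?_, hin, K, K', hne.symm, ?_, hneg⟩
    · intro hb
      obtain ⟨x, hx, hxe⟩ := exists_mem_edge_interior hcard
      have hxf := (Finset.mem_filter.1 hb).2 hx
      rw [hopen.frontier_eq] at hxf
      exact hxf.2 (hin x hx hxe)
    · ext K''
      simp only [Finset.mem_insert, Finset.mem_singleton]
      constructor
      · intro hK''
        by_contra hcon
        push Not at hcon
        -- A third triangle would have a normal opposite to both of two opposite vectors, forcing
        -- the normal to be zero.
        have g1 := T.normal_eq_neg hK hK'' hcon.1.symm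
        have g2 := T.normal_eq_neg hK' hK'' hcon.2.symm
        rw [hneg, neg_neg] at g2
        rw [g2] at g1
        have g3 : outwardNormal K e = 0 := by
          have : (2 : ℝ) • outwardNormal K e = 0 := by
            rw [two_smul]
            nth_rewrite 1 [g1]
            exact neg_add_cancel _
          exact (smul_eq_zero.1 this).resolve_left two_ne_zero
        rw [g3, norm_zero] at h1
        exact zero_ne_one h1
      · rintro (rfl | rfl)
        · exact hK
        · exact hK'

end Triangulation

/-! ### Normal traces and their jumps -/

/-- The normal component on the edge `e` of `K` of the trace of the field `w`. -/
def normalTrace (K e : Finset Plane) (w : Fin 2 → Plane → ℝ) (x : Plane) : ℝ :=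
  ∑ j, trace K e (w j) x * outwardNormal K e j

theorem IsTriangle.memLp_normalTrace {K e : Finset Plane} (hK : IsTriangle K) (he : e ∈ sides K)
    {w : Fin 2 → Plane → ℝ} (hw : ∀ j, MemSobolev 1 (cell K) (w j)) :
    MemLp (normalTrace K e w) 2 (arcLength e) :=
  memLp_finsetSum _ fun j _ => (hK.memLp_trace he (hw j)).mul_const _

theorem IsTriangle.green_normalTrace {K : Finset Plane} (hK : IsTriangle K)
    {w : Fin 2 → Plane → ℝ} (hw : ∀ j, MemSobolev 1 (cell K) (w j)) {d : Plane → ℝ}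
    (hd : (fun x => ∑ j, weakDeriv (cell K) j (w j) x) =ᵐ[volume.restrict (cell K)] d)
    {ψ : Plane → ℝ} (hψ : ContDiff ℝ ∞ ψ) :
    (∫ x in cell K, ∑ j, w j x * pderiv j ψ x) + ∫ x in cell K, d x * ψ x =
      ∑ e ∈ sides K, ∫ x, normalTrace K e w x * ψ x ∂(arcLength e) := by
  have h1 : ∀ j, Integrable (fun x => w j x * pderiv j ψ x) (volume.restrict (cell K)) := fun j =>
    integrable_fun_mul (hw j).memL2 (memL2_cell (contDiff_pderiv hψ j).continuous K)
  have h2 : ∀ j, Integrable (fun x => weakDeriv (cell K) j (w j) x * ψ x)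
      (volume.restrict (cell K)) := fun j =>
    integrable_fun_mul ((hw j).weakDeriv (isOpen_cell K) j).memL2 (memL2_cell hψ.continuous K)
  have h3 : ∫ x in cell K, d x * ψ x = ∫ x in cell K, ∑ j, weakDeriv (cell K) j (w j) x * ψ x := by
    refine integral_congr_ae ?_
    filter_upwards [hd] with x hx
    rw [← hx, Finset.sum_mul]
  rw [h3, integral_finsetSum _ fun j _ => h1 j, integral_finsetSum _ fun j _ => h2 j,
    ← Finset.sum_add_distrib, Finset.sum_congr rfl fun j _ => hK.green (hw j) hψ j,
    Finset.sum_comm]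
  refine Finset.sum_congr rfl fun e he => ?_
  have h4 : ∀ j, Integrable (fun x => trace K e (w j) x * outwardNormal K e j * ψ x)
      (arcLength e) := fun j =>
    integrable_fun_mul ((hK.memLp_trace he (hw j)).mul_const _)
      (memLp_arcLength hψ.continuous (card_of_mem_sides he))
  simp only [normalTrace, Finset.sum_mul]
  rw [integral_finsetSum _ fun j _ => h4 j]
  refine Finset.sum_congr rfl fun j _ => ?_
  rw [← integral_const_mul]
  congr 1
  funext x
  ring

theorem IsTriangle.inner_normal_tangent {K e : Finset Plane} (hK : IsTriangle K) (he : e ∈ sides K)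
    {d : Plane} (hd : IsUnitTangent e d) : inner ℝ (outwardNormal K e) d = 0 := by
  obtain ⟨-, hn, -, -⟩ := hK.normal_spec he
  obtain ⟨-, htv⟩ := hd
  obtain ⟨a, b, hab, rfl⟩ := Finset.card_eq_two.1 (card_of_mem_sides he)
  rw [Finset.coe_insert, Finset.coe_singleton, vectorSpan_pair,
    Submodule.mem_span_singleton] at htv
  obtain ⟨r, rfl⟩ := htv
  rw [inner_smul_right, vsub_eq_sub, hn b (subset_convexHull _ _ (by simp)) a
    (subset_convexHull _ _ (by simp)), mul_zero]

/-- `d` is the divergence of `w` on `D` in the sense of distributions. -/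
def IsWeakDiv (D : Set Plane) (w : Fin 2 → Plane → ℝ) (d : Plane → ℝ) : Prop :=
  ∀ φ, IsTestFunction D φ → ∫ x in D, ∑ j, w j x * pderiv j φ x = - ∫ x in D, d x * φ x

theorem IsWeakDiv.mono {D D' : Set Plane} {w : Fin 2 → Plane → ℝ} {d : Plane → ℝ}
    (h : IsWeakDiv D w d) (hD : D' ⊆ D) : IsWeakDiv D' w d := by
  intro φ hφ
  have h1 := h φ (hφ.mono hD)
  rw [(hφ.mono hD).setIntegral, setIntegral_eq_integral_of_forall_compl_eq_zero] at h1
  · rw [hφ.setIntegral, ← h1, setIntegral_eq_integral_of_forall_compl_eq_zero]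
    intro x hx
    simp [(hφ.pderiv _).eq_zero hx]
  · intro x hx
    simp [((hφ.mono hD).pderiv _).eq_zero hx]

theorem IsWeakDiv.sum_weakDeriv_ae_eq {D : Set Plane} (hD : IsOpen D) {w : Fin 2 → Plane → ℝ}
    {d : Plane → ℝ} (h : IsWeakDiv D w d) (hw : ∀ j, MemSobolev 1 D (w j)) (hd : MemL2 D d) :
    (fun x => ∑ j, weakDeriv D j (w j) x) =ᵐ[volume.restrict D] d := by
  have hl : MemL2 D fun x => ∑ j, weakDeriv D j (w j) x :=
    memLp_finsetSum _ fun j _ => ((hw j).weakDeriv hD j).memL2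
  refine ae_eq_of_forall_testFunction hD hl.locallyIntegrableOn hd.locallyIntegrableOn
    fun φ hφ => ?_
  have h1 := h φ hφ
  rw [integral_finsetSum _ fun j _ =>
    ((hφ.pderiv j).integrable (hw j).memL2.locallyIntegrableOn).restrict,
    Finset.sum_congr rfl fun j _ => ((hw j).isWeakDeriv j).2.2 φ hφ, Finset.sum_neg_distrib,
    neg_inj] at h1
  rw [← h1]
  simp only [Finset.sum_mul]
  exact integral_finsetSum _ fun j _ =>
    (hφ.integrable ((hw j).weakDeriv hD j).memL2.locallyIntegrableOn).restrict

theorem ae_notMem_vertices (e : Finset Plane) : ∀ᵐ x ∂(arcLength e), x ∉ e := by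
  have : (μH[1] : Measure Plane) (e : Set Plane) = 0 := by
    have := Measure.nullSingletonClass_hausdorff Plane (d := 1) one_pos
    exact e.finite_toSet.measure_zero _
  exact ae_restrict_of_ae (measure_eq_zero_iff_ae_notMem.1 this)

theorem measurableSet_hull (s : Finset Plane) : MeasurableSet (hull s) :=
  (isCompact_hull s).isClosed.measurableSet

theorem ae_mem_hull (e : Finset Plane) : ∀ᵐ x ∂(arcLength e), x ∈ hull e :=
  ae_restrict_mem (measurableSet_hull e)

namespace Triangulation

variable {Ω : Set Plane} (T : Triangulation Ω)

/-- Removing the other edges from `U` leaves an open set that contains `e` up to its end points,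
because two edges share at most a vertex. Test functions on this set see one edge only. -/
theorem ae_eq_zero_on_edge {e : Finset Plane} (he : e ∈ T.edges) {U : Set Plane} (hU : IsOpen U)
    (heU : ∀ x ∈ hull e, x ∉ e → x ∈ U) {f : Plane → ℝ} (hf : MemLp f 2 (arcLength e))
    (h : ∀ φ, IsTestFunction U φ → (∀ e' ∈ T.edges, e' ≠ e → ∀ x ∈ hull e', φ x = 0) →
      ∫ x, f x * φ x ∂(arcLength e) = 0) : f =ᵐ[arcLength e] 0 := by
  have hfin := isFiniteMeasure_arcLength (T.mem_edges.1 he).2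
  set V : Set Plane := U ∩ ⋂ e' ∈ T.edges.erase e, (hull e')ᶜ with hV
  have hVo : IsOpen V := hU.inter (isOpen_biInter_finset fun e' _ =>
    (isCompact_hull e').isClosed.isOpen_compl)
  have h0 := hVo.ae_eq_zero_of_integral_contDiff_smul_eq_zero (f := f) (μ := arcLength e)
    ((hf.integrable (by norm_num)).locallyIntegrable.locallyIntegrableOn V) (fun φ h1 h2 h3 => by
      simp only [smul_eq_mul, mul_comm (φ _)]
      refine h φ ⟨h1, h2, h3.trans Set.inter_subset_left⟩ fun e' he' hne x hx => ?_
      refine image_eq_zero_of_notMem_tsupport fun hx' => ?_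
      have := (h3 hx').2
      simp only [Set.mem_iInter] at this
      exact this e' (Finset.mem_erase.2 ⟨hne, he'⟩) hx)
  filter_upwards [h0, ae_notMem_vertices e, ae_mem_hull e] with x hx hxe hxh
  refine hx ⟨heU x hxh hxe, ?_⟩
  simp only [Set.mem_iInter]
  intro e' he' hx'
  obtain ⟨hne, he'⟩ := Finset.mem_erase.1 he'
  exact hxe (T.hull_inter_hull_subset he he' hne.symm ⟨hxh, hx'⟩)

theorem green_sum (hΩ : interior (closure Ω) = Ω) {w : Fin 2 → Plane → ℝ}
    (hw : ∀ K ∈ T.triangles, ∀ j, MemSobolev 1 (cell K) (w j)) {d : Plane → ℝ} (hd : MemL2 Ω d)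
    (h : IsWeakDiv Ω w d) {ψ : Plane → ℝ} (hψ : ContDiff ℝ ∞ ψ) :
    (∫ x in Ω, ∑ j, w j x * pderiv j ψ x) + ∫ x in Ω, d x * ψ x =
      ∑ K ∈ T.triangles, ∑ e ∈ sides K, ∫ x, normalTrace K e w x * ψ x ∂(arcLength e) := by
  rw [T.integral_eq_sum hΩ, T.integral_eq_sum hΩ, ← Finset.sum_add_distrib]
  · refine Finset.sum_congr rfl fun K hK => ?_
    exact (T.isTriangle hK).green_normalTrace (hw K hK)
      ((h.mono (T.cell_subset hΩ hK)).sum_weakDeriv_ae_eq (isOpen_cell K) (hw K hK)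
        (hd.mono (T.cell_subset hΩ hK))) hψ
  · intro K hK
    exact integrable_fun_mul (hd.mono (T.cell_subset hΩ hK)) (memL2_cell hψ.continuous K)
  · intro K hK
    exact integrable_finsetSum _ fun j _ => integrable_fun_mul (hw K hK j).memL2
      (memL2_cell (contDiff_pderiv hψ j).continuous K)

theorem sum_sides_eq_sum_around {e : Finset Plane} {F : Finset Plane → Finset Plane → ℝ}
    (hF : ∀ K ∈ T.triangles, ∀ e' ∈ sides K, e' ≠ e → F K e' = 0) :
    ∑ K ∈ T.triangles, ∑ e' ∈ sides K, F K e' = ∑ K ∈ T.around e, F K e := by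
  classical
  rw [around, Finset.sum_filter]
  refine Finset.sum_congr rfl fun K hK => ?_
  split_ifs with h
  · exact Finset.sum_eq_single_of_mem e h fun e' he' hne => hF K hK e' he' hne
  · exact Finset.sum_eq_zero fun e' he' => hF K hK e' he' fun heq => h (heq ▸ he')

theorem sum_sides_eq_sum_edges (F : Finset Plane → Finset Plane → ℝ) :
    ∑ K ∈ T.triangles, ∑ e ∈ sides K, F K e = ∑ e ∈ T.edges, ∑ K ∈ T.around e, F K e := by
  classical
  refine Finset.sum_comm' fun K e => ?_
  rw [mem_around]
  constructor
  · rintro ⟨h1, h2⟩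
    exact ⟨⟨h1, h2⟩, T.side_mem_edges h1 h2⟩
  · rintro ⟨h1, -⟩
    exact h1

theorem integral_arcLength_eq_zero {e' : Finset Plane} {φ : Plane → ℝ} (h : ∀ x ∈ hull e', φ x = 0)
    (f : Plane → ℝ) : ∫ x, f x * φ x ∂(arcLength e') = 0 := by
  rw [← integral_zero Plane ℝ (μ := arcLength e')]
  refine integral_congr_ae ?_
  filter_upwards [ae_mem_hull e'] with x hx
  simp [h x hx]

theorem green_around (hΩ : interior (closure Ω) = Ω) {w : Fin 2 → Plane → ℝ}
    (hw : ∀ K ∈ T.triangles, ∀ j, MemSobolev 1 (cell K) (w j)) {d : Plane → ℝ} (hd : MemL2 Ω d)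
    (h : IsWeakDiv Ω w d) {ψ : Plane → ℝ} (hψ : ContDiff ℝ ∞ ψ) {e : Finset Plane}
    (hψe : ∀ e' ∈ T.edges, e' ≠ e → ∀ x ∈ hull e', ψ x = 0) :
    (∫ x in Ω, ∑ j, w j x * pderiv j ψ x) + ∫ x in Ω, d x * ψ x =
      ∑ K ∈ T.around e, ∫ x, normalTrace K e w x * ψ x ∂(arcLength e) := by
  rw [T.green_sum hΩ hw hd h hψ]
  exact T.sum_sides_eq_sum_around fun K hK e' he' hne =>
    integral_arcLength_eq_zero (hψe e' (T.side_mem_edges hK he') hne) _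

/-- The normal traces of a field with a square integrable divergence cancel on interior edges. -/
theorem normalTrace_jump (hΩ : interior (closure Ω) = Ω) {w : Fin 2 → Plane → ℝ}
    (hw : ∀ K ∈ T.triangles, ∀ j, MemSobolev 1 (cell K) (w j)) {d : Plane → ℝ} (hd : MemL2 Ω d)
    (h : IsWeakDiv Ω w d) {e : Finset Plane} (he : e ∈ T.edges)
    (hin : ∀ x ∈ hull e, x ∉ e → x ∈ Ω) :
    (fun x => ∑ K ∈ T.around e, normalTrace K e w x) =ᵐ[arcLength e] 0 := by
  have hopen : IsOpen Ω := by rw [← hΩ]; exact isOpen_interior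
  have hm : ∀ K ∈ T.around e, MemLp (normalTrace K e w) 2 (arcLength e) := fun K hK =>
    (T.isTriangle (T.mem_around.1 hK).1).memLp_normalTrace (T.mem_around.1 hK).2
      (hw K (T.mem_around.1 hK).1)
  refine T.ae_eq_zero_on_edge he hopen hin (memLp_finsetSum _ hm) fun φ hφ hφe => ?_
  have h1 := T.green_around hΩ hw hd h hφ.1 hφe
  -- The test function has support in `Ω`, so the volume terms cancel by the definition of the weak
  -- divergence and only the edge terms are left.
  rw [h φ hφ, neg_add_cancel] at h1
  simp only [Finset.sum_mul]
  rw [integral_finsetSum, ← h1]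
  intro K hK
  exact integrable_fun_mul (hm K hK) (memLp_arcLength hφ.1.continuous (T.mem_edges.1 he).2)

end Triangulation

/-! ### The stress of the Stokes solution -/

section Stokes

variable {Ω : Set Plane} {T : Triangulation Ω} {t : Finset Plane → Plane} {ν : ℝ}
  {f : Plane → Plane} {g : Plane → ℝ} {u : Plane → Plane} {p : Plane → ℝ}

theorem IsStokesSolution.weakDeriv_ae_eq (h : IsStokesSolution T t ν f g u p)
    (hΩ : interior (closure Ω) = Ω) {K : Finset Plane} (hK : K ∈ T.triangles) (i j : Fin 2) :
    weakDeriv (cell K) j (fun y => u y i) =ᵐ[volume.restrict (cell K)]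
      weakDeriv Ω j (fun y => u y i) :=
  (((h.velocity_mem i).isWeakDeriv j).mono (T.cell_subset hΩ hK)).weakDeriv_ae_eq (isOpen_cell K)

theorem IsStokesSolution.weakDeriv_mem (h : IsStokesSolution T t ν f g u p)
    (hΩ : interior (closure Ω) = Ω) (hu : ∀ i, MemBroken T 2 (fun x => u x i))
    {K : Finset Plane} (hK : K ∈ T.triangles) (i j : Fin 2) :
    MemSobolev 1 (cell K) (weakDeriv Ω j (fun y => u y i)) :=
  (((hu i).2 K hK).weakDeriv (isOpen_cell K) j).congr (h.weakDeriv_ae_eq hΩ hK i j)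

theorem IsStokesSolution.stress_integral (h : IsStokesSolution T t ν f g u p)
    (hΩ : interior (closure Ω) = Ω) (i : Fin 2) {φ : Plane → ℝ} (hφ : IsTestFunction Ω φ) :
    ∫ x in Ω, ∑ j, stress Ω ν u p i j x * pderiv j φ x = ∫ x in Ω, f x i * φ x := by
  have hopen : IsOpen Ω := by rw [← hΩ]; exact isOpen_interior
  have hm := h.momentum i φ hφ
  have hi := fun j => (((hφ.pderiv j).integrable
    ((h.velocity_mem i).weakDeriv hopen j).memL2.locallyIntegrableOn).restrict (s := Ω))
  have hp := ((hφ.pderiv i).integrable h.pressure_mem.locallyIntegrableOn).restrict (s := Ω)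
  rw [← hm, Finset.mul_sum]
  simp only [← integral_const_mul]
  rw [← integral_finsetSum _ fun j _ => (hi j).const_mul ν, ← integral_sub
    (integrable_finsetSum _ fun j _ => (hi j).const_mul ν) hp]
  congr 1
  funext x
  simp only [stress, sub_mul, Finset.sum_sub_distrib, ite_mul, zero_mul, mul_assoc]
  simp

/-- On a triangle the momentum equation reads `∂_i p = ν Δu_i + f_i`, and the right-hand side is
square integrable because `u` is piecewise in `H²`. This is what gives the stress traces. -/
theorem IsStokesSolution.pressure_memSobolev (h : IsStokesSolution T t ν f g u p)
    (hΩ : interior (closure Ω) = Ω) (hf : ∀ i, MemL2 Ω (fun x => f x i))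
    (hu : ∀ i, MemBroken T 2 (fun x => u x i)) {K : Finset Plane} (hK : K ∈ T.triangles) :
    MemSobolev 1 (cell K) p := by
  have hsub := T.cell_subset hΩ hK
  have hp := h.pressure_mem.mono hsub
  have hH := h.weakDeriv_mem hΩ hu hK
  refine ⟨hp, fun i => ?_⟩
  set z : Fin 2 → Plane → ℝ := fun j => weakDeriv Ω j (fun y => u y i) with hz
  have hL : MemL2 (cell K) fun x => (∑ j, ν * weakDeriv (cell K) j (z j) x) + f x i :=
    (memLp_finsetSum _ fun j _ => ((hH i j).weakDeriv (isOpen_cell K) j).memL2.const_mul ν).add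
      ((hf i).mono hsub)
  refine ⟨_, ⟨hp.locallyIntegrableOn, hL.locallyIntegrableOn, fun φ hφ => ?_⟩, hL⟩
  have hm := h.momentum i φ (hφ.mono hsub)
  have e1 : ∀ j, ∫ x in Ω, weakDeriv Ω j (fun y => u y i) x * pderiv j φ x =
      - ∫ x in cell K, weakDeriv (cell K) j (z j) x * φ x := by
    intro j
    rw [((hφ.mono hsub).pderiv j).setIntegral, ← (hφ.pderiv j).setIntegral]
    exact ((hH i j).isWeakDeriv j).2.2 φ hφ
  rw [Finset.sum_congr rfl fun j _ => e1 j, ((hφ.mono hsub).pderiv i).setIntegral,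
    (hφ.mono hsub).setIntegral (fun x => f x i), ← (hφ.pderiv i).setIntegral,
    ← hφ.setIntegral (fun x => f x i)] at hm
  have hint := fun j => ((hφ.integrable
    ((hH i j).weakDeriv (isOpen_cell K) j).memL2.locallyIntegrableOn).restrict (s := cell K))
  simp only [add_mul, Finset.sum_mul, mul_assoc]
  rw [integral_add (integrable_finsetSum _ fun j _ => (hint j).const_mul ν)
    (hφ.integrable ((hf i).mono hsub).locallyIntegrableOn).restrict,
    integral_finsetSum _ fun j _ => (hint j).const_mul ν]
  simp only [integral_const_mul]
  rw [← Finset.mul_sum]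
  rw [Finset.sum_neg_distrib] at hm
  linarith

theorem IsStokesSolution.stress_memSobolev (h : IsStokesSolution T t ν f g u p)
    (hΩ : interior (closure Ω) = Ω) (hf : ∀ i, MemL2 Ω (fun x => f x i))
    (hu : ∀ i, MemBroken T 2 (fun x => u x i)) {K : Finset Plane} (hK : K ∈ T.triangles)
    (i j : Fin 2) : MemSobolev 1 (cell K) (stress Ω ν u p i j) := by
  have h1 := (h.weakDeriv_mem hΩ hu hK i j).const_mul ν
  by_cases hij : i = j
  · have h2 := h1.sub (h.pressure_memSobolev hΩ hf hu hK)
    refine h2.congr (ae_of_all _ fun x => ?_)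
    simp [stress, hij]
  · refine h1.congr (ae_of_all _ fun x => ?_)
    simp [stress, hij]

theorem IsStokesSolution.stress_memL2 (h : IsStokesSolution T t ν f g u p)
    (hΩ : interior (closure Ω) = Ω) (i j : Fin 2) : MemL2 Ω (stress Ω ν u p i j) := by
  have hopen : IsOpen Ω := by rw [← hΩ]; exact isOpen_interior
  have h1 : MemL2 Ω fun x => ν * weakDeriv Ω j (fun y => u y i) x :=
    ((h.velocity_mem i).weakDeriv hopen j).memL2.const_mul ν
  by_cases hij : i = j
  · refine MemL2.congr (MemLp.sub h1 h.pressure_mem) (ae_of_all _ fun x => ?_)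
    simp [stress, hij]
  · refine h1.congr (ae_of_all _ fun x => ?_)
    simp [stress, hij]

theorem IsStokesSolution.stress_isWeakDiv (h : IsStokesSolution T t ν f g u p)
    (hΩ : interior (closure Ω) = Ω) (i : Fin 2) :
    IsWeakDiv Ω (stress Ω ν u p i) (fun x => - f x i) := by
  intro φ hφ
  rw [h.stress_integral hΩ i hφ]
  simp [integral_neg]

/-- The normal component of the normal stress is `g` on the boundary edges. -/
theorem IsStokesSolution.normal_stress_ae_eq (h : IsStokesSolution T t ν f g u p)
    (hΩ : interior (closure Ω) = Ω) (ht : ∀ e ∈ T.edges, IsUnitTangent e (t e))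
    (hf : ∀ i, MemL2 Ω (fun x => f x i)) (hg : MemLp g 2 ((μH[1]).restrict (frontier Ω)))
    (hu : ∀ i, MemBroken T 2 (fun x => u x i)) {K e : Finset Plane} (he : e ∈ T.boundaryEdges)
    (hK : T.around e = {K}) :
    (fun x => ∑ i, normalTrace K e (stress Ω ν u p i) x * outwardNormal K e i)
      =ᵐ[arcLength e] g := by
  classical
  have hee : e ∈ T.edges := (Finset.mem_filter.1 he).1
  have hef : hull e ⊆ frontier Ω := (Finset.mem_filter.1 he).2
  obtain ⟨hKt, heK⟩ := T.mem_around.1 (hK ▸ Finset.mem_singleton_self K : K ∈ T.around e)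
  obtain ⟨hn1, hn2, -, -⟩ := (T.isTriangle hKt).normal_spec heK
  set n := outwardNormal K e with hn
  have hge : MemLp g 2 (arcLength e) := hg.mono_measure (Measure.restrict_mono hef le_rfl)
  have hS : ∀ i, MemLp (normalTrace K e (stress Ω ν u p i)) 2 (arcLength e) := fun i =>
    (T.isTriangle hKt).memLp_normalTrace heK fun j => h.stress_memSobolev hΩ hf hu hKt i j
  have hSn : MemLp (fun x => ∑ i, normalTrace K e (stress Ω ν u p i) x * n i) 2 (arcLength e) :=
    memLp_finsetSum _ fun i _ => (hS i).mul_const _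
  -- The open set is the whole plane: the edge lies on the frontier, so the test functions must not
  -- be required to vanish there.
  have hmain := T.ae_eq_zero_on_edge hee isOpen_univ (fun _ _ _ => Set.mem_univ _) (hSn.sub hge)
    fun φ hφ hφe => by
      -- The field `φ n` is admissible: on `e` it is normal, and on the other edges `φ` vanishes.
      have hflux := h.normal_flux (fun x => φ x • n) (hφ.1.smul contDiff_const) (by
        intro e' he' x hx
        by_cases hee' : e' = e
        · subst hee'
          rw [inner_smul_left, (T.isTriangle hKt).inner_normal_tangent heK (ht e' hee), mul_zero]
        · rw [hφe e' (Finset.mem_filter.1 he').1 hee' x hx, zero_smul, inner_zero_left])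
      have hpd : ∀ i j x, pderiv j (fun y => (φ y • n) i) x = n i * pderiv j φ x := by
        intro i j x
        have : (fun y => (φ y • n) i) = fun y => φ y * n i := by
          funext y
          simp
        rw [this, pderiv, fderiv_mul_const (hφ.1.differentiable (by simp) x)]
        rfl
      have hgr := fun i => T.green_around hΩ
        (fun K hK j => h.stress_memSobolev hΩ hf hu hK i j) (hf i).neg (h.stress_isWeakDiv hΩ i)
        hφ.1 hφe
      rw [hK] at hgr
      simp only [Finset.sum_singleton] at hgr
      have hφ2 : MemL2 Ω φ :=
        (hφ.1.continuous.memLp_of_hasCompactSupport hφ.2.1).restrict Ω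
      have hφ2' : ∀ j, MemL2 Ω (pderiv j φ) := fun j =>
        ((contDiff_pderiv hφ.1 j).continuous.memLp_of_hasCompactSupport
          (hφ.pderiv j).2.1).restrict Ω
      have i1 : ∀ i, Integrable (fun x => ∑ j, stress Ω ν u p i j x * pderiv j φ x)
          (volume.restrict Ω) := fun i =>
        integrable_finsetSum _ fun j _ => integrable_fun_mul (h.stress_memL2 hΩ i j) (hφ2' j)
      have i2 : ∀ i, Integrable (fun x => f x i * φ x) (volume.restrict Ω) := fun i =>
        integrable_fun_mul (hf i) hφ2
      have l1 : ∫ x in Ω, ∑ i, ∑ j, stress Ω ν u p i j x * pderiv j (fun y => (φ y • n) i) x =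
          ∑ i, n i * ∫ x in Ω, ∑ j, stress Ω ν u p i j x * pderiv j φ x := by
        simp only [← integral_const_mul]
        rw [← integral_finsetSum _ fun i _ => (i1 i).const_mul (n i)]
        congr 1
        funext x
        simp only [hpd, Finset.mul_sum]
        refine Finset.sum_congr rfl fun i _ => Finset.sum_congr rfl fun j _ => ?_
        ring
      have l2 : ∫ x in Ω, ∑ i, f x i * (φ x • n) i = ∑ i, n i * ∫ x in Ω, f x i * φ x := by
        simp only [← integral_const_mul]
        rw [← integral_finsetSum _ fun i _ => (i2 i).const_mul (n i)]
        congr 1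
        funext x
        refine Finset.sum_congr rfl fun i _ => ?_
        simp only [PiLp.smul_apply, smul_eq_mul]
        ring
      have l3 : boundaryIntegral T (fun K e x => g x * inner ℝ (φ x • n) (outwardNormal K e)) =
          ∫ x, g x * φ x ∂(arcLength e) := by
        have hterm : ∀ K' ∈ T.triangles, ∀ e' ∈ sides K', e' ≠ e →
            (if e' ∈ T.boundaryEdges then
              ∫ x, g x * inner ℝ (φ x • n) (outwardNormal K' e') ∂(arcLength e') else 0) = 0 := by
          intro K' hK' e' he' hne
          split_ifs
          · have := Triangulation.integral_arcLength_eq_zero (hφe e' (T.side_mem_edges hK' he') hne)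
              fun x => g x * inner ℝ n (outwardNormal K' e')
            rw [← this]
            congr 1
            funext x
            rw [inner_smul_left]
            simp
            ring
          · rfl
        rw [boundaryIntegral]
        simp only [Finset.sum_filter]
        rw [T.sum_sides_eq_sum_around hterm, hK, Finset.sum_singleton, if_pos he]
        congr 1
        funext x
        rw [inner_smul_left, real_inner_self_eq_norm_sq, hn1]
        simp
      rw [l1, l2, l3, ← Finset.sum_sub_distrib] at hflux
      simp only [Pi.sub_apply, sub_mul, Finset.sum_mul]
      have hφa := memLp_arcLength hφ.1.continuous (T.mem_edges.1 hee).2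
      have i3 : ∀ i, Integrable (fun x => normalTrace K e (stress Ω ν u p i) x * n i * φ x)
          (arcLength e) := fun i => integrable_fun_mul ((hS i).mul_const _) hφa
      rw [integral_sub (integrable_finsetSum _ fun i _ => i3 i) (integrable_fun_mul hge hφa),
        integral_finsetSum _ fun i _ => i3 i, ← hflux, sub_eq_zero]
      refine Finset.sum_congr rfl fun i _ => ?_
      have hgi := hgr i
      have e1 : ∫ x in Ω, (-fun x => f x i) x * φ x = - ∫ x in Ω, f x i * φ x := by
        rw [← integral_neg]
        congr 1
        funext x
        rw [Pi.neg_apply, neg_mul]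
      rw [e1, ← sub_eq_add_neg] at hgi
      rw [← mul_sub, hgi, ← integral_const_mul]
      congr 1
      funext x
      ring
  filter_upwards [hmain] with x hx
  exact sub_eq_zero.1 hx

end Stokes

/-! ### Linearity of the forms -/

/-- The common pattern of the linearity proofs: derivatives, traces and projections are subtractive
only almost everywhere, which an integral does not see. -/
theorem integral_mul_of_ae_eq_sub {μ : Measure Plane} {F f g h : Plane → ℝ}
    (hF : F =ᵐ[μ] fun x => f x - g x) (hf : MemLp f 2 μ) (hg : MemLp g 2 μ) (hh : MemLp h 2 μ) :
    ∫ x, F x * h x ∂μ = (∫ x, f x * h x ∂μ) - ∫ x, g x * h x ∂μ := by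
  rw [← integral_sub (integrable_fun_mul hf hh) (integrable_fun_mul hg hh)]
  refine integral_congr_ae ?_
  filter_upwards [hF] with x hx
  rw [hx, sub_mul]

theorem integral_sum_sum_mul {μ : Measure Plane} (ν : ℝ) {F G : Fin 2 → Fin 2 → Plane → ℝ}
    (hF : ∀ i j, MemLp (F i j) 2 μ) (hG : ∀ i j, MemLp (G i j) 2 μ) :
    ∫ x, ν * ∑ i, ∑ j, F i j x * G i j x ∂μ = ν * ∑ i, ∑ j, ∫ x, F i j x * G i j x ∂μ := by
  rw [integral_const_mul, integral_finsetSum _ fun i _ => integrable_finsetSum _ fun j _ =>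
    integrable_fun_mul (hF i j) (hG i j)]
  congr 1
  exact Finset.sum_congr rfl fun i _ => integral_finsetSum _ fun j _ =>
    integrable_fun_mul (hF i j) (hG i j)

section Trace

variable {K e : Finset Plane} {w z : Plane → Plane}

theorem IsTriangle.memLp_traceComp (hK : IsTriangle K) (he : e ∈ sides K) (d : Plane)
    (hw : ∀ i, MemSobolev 2 (cell K) (fun x => w x i)) :
    MemLp (traceComp K e d w) 2 (arcLength e) :=
  memLp_finsetSum _ fun i _ => (hK.memLp_trace he (hw i).of_succ).mul_const _

theorem IsTriangle.memLp_normalDerivTangential (hK : IsTriangle K) (he : e ∈ sides K) (d : Plane)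
    (hw : ∀ i, MemSobolev 2 (cell K) (fun x => w x i)) :
    MemLp (normalDerivTangential K e d w) 2 (arcLength e) := by
  have h : ∀ i, MemLp (fun x => ∑ j, trace K e (weakDeriv (cell K) j (fun y => w y i)) x *
      outwardNormal K e j) 2 (arcLength e) := fun i => memLp_finsetSum _ fun j _ =>
    (hK.memLp_trace he ((hw i).weakDeriv (isOpen_cell K) j)).mul_const _
  exact memLp_finsetSum _ fun i _ => (h i).mul_const _

theorem IsTriangle.trace_sub (hK : IsTriangle K) (he : e ∈ sides K) {w z : Plane → ℝ}
    (hw : MemSobolev 1 (cell K) w) (hz : MemSobolev 1 (cell K) z) :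
    trace K e (fun x => w x - z x) =ᵐ[arcLength e] fun x => trace K e w x - trace K e z x :=
  hK.trace_ae_eq he ((hK.isTrace_trace he hw).sub (hK.isTrace_trace he hz))

theorem IsTriangle.trace_congr (hK : IsTriangle K) (he : e ∈ sides K) {w z : Plane → ℝ}
    (hw : MemSobolev 1 (cell K) w) (h : w =ᵐ[volume.restrict (cell K)] z) :
    trace K e z =ᵐ[arcLength e] trace K e w :=
  hK.trace_ae_eq he ((hK.isTrace_trace he hw).congr h)

theorem IsTriangle.traceComp_sub (hK : IsTriangle K) (he : e ∈ sides K) (d : Plane)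
    (hw : ∀ i, MemSobolev 2 (cell K) (fun x => w x i))
    (hz : ∀ i, MemSobolev 2 (cell K) (fun x => z x i)) :
    traceComp K e d (fun x => w x - z x) =ᵐ[arcLength e]
      fun x => traceComp K e d w x - traceComp K e d z x := by
  have h := fun i => hK.trace_sub he (hw i).of_succ (hz i).of_succ
  filter_upwards [ae_all_iff.2 h] with x hx
  simp only [traceComp, PiLp.sub_apply, hx, sub_mul, Finset.sum_sub_distrib]

theorem IsTriangle.normalDerivTangential_sub (hK : IsTriangle K) (he : e ∈ sides K) (d : Plane)
    (hw : ∀ i, MemSobolev 2 (cell K) (fun x => w x i))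
    (hz : ∀ i, MemSobolev 2 (cell K) (fun x => z x i)) :
    normalDerivTangential K e d (fun x => w x - z x) =ᵐ[arcLength e]
      fun x => normalDerivTangential K e d w x - normalDerivTangential K e d z x := by
  have ho := isOpen_cell K
  have h : ∀ i j, trace K e (weakDeriv (cell K) j fun y => w y i - z y i) =ᵐ[arcLength e]
      fun x => trace K e (weakDeriv (cell K) j fun y => w y i) x -
        trace K e (weakDeriv (cell K) j fun y => z y i) x := fun i j =>
    (hK.trace_congr he (((hw i).weakDeriv ho j).sub ((hz i).weakDeriv ho j))
      (weakDeriv_sub ho j (hw i).of_succ (hz i).of_succ).symm).trans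
      (hK.trace_sub he ((hw i).weakDeriv ho j) ((hz i).weakDeriv ho j))
  filter_upwards [ae_all_iff.2 fun i => ae_all_iff.2 (h i)] with x hx
  simp only [normalDerivTangential, PiLp.sub_apply, hx, sub_mul, Finset.sum_sub_distrib]

end Trace

section Forms

variable {Ω : Set Plane} (T : Triangulation Ω)

/-- Piecewise `H²` velocities together with square integrable functions on the edges. -/
def MemBrokenPair (w : Plane → Plane) (w' : Plane → ℝ) : Prop :=
  ∀ K ∈ T.triangles, (∀ i, MemSobolev 2 (cell K) (fun x => w x i)) ∧
    ∀ e ∈ sides K, MemLp w' 2 (arcLength e)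

variable {T}

theorem MemDiscrete.memBrokenPair {k : ℕ} {v : Plane → Plane} {v' q : Plane → ℝ}
    (h : MemDiscrete T k v v' q) : MemBrokenPair T v v' := fun K hK =>
  ⟨fun i => (h.1.2 K hK i).memSobolev 2, fun e he => (h.2.1.1 e (T.side_mem_edges hK he)).1⟩

theorem formA_sub (t : Finset Plane → Plane) (ν τ ε : ℝ) (k : ℕ) {w z v : Plane → Plane}
    {w' z' v' : Plane → ℝ} (hw : MemBrokenPair T w w') (hz : MemBrokenPair T z z')
    (hv : MemBrokenPair T v v') :
    formA T t ν τ ε k (fun x => w x - z x) (fun x => w' x - z' x) v v' =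
      formA T t ν τ ε k w w' v v' - formA T t ν τ ε k z z' v v' := by
  rw [formA, formA, formA, ← Finset.sum_sub_distrib]
  refine Finset.sum_congr rfl fun K hK => ?_
  have hT := T.isTriangle hK
  obtain ⟨hw, hw'⟩ := hw K hK
  obtain ⟨hz, hz'⟩ := hz K hK
  obtain ⟨hv, hv'⟩ := hv K hK
  have hmem : ∀ {y : Plane → Plane}, (∀ i, MemSobolev 2 (cell K) (fun x => y x i)) → ∀ i j,
      MemLp (weakDeriv (cell K) j fun x => y x i) 2 (volume.restrict (cell K)) := fun hy i j =>
    ((hy i).weakDeriv (isOpen_cell K) j).memL2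
  have hwz : ∀ i, MemSobolev 2 (cell K) (fun x => (w x - z x) i) := fun i => (hw i).sub (hz i)
  have h1 : ∀ i j, ∫ x in cell K, weakDeriv (cell K) j (fun y => (w y - z y) i) x *
      weakDeriv (cell K) j (fun y => v y i) x = _ := fun i j =>
    integral_mul_of_ae_eq_sub (weakDeriv_sub (w := fun x => w x i) (z := fun x => z x i)
      (isOpen_cell K) j (hw i).of_succ (hz i).of_succ)
      (hmem hw i j) (hmem hz i j) (hmem hv i j)
  rw [integral_sum_sum_mul ν (hmem hwz) (hmem hv), integral_sum_sum_mul ν (hmem hw) (hmem hv),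
    integral_sum_sum_mul ν (hmem hz) (hmem hv)]
  simp only [h1, Finset.sum_sub_distrib]
  have hjump : ∀ e ∈ sides K, ∀ {y : Plane → Plane} {y' : Plane → ℝ},
      (∀ i, MemSobolev 2 (cell K) (fun x => y x i)) → (∀ e ∈ sides K, MemLp y' 2 (arcLength e)) →
      MemLp (fun x => traceComp K e (t e) y x - y' x) 2 (arcLength e) := fun e he _ _ hy hy' =>
    (hT.memLp_traceComp he (t e) hy).sub (hy' e he)
  have h2 : ∀ e ∈ sides K, (fun x => traceComp K e (t e) (fun x => w x - z x) x - (w' x - z' x))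
      =ᵐ[arcLength e] fun x => (traceComp K e (t e) w x - w' x) -
        (traceComp K e (t e) z x - z' x) := by
    intro e he
    filter_upwards [hT.traceComp_sub he (t e) hw hz] with x hx
    rw [hx]
    ring
  have e1 : ∀ e ∈ sides K, ∫ x, ν * normalDerivTangential K e (t e) (fun x => w x - z x) x *
      (traceComp K e (t e) v x - v' x) ∂(arcLength e) = _ := fun e he =>
    integral_mul_of_ae_eq_sub (f := fun x => ν * normalDerivTangential K e (t e) w x)
      (g := fun x => ν * normalDerivTangential K e (t e) z x)
      (by
        filter_upwards [hT.normalDerivTangential_sub he (t e) hw hz] with x hx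
        rw [hx, mul_sub])
      ((hT.memLp_normalDerivTangential he (t e) hw).const_mul ν)
      ((hT.memLp_normalDerivTangential he (t e) hz).const_mul ν) (hjump e he hv hv')
  have e2 : ∀ e ∈ sides K, ∫ x, ν * (traceComp K e (t e) (fun x => w x - z x) x -
      (w' x - z' x)) * normalDerivTangential K e (t e) v x ∂(arcLength e) = _ := fun e he =>
    integral_mul_of_ae_eq_sub (f := fun x => ν * (traceComp K e (t e) w x - w' x))
      (g := fun x => ν * (traceComp K e (t e) z x - z' x))
      (by
        filter_upwards [h2 e he] with x hx
        rw [hx, mul_sub])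
      ((hjump e he hw hw').const_mul ν) ((hjump e he hz hz').const_mul ν)
      (hT.memLp_normalDerivTangential he (t e) hv)
  have e3 : ∀ e ∈ sides K, ∫ x, edgeProj (k - 1) e
      (fun x => traceComp K e (t e) (fun x => w x - z x) x - (w' x - z' x)) x *
      edgeProj (k - 1) e (fun x => traceComp K e (t e) v x - v' x) x ∂(arcLength e) = _ :=
    fun e he => by
      have hc := continuousMemL2_arcLength (card_of_mem_sides he)
      -- The projection is a choice depending on the function itself, so the almost everywhere
      -- identity of the jumps must be carried through it before it can be split.
      exact integral_mul_of_ae_eq_sub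
        ((polyProj_congr hc (k - 1) (((hjump e he hw hw').sub (hjump e he hz hz')).ae_eq
          (h2 e he).symm) (h2 e he)).trans
          (polyProj_sub hc (k - 1) (hjump e he hw hw') (hjump e he hz hz')))
        (memLp_polyProj hc (k - 1) (hjump e he hw hw'))
        (memLp_polyProj hc (k - 1) (hjump e he hz hz'))
        (memLp_polyProj hc (k - 1) (hjump e he hv hv'))
  rw [Finset.sum_congr rfl e1, Finset.sum_congr rfl e2, Finset.sum_congr rfl e3]
  simp only [Finset.sum_sub_distrib, edgeProj]
  ring

theorem memLp_sum_weakDeriv {K : Finset Plane} {v : Plane → Plane}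
    (hv : ∀ i, MemSobolev 2 (cell K) (fun x => v x i)) :
    MemLp (fun x => ∑ i, weakDeriv (cell K) i (fun y => v y i) x) 2 (volume.restrict (cell K)) :=
  memLp_finsetSum _ fun i _ => ((hv i).weakDeriv (isOpen_cell K) i).memL2

theorem formB_sub_left {w z : Plane → Plane} {w' z' q : Plane → ℝ} (hw : MemBrokenPair T w w')
    (hz : MemBrokenPair T z z') (hq : ∀ K ∈ T.triangles, MemL2 (cell K) q) :
    formB T (fun x => w x - z x) q = formB T w q - formB T z q := by
  rw [formB, formB, formB, ← neg_sub_neg, neg_neg, neg_neg, ← Finset.sum_neg_distrib,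
    ← Finset.sum_sub_distrib]
  refine Finset.sum_congr rfl fun K hK => ?_
  have h := fun i => weakDeriv_sub (isOpen_cell K) i ((hw K hK).1 i).of_succ ((hz K hK).1 i).of_succ
  have := integral_mul_of_ae_eq_sub (h := q)
    (F := fun x => ∑ i, weakDeriv (cell K) i (fun y => (w y - z y) i) x) (by
      filter_upwards [ae_all_iff.2 h] with x hx
      simp only [PiLp.sub_apply, hx, Finset.sum_sub_distrib])
    (memLp_sum_weakDeriv (hw K hK).1) (memLp_sum_weakDeriv (hz K hK).1) (hq K hK)
  simp only [mul_comm (q _), this]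
  ring

theorem formB_sub_right {v : Plane → Plane} {v' p r : Plane → ℝ} (hv : MemBrokenPair T v v')
    (hp : ∀ K ∈ T.triangles, MemL2 (cell K) p) (hr : ∀ K ∈ T.triangles, MemL2 (cell K) r) :
    formB T v (fun x => p x - r x) = formB T v p - formB T v r := by
  have : ∀ K ∈ T.triangles, _ := fun K hK => integral_mul_of_ae_eq_sub
    (ae_eq_refl (fun x => p x - r x)) (hp K hK) (hr K hK) (memLp_sum_weakDeriv (hv K hK).1)
  rw [formB, formB, formB, Finset.sum_congr rfl this, Finset.sum_sub_distrib]
  ring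

theorem cellwiseProj_ae_eq (m : ℕ) (w : Plane → ℝ) {K : Finset Plane} (hK : K ∈ T.triangles) :
    cellwiseProj T m w =ᵐ[volume.restrict (cell K)] polyProj m (volume.restrict (cell K)) w := by
  filter_upwards [ae_restrict_mem (isOpen_cell K).measurableSet] with x hx
  rw [cellwiseProj, Finset.sum_eq_single_of_mem K hK, Set.indicator_of_mem hx]
  intro K' hK' hne
  exact Set.indicator_of_notMem
    (fun hx' => Set.disjoint_left.1 (T.pairwise_disjoint_cell hK' hK hne) hx' hx) _

theorem memLp_sub_cellwiseProj (m : ℕ) {w : Plane → ℝ} {K : Finset Plane} (hK : K ∈ T.triangles)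
    (hw : MemL2 (cell K) w) :
    MemLp (fun x => w x - cellwiseProj T m w x) 2 (volume.restrict (cell K)) :=
  MemLp.sub hw ((memLp_polyProj (continuousMemL2_cell K) m hw).ae_eq (cellwiseProj_ae_eq m w hK).symm)

theorem sub_cellwiseProj_sub (m : ℕ) {p r : Plane → ℝ} {K : Finset Plane} (hK : K ∈ T.triangles)
    (hp : MemL2 (cell K) p) (hr : MemL2 (cell K) r) :
    (fun x => (p x - r x) - cellwiseProj T m (fun y => p y - r y) x) =ᵐ[volume.restrict (cell K)]
      fun x => (p x - cellwiseProj T m p x) - (r x - cellwiseProj T m r x) := by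
  filter_upwards [cellwiseProj_ae_eq m p hK, cellwiseProj_ae_eq m r hK,
    cellwiseProj_ae_eq m (fun y => p y - r y) hK,
    polyProj_sub (continuousMemL2_cell K) m hp hr] with x h1 h2 h3 h4
  rw [h1, h2, h3, h4]
  ring

theorem stab_sub (hΩ : interior (closure Ω) = Ω) (ν : ℝ) (k : ℕ) {p r q : Plane → ℝ}
    (hp : ∀ K ∈ T.triangles, MemL2 (cell K) p) (hr : ∀ K ∈ T.triangles, MemL2 (cell K) r)
    (hq : ∀ K ∈ T.triangles, MemL2 (cell K) q) :
    stab T ν k (fun x => p x - r x) q = stab T ν k p q - stab T ν k r q := by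
  have h : ∀ y : Plane → ℝ, (∀ K ∈ T.triangles, MemL2 (cell K) y) → stab T ν k y q =
      1 / ν * ∑ K ∈ T.triangles, ∫ x in cell K,
        (y x - cellwiseProj T (k - 1) y x) * (q x - cellwiseProj T (k - 1) q x) := fun y hy => by
    rw [stab, T.integral_eq_sum hΩ]
    exact fun K hK => integrable_fun_mul (memLp_sub_cellwiseProj _ hK (hy K hK))
      (memLp_sub_cellwiseProj _ hK (hq K hK))
  rw [h _ hp, h _ hr, h (fun x => p x - r x) fun K hK => MemLp.sub (hp K hK) (hr K hK), ← mul_sub,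
    ← Finset.sum_sub_distrib]
  congr 1
  exact Finset.sum_congr rfl fun K hK => integral_mul_of_ae_eq_sub
    (sub_cellwiseProj_sub (k - 1) hK (hp K hK) (hr K hK))
    (memLp_sub_cellwiseProj _ hK (hp K hK)) (memLp_sub_cellwiseProj _ hK (hr K hK))
    (memLp_sub_cellwiseProj _ hK (hq K hK))

theorem formFull_sub (hΩ : interior (closure Ω) = Ω) (t : Finset Plane → Plane) (ν τ ε : ℝ) (k : ℕ)
    {w z v : Plane → Plane} {w' z' v' p r q : Plane → ℝ} (hw : MemBrokenPair T w w')
    (hz : MemBrokenPair T z z') (hv : MemBrokenPair T v v') (hp : MemL2 Ω p) (hr : MemL2 Ω r)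
    (hq : MemL2 Ω q) :
    formFull T t ν τ ε k (fun x => w x - z x) (fun x => w' x - z' x) (fun x => p x - r x) v v' q =
      formFull T t ν τ ε k w w' p v v' q - formFull T t ν τ ε k z z' r v v' q := by
  have hm : ∀ {y : Plane → ℝ}, MemL2 Ω y → ∀ K ∈ T.triangles, MemL2 (cell K) y :=
    fun hy K hK => hy.mono (T.cell_subset hΩ hK)
  rw [formFull, formFull, formFull, formA_sub t ν τ ε k hw hz hv, formB_sub_left hw hz (hm hq),
    formB_sub_right hv (hm hp) (hm hr), stab_sub hΩ ν k (hm hp) (hm hr) (hm hq)]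
  ring

end Forms

/-! ### Consistency -/

/-- Parseval's identity in the basis `n`, `d`; it splits `σn · v` into normal and tangential parts.
-/
theorem sum_mul_eq_of_orthonormal {n d : Plane} (hn : ‖n‖ = 1) (hd : ‖d‖ = 1)
    (h : inner ℝ n d = 0) (s v : Fin 2 → ℝ) :
    ∑ i, s i * v i = (∑ i, s i * n i) * (∑ i, v i * n i) + (∑ i, s i * d i) * ∑ i, v i * d i := by
  have h1 : n 0 ^ 2 + n 1 ^ 2 = 1 := by rw [← norm_sq_plane, hn, one_pow]
  have h2 : d 0 ^ 2 + d 1 ^ 2 = 1 := by rw [← norm_sq_plane, hd, one_pow]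
  rw [inner_plane] at h
  have e0 : n 0 ^ 2 = d 1 ^ 2 := by
    linear_combination (- n 0 ^ 2) * h2 + (n 0 * d 0 - n 1 * d 1) * h + (d 1 ^ 2) * h1
  have e1 : n 0 * n 1 = - (d 0 * d 1) := by
    linear_combination (- d 0 * d 1) * h1 + (n 0 * d 1 + n 1 * d 0) * h - (n 0 * n 1) * h2
  simp only [Fin.sum_univ_two]
  linear_combination (-s 0 * v 0) * (e0 + h2) - (s 0 * v 1 + s 1 * v 0) * e1 +
    (s 1 * v 1) * (e0 - h1)

/-- A discrete function agrees on the triangle with a smooth one, which may replace it, its weak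
derivatives and its trace. -/
theorem IsTriangle.green_polynomial {K : Finset Plane} (hK : IsTriangle K)
    {w : Fin 2 → Plane → ℝ} (hw : ∀ j, MemSobolev 1 (cell K) (w j)) {d : Plane → ℝ}
    (hd : (fun x => ∑ j, weakDeriv (cell K) j (w j) x) =ᵐ[volume.restrict (cell K)] d)
    {k : ℕ} {z : Plane → ℝ} (hz : IsPolyOn k (volume.restrict (cell K)) z) :
    (∫ x in cell K, ∑ j, w j x * weakDeriv (cell K) j z x) + ∫ x in cell K, d x * z x =
      ∑ e ∈ sides K, ∫ x, normalTrace K e w x * trace K e z x ∂(arcLength e) := by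
  obtain ⟨P, -, hP⟩ := hz
  have hψ := contDiff_polyFun P
  have hS := memSobolev_of_contDiff hψ K 1
  have h1 : ∀ j, weakDeriv (cell K) j z =ᵐ[volume.restrict (cell K)] pderiv j (polyFun P) :=
    fun j => (weakDeriv_congr (isOpen_cell K) hS hP.symm).symm.trans
      ((isWeakDeriv_of_contDiff (cell K) hψ j).weakDeriv_ae_eq (isOpen_cell K))
  have h := hK.green_normalTrace hw hd hψ
  convert h using 1
  · congr 1
    · refine integral_congr_ae ?_
      filter_upwards [ae_all_iff.2 h1] with x hx
      simp only [hx]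
    · refine integral_congr_ae ?_
      filter_upwards [hP] with x hx
      rw [hx]
  · refine Finset.sum_congr rfl fun e he => integral_congr_ae ?_
    filter_upwards [hK.trace_ae_eq he ((isTrace_of_contDiff he hψ).congr hP.symm)] with x hx
    rw [hx]

section Stokes

variable {Ω : Set Plane} {T : Triangulation Ω} {t : Finset Plane → Plane} {ν : ℝ}
  {f : Plane → Plane} {g : Plane → ℝ} {u : Plane → Plane} {p : Plane → ℝ}

theorem IsStokesSolution.trace_stress_ae_eq (h : IsStokesSolution T t ν f g u p)
    (hΩ : interior (closure Ω) = Ω) (hf : ∀ i, MemL2 Ω (fun x => f x i))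
    (hu : ∀ i, MemBroken T 2 (fun x => u x i)) {K e : Finset Plane} (hK : K ∈ T.triangles)
    (he : e ∈ sides K) (i j : Fin 2) :
    trace K e (stress Ω ν u p i j) =ᵐ[arcLength e] fun x =>
      ν * trace K e (weakDeriv (cell K) j (fun y => u y i)) x -
        if i = j then trace K e p x else 0 := by
  have hT := T.isTriangle hK
  have h1 := ((hT.isTrace_trace he (((hu i).2 K hK).weakDeriv (isOpen_cell K) j)).const_mul ν)
  have h2 := h.weakDeriv_ae_eq hΩ hK i j
  refine hT.trace_ae_eq he ?_
  by_cases hij : i = j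
  · simp only [hij, if_true]
    subst hij
    refine (h1.sub (hT.isTrace_trace he (h.pressure_memSobolev hΩ hf hu hK))).congr ?_
    filter_upwards [h2] with x hx
    simp [stress, hx]
  · simp only [hij, if_false, sub_zero]
    refine h1.congr ?_
    filter_upwards [h2] with x hx
    simp [stress, hx, hij]

/-- The pressure contributes `p n`, which is orthogonal to the tangent. -/
theorem IsStokesSolution.tangential_stress_ae_eq (h : IsStokesSolution T t ν f g u p)
    (hΩ : interior (closure Ω) = Ω) (ht : ∀ e ∈ T.edges, IsUnitTangent e (t e))
    (hf : ∀ i, MemL2 Ω (fun x => f x i)) (hu : ∀ i, MemBroken T 2 (fun x => u x i))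
    {K e : Finset Plane} (hK : K ∈ T.triangles) (he : e ∈ sides K) :
    (fun x => ∑ i, normalTrace K e (stress Ω ν u p i) x * t e i) =ᵐ[arcLength e]
      fun x => ν * normalDerivTangential K e (t e) u x := by
  have h0 := (T.isTriangle hK).inner_normal_tangent he (ht e (T.side_mem_edges hK he))
  rw [inner_plane] at h0
  have h1 := fun i j => h.trace_stress_ae_eq hΩ hf hu hK he i j
  filter_upwards [ae_all_iff.2 fun i => ae_all_iff.2 (h1 i)] with x hx
  simp only [normalTrace, normalDerivTangential, hx, Fin.sum_univ_two, Fin.isValue, if_true,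
    zero_ne_one, one_ne_zero, if_false]
  linear_combination (- trace K e p x) * h0

/-- Green's formula for each row of the stress, with divergence `-f_i`. The diagonal entries of `σ`
pair `p` with the divergence of `v`, so the viscous and pressure terms are integrated by parts
together. -/
theorem IsStokesSolution.green_stress (h : IsStokesSolution T t ν f g u p)
    (hΩ : interior (closure Ω) = Ω) (hf : ∀ i, MemL2 Ω (fun x => f x i))
    (hu : ∀ i, MemBroken T 2 (fun x => u x i)) {k : ℕ} {v : Plane → Plane} (hv : MemBDM T k v)
    {K : Finset Plane} (hK : K ∈ T.triangles) :
    (∫ x in cell K, ν * ∑ i, ∑ j, weakDeriv (cell K) j (fun y => u y i) x *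
        weakDeriv (cell K) j (fun y => v y i) x) -
      ∫ x in cell K, p x * ∑ i, weakDeriv (cell K) i (fun y => v y i) x =
      (∫ x in cell K, ∑ i, f x i * v x i) + ∑ e ∈ sides K,
        ∫ x, ∑ i, normalTrace K e (stress Ω ν u p i) x * trace K e (fun y => v y i) x
          ∂(arcLength e) := by
  have hT := T.isTriangle hK
  have hsub := T.cell_subset hΩ hK
  have hvS := fun i => (hv.2 K hK i).memSobolev 2
  have hvD := fun i j => ((hvS i).weakDeriv (isOpen_cell K) j).memL2
  have hS := fun i j => h.stress_memSobolev hΩ hf hu hK i j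
  have hg := fun i => hT.green_polynomial (hS i)
    (((h.stress_isWeakDiv hΩ i).mono hsub).sum_weakDeriv_ae_eq (isOpen_cell K) (hS i)
      ((hf i).neg.mono_measure (Measure.restrict_mono hsub le_rfl))) (hv.2 K hK i)
  have i1 : ∀ i, Integrable (fun x => ∑ j, stress Ω ν u p i j x *
      weakDeriv (cell K) j (fun y => v y i) x) (volume.restrict (cell K)) := fun i =>
    integrable_finsetSum _ fun j _ => integrable_fun_mul (hS i j).memL2 (hvD i j)
  have i2 : ∀ i, Integrable (fun x => f x i * v x i) (volume.restrict (cell K)) := fun i =>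
    integrable_fun_mul ((hf i).mono hsub) (hvS i).memL2
  have i3 : ∀ e ∈ sides K, ∀ i, Integrable (fun x => normalTrace K e (stress Ω ν u p i) x *
      trace K e (fun y => v y i) x) (arcLength e) := fun e he i =>
    integrable_fun_mul (hT.memLp_normalTrace he (hS i)) (hT.memLp_trace he (hvS i).of_succ)
  have l1 : (∫ x in cell K, ν * ∑ i, ∑ j, weakDeriv (cell K) j (fun y => u y i) x *
        weakDeriv (cell K) j (fun y => v y i) x) -
      ∫ x in cell K, p x * ∑ i, weakDeriv (cell K) i (fun y => v y i) x =
      ∑ i, ∫ x in cell K, ∑ j, stress Ω ν u p i j x * weakDeriv (cell K) j (fun y => v y i) x := by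
    have hp := h.pressure_mem.mono hsub
    rw [← integral_finsetSum _ fun i _ => i1 i, ← integral_sub]
    · refine integral_congr_ae ?_
      filter_upwards [ae_all_iff.2 fun i => ae_all_iff.2 (h.weakDeriv_ae_eq hΩ hK i)] with x hx
      simp only [hx, stress, Fin.sum_univ_two, Fin.isValue, if_true, zero_ne_one, one_ne_zero,
        if_false]
      ring
    · exact (integrable_finsetSum _ fun i _ => integrable_finsetSum _ fun j _ => integrable_fun_mul
        (((hu i).2 K hK).weakDeriv (isOpen_cell K) j).memL2 (hvD i j)).const_mul ν
    · exact integrable_fun_mul hp (memLp_sum_weakDeriv hvS)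
  rw [l1, integral_finsetSum _ fun i _ => i2 i,
    Finset.sum_congr rfl fun e he => integral_finsetSum _ fun i _ => i3 e he i, Finset.sum_comm,
    ← Finset.sum_add_distrib]
  refine Finset.sum_congr rfl fun i _ => ?_
  rw [← hg i]
  simp only [neg_mul, integral_neg]
  ring

/-- The flux through the edge `e` of `K` that is left over after integration by parts. -/
def residualFlux (Ω : Set Plane) (ν : ℝ) (u : Plane → Plane) (p : Plane → ℝ) (d : Plane)
    (v : Plane → Plane) (v' : Plane → ℝ) (K e : Finset Plane) (x : Plane) : ℝ :=
  (∑ i, normalTrace K e (stress Ω ν u p i) x * outwardNormal K e i) *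
      traceComp K e (outwardNormal K e) v x +
    (∑ i, normalTrace K e (stress Ω ν u p i) x * d i) * v' x

/-- The tangential part of `σn · v` is `ν (∂_n u)_t v_t`, so subtracting the consistency term
cancels `v_t` and leaves the single-valued `v'`. -/
theorem IsStokesSolution.integral_normalTrace_stress (h : IsStokesSolution T t ν f g u p)
    (hΩ : interior (closure Ω) = Ω) (ht : ∀ e ∈ T.edges, IsUnitTangent e (t e))
    (hf : ∀ i, MemL2 Ω (fun x => f x i)) (hu : ∀ i, MemBroken T 2 (fun x => u x i))
    {v : Plane → Plane} {v' : Plane → ℝ} (hv : MemBrokenPair T v v')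
    {K e : Finset Plane} (hK : K ∈ T.triangles) (he : e ∈ sides K) :
    (∫ x, ∑ i, normalTrace K e (stress Ω ν u p i) x * trace K e (fun y => v y i) x
        ∂(arcLength e)) -
      ∫ x, ν * normalDerivTangential K e (t e) u x * (traceComp K e (t e) v x - v' x)
        ∂(arcLength e) = ∫ x, residualFlux Ω ν u p (t e) v v' K e x ∂(arcLength e) := by
  have hT := T.isTriangle hK
  have hte := ht e (T.side_mem_edges hK he)
  obtain ⟨hvS, hv'⟩ := hv K hK
  rw [← integral_sub]
  · refine integral_congr_ae ?_
    filter_upwards [h.tangential_stress_ae_eq hΩ ht hf hu hK he] with x hx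
    rw [← hx, residualFlux, sum_mul_eq_of_orthonormal (hT.normal_spec he).1 hte.1
      (hT.inner_normal_tangent he hte), traceComp, traceComp]
    ring
  · exact integrable_finsetSum _ fun i _ => integrable_fun_mul
      (hT.memLp_normalTrace he (h.stress_memSobolev hΩ hf hu hK i))
      (hT.memLp_trace he (hvS i).of_succ)
  · exact integrable_fun_mul
      ((hT.memLp_normalDerivTangential he (t e) fun i => (hu i).2 K hK).const_mul ν)
      ((hT.memLp_traceComp he (t e) hvS).sub (hv' e he))

theorem IsStokesSolution.sum_integral_residualFlux (h : IsStokesSolution T t ν f g u p)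
    (hΩ : interior (closure Ω) = Ω) (ht : ∀ e ∈ T.edges, IsUnitTangent e (t e))
    (hf : ∀ i, MemL2 Ω (fun x => f x i)) (hg : MemLp g 2 ((μH[1]).restrict (frontier Ω)))
    (hu : ∀ i, MemBroken T 2 (fun x => u x i)) {k : ℕ} {v : Plane → Plane} {v' q : Plane → ℝ}
    (hv : MemDiscrete T k v v' q) :
    ∑ K ∈ T.triangles, ∑ e ∈ sides K, ∫ x, residualFlux Ω ν u p (t e) v v' K e x ∂(arcLength e) =
      boundaryIntegral T (fun K e x => g x * traceComp K e (outwardNormal K e) v x) := by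
  classical
  simp only [boundaryIntegral, Finset.sum_filter]
  rw [T.sum_sides_eq_sum_edges fun K e => ∫ x, residualFlux Ω ν u p (t e) v v' K e x ∂(arcLength e),
    T.sum_sides_eq_sum_edges fun K e => if e ∈ T.boundaryEdges then
      ∫ x, g x * traceComp K e (outwardNormal K e) v x ∂(arcLength e) else 0]
  refine Finset.sum_congr rfl fun e he => ?_
  have hpair := hv.memBrokenPair
  rcases T.edge_cases hΩ he with ⟨hb, K, hK⟩ | ⟨hb, hin, K, K', hne, hKK, hn⟩
  · rw [hK, Finset.sum_singleton, Finset.sum_singleton, if_pos hb]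
    -- Boundary edge: `σ_nn = g` and the multiplier vanishes.
    refine integral_congr_ae ?_
    filter_upwards [h.normal_stress_ae_eq hΩ ht hf hg hu hb hK, hv.2.1.2 e hb] with x hx hx'
    rw [residualFlux, hx, hx', Pi.zero_apply, mul_zero, add_zero]
  · simp only [if_neg hb, Finset.sum_const_zero]
    rw [hKK, Finset.sum_pair hne]
    have hjS := fun i => T.normalTrace_jump hΩ
      (fun K hK j => h.stress_memSobolev hΩ hf hu hK i j) (hf i).neg (h.stress_isWeakDiv hΩ i)
      he hin
    obtain ⟨-, d, hd, hvd⟩ := hv.1.1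
    have hjv := T.normalTrace_jump hΩ (w := fun j x => v x j)
      (fun K hK j => ((hpair K hK).1 j).of_succ) hd hvd he hin
    rw [add_eq_zero_iff_eq_neg, ← integral_neg]
    refine integral_congr_ae ?_
    filter_upwards [ae_all_iff.2 hjS, hjv] with x h1 h2
    simp only [hKK, Finset.sum_pair hne, Pi.zero_apply] at h1 h2
    have h3 : ∀ i, normalTrace K' e (stress Ω ν u p i) x = - normalTrace K e (stress Ω ν u p i) x :=
      fun i => eq_neg_of_add_eq_zero_right (h1 i)
    have h4 : traceComp K' e (outwardNormal K' e) v x = - traceComp K e (outwardNormal K e) v x :=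
      eq_neg_of_add_eq_zero_right h2
    rw [hn] at h4
    -- Interior edge: `σ_nn` is unchanged since `σn` and `n` both flip, while `v_n` flips; `σ_nt`
    -- flips while the tangent and `v'` are shared.
    simp only [residualFlux, h3, hn, h4, PiLp.neg_apply, mul_neg, neg_mul, neg_neg,
      Finset.sum_neg_distrib]
    ring

theorem IsStokesSolution.formB_eq_zero (h : IsStokesSolution T t ν f g u p)
    (hΩ : interior (closure Ω) = Ω) (q : Plane → ℝ) : formB T u q = 0 := by
  rw [formB, neg_eq_zero]
  refine Finset.sum_eq_zero fun K hK => integral_eq_zero_of_ae ?_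
  filter_upwards [ae_all_iff.2 fun i => h.weakDeriv_ae_eq hΩ hK i i,
    ae_restrict_of_ae_restrict_of_subset (T.cell_subset hΩ hK) h.incompressible] with x h1 h2
  simp only [h1]
  rw [h2]
  exact mul_zero _

/-- The `ε` term and the penalty both contain the jump `w_t - w'`, which vanishes here. -/
theorem formA_eq_of_trace_eq {ε τ : ℝ} {k : ℕ} {w v : Plane → Plane} {w' v' : Plane → ℝ}
    (hw : ∀ K ∈ T.triangles, ∀ e ∈ sides K, w' =ᵐ[arcLength e] traceComp K e (t e) w) :
    formA T t ν τ ε k w w' v v' = ∑ K ∈ T.triangles,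
      ((∫ x in cell K, ν * ∑ i, ∑ j,
        weakDeriv (cell K) j (fun y => w y i) x * weakDeriv (cell K) j (fun y => v y i) x)
      - (∑ e ∈ sides K, ∫ x, ν * normalDerivTangential K e (t e) w x
          * (traceComp K e (t e) v x - v' x) ∂(arcLength e))) := by
  refine Finset.sum_congr rfl fun K hK => ?_
  have h0 : ∀ e ∈ sides K, (fun x => traceComp K e (t e) w x - w' x) =ᵐ[arcLength e]
      fun _ => 0 := by
    intro e he
    filter_upwards [hw K hK e he] with x hx
    rw [hx, sub_self]
  rw [Finset.sum_eq_zero (f := fun e => ∫ x, ν * (traceComp K e (t e) w x - w' x)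
      * normalDerivTangential K e (t e) v x ∂(arcLength e)),
    Finset.sum_eq_zero (f := fun e => ∫ x, edgeProj (k - 1) e
      (fun y => traceComp K e (t e) w y - w' y) x * edgeProj (k - 1) e
      (fun y => traceComp K e (t e) v y - v' y) x ∂(arcLength e))]
  · ring
  · intro e he
    have hc := continuousMemL2_arcLength (card_of_mem_sides he)
    refine integral_eq_zero_of_ae ?_
    filter_upwards [polyProj_congr hc (k - 1) ((hc _ continuous_const).ae_eq (h0 e he).symm)
      (h0 e he), polyProj_zero hc (k - 1)] with x h1 h2
    rw [edgeProj, h1, h2, zero_mul, Pi.zero_apply]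
  · intro e he
    refine integral_eq_zero_of_ae ?_
    filter_upwards [h0 e he] with x hx
    rw [hx, mul_zero, zero_mul, Pi.zero_apply]

/-- The method is consistent up to the stabilisation of the pressure. -/
theorem IsStokesSolution.formFull_eq (h : IsStokesSolution T t ν f g u p)
    (hΩ : interior (closure Ω) = Ω) (ht : ∀ e ∈ T.edges, IsUnitTangent e (t e))
    (hf : ∀ i, MemL2 Ω (fun x => f x i)) (hg : MemLp g 2 ((μH[1]).restrict (frontier Ω)))
    (hu : ∀ i, MemBroken T 2 (fun x => u x i)) {u' : Plane → ℝ}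
    (hu' : ∀ K ∈ T.triangles, ∀ e ∈ sides K, u' =ᵐ[arcLength e] traceComp K e (t e) u)
    (τ ε : ℝ) {k : ℕ} {v : Plane → Plane} {v' q : Plane → ℝ} (hv : MemDiscrete T k v v' q) :
    formFull T t ν τ ε k u u' p v v' q = (∫ x in Ω, ∑ i, f x i * v x i) +
      boundaryIntegral T (fun K e x => g x * traceComp K e (outwardNormal K e) v x) -
      stab T ν k p q := by
  rw [formFull, h.formB_eq_zero hΩ, formA_eq_of_trace_eq hu', formB, add_zero, ← sub_eq_add_neg,
    ← Finset.sum_sub_distrib, ← h.sum_integral_residualFlux hΩ ht hf hg hu hv,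
    T.integral_eq_sum hΩ, ← Finset.sum_add_distrib]
  · congr 1
    refine Finset.sum_congr rfl fun K hK => ?_
    rw [sub_right_comm, h.green_stress hΩ hf hu hv.1 hK, add_sub_assoc, ← Finset.sum_sub_distrib]
    congr 1
    exact Finset.sum_congr rfl fun e he =>
      h.integral_normalTrace_stress hΩ ht hf hu hv.memBrokenPair hK he
  · exact fun K hK => integrable_finsetSum _ fun i _ => integrable_fun_mul
      ((hf i).mono (T.cell_subset hΩ hK)) ((hv.memBrokenPair K hK).1 i).memL2

end Stokes

end

end StokesHDG

/-! ### The error identity: linearity combined with consistency -/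

theorem mainTheorem5
    (Ω : Set Plane) (hΩ : interior (closure Ω) = Ω) (T : Triangulation Ω)
    (t : Finset Plane → Plane) (ht : ∀ e ∈ T.edges, IsUnitTangent e (t e))
    (ν τ ε : ℝ) (hν : 0 < ν) (hτ : 0 < τ) (hε : ε = -1 ∨ ε = 1) (k : ℕ) (hk : 1 ≤ k)
    (f : Plane → Plane) (hf : ∀ i, MemL2 Ω (fun x => f x i))
    (g : Plane → ℝ) (hg : MemLp g 2 ((μH[1]).restrict (frontier Ω)))
    (u : Plane → Plane) (p : Plane → ℝ) (hup : IsStokesSolution T t ν f g u p)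
    (hu : ∀ i, MemBroken T 2 (fun x => u x i))
    (u' : Plane → ℝ)
    (hu' : ∀ K ∈ T.triangles, ∀ e ∈ sides K, u' =ᵐ[arcLength e] traceComp K e (t e) u)
    (uh : Plane → Plane) (uh' ph : Plane → ℝ)
    (huh : IsDiscreteSolution T t ν τ ε k f g uh uh' ph)
    (v : Plane → Plane) (v' q : Plane → ℝ) (hv : MemDiscrete T k v v' q) :
    formFull T t ν τ ε k (fun x => u x - uh x) (fun x => u' x - uh' x) (fun x => p x - ph x)
      v v' q = - stab T ν k p q := by
  have hpair : MemBrokenPair T u u' := fun K hK => ⟨fun i => (hu i).2 K hK, fun e he =>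
    ((T.isTriangle hK).memLp_traceComp he (t e) fun i => (hu i).2 K hK).ae_eq
      (hu' K hK e he).symm⟩
  -- The discrete and the exact solution produce the same load, so only the stabilisation of `p`
  -- survives the subtraction.
  rw [formFull_sub hΩ t ν τ ε k hpair huh.1.memBrokenPair hv.memBrokenPair hup.pressure_mem
    huh.1.2.2.1 hv.2.2.1, huh.2 v v' q hv, hup.formFull_eq hΩ ht hf hg hu hu' τ ε hv]
  ring
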